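/- Let $\mathcal M$ be a connected complex manifold of complex dimension $n$ with a Riemannian metric $g$ that is the real part of a Kähler metric, and let $m$ be its Riemannian volume measure. Let $\mathcal L\to\mathcal M$ be a holomorphic line bundle with a smooth Hermitian metric $h$, and let $\nabla$ be the connection compatible with $h$ and with the holomorphic structure, with curvature $R$. Write $J$ for the complex structure, choose pointwise $e_1,\dots,e_n$ such that $e_1,\dots,e_n,Je_1,\dots,Je_n$ is an orthonormal basis of the real tangent space, and put $\bar Z_k=(e_k+iJe_k)/\sqrt2$, $Z_k=(e_k-iJe_k)/\sqrt2$. On smooth compactly supported sections $\psi$ of $\mathcal L$ let $$\mathcal E^{\mathcal L}(\psi,\psi)=\int_{\mathcal M}\sum_{k=1}^n\bigl(h(\nabla_{e_k}\psi,\nabla_{e_k}\psi)+h(\nabla_{Je_k}\psi,\nabla_{Je_k}\psi)\bigr)\,dm,\qquad \mathcal E^{(0,\bullet)}(\psi,\psi)=\int_{\mathcal M}\sum_{k=1}^n h(\nabla_{\bar Z_k}\psi,\nabla_{\bar Z_k}\psi)\,dm$$ be the forms of the negative Bochner Laplacian and of the negative holomorphic Laplacian, let $\rho=\sum_{k=1}^n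 R_{\bar Z_k,Z_k}$ (a real function), and for a real function $q$ and $D>0$ let $$\mathcal S^{\mathcal L}_{D,q}(\psi,\psi)=D\,\mathcal E^{\mathcal L}(\psi,\psi)+(\psi,q\psi),\qquad \mathcal S^{(0,\bullet)}_{D,q}(\psi,\psi)=D\,\mathcal E^{(0,\bullet)}(\psi,\psi)+(\psi,q\psi),$$ where $(\psi,q\psi)=\int_{\mathcal M} q\,h(\psi,\psi)\,dm$; norms are those of the space $L^2(hm)$ of square-integrable sections. Theorem. Assume that $\mathcal M$ is complete. Let $D>0$, let $f:\mathcal M\to\mathbb R$ be measurable with positive and negative parts $f^\pm$, and let $\mathcal C$ be the set of smooth compactly supported sections $\psi$ with $(\psi,f^+\psi)<\infty$. Suppose that $f^-$ and $\rho$ are form-bounded perturbations of $\mathcal S^{\mathcal L}_{D,f^+}$ whose total relative lower bound is less than one, that is, there are real constants $c_1<1$, $c_2$, $a$, $b$, $\kappa<1$, $b'$ such that for all $\psi\in\mathcal C$ $$(\psi,f^-\psi)\le c_1\,\mathcal S^{\mathcal L}_{D,f^+}(\psi,\psi)+c_2\|\psi\|^2,\qquad |(\psi,D\rho\,\psi)|\le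 a\,\mathcal S^{\mathcal L}_{D,f^+}(\psi,\psi)+b\|\psi\|^2,$$ $$(\psi,(f^--D\rho)\psi)\le\kappa\,\mathcal S^{\mathcal L}_{D,f^+}(\psi,\psi)+b'\|\psi\|^2 .$$ (The third inequality follows from the first two if $c_1+a<1$, for instance if $\rho$ is infinitesimally form-bounded.) Let the form domain $\mathcal Q$ be the set of $\psi\in L^2(hm)$ for which there is a sequence in $\mathcal C$ that converges to $\psi$ in $L^2(hm)$ and is Cauchy with respect to $\mathcal S^{\mathcal L}_{D,f^+}$. Then: (1) The form $\mathcal S^{(0,\bullet)}_{2D,f}$, extended from $\mathcal C$ to $\mathcal Q$ by limits, is semibounded: there is $c\in\mathbb R$ such that for every $\psi\in\mathcal Q$ and every such approximating sequence $(u_l)$ the limit $\lim_l\mathcal S^{(0,\bullet)}_{2D,f}(u_l,u_l)$ exists and is at least $c\|\psi\|^2$. (2) On the space $L^2_{hol}(hm)$ of square-integrable holomorphic sections, the Berezin–Toeplitz form $t_f(\psi,\phi)=\int_{\mathcal M} f\,h(\psi,\phi)\,dm$ with domain $\{\psi\in L^2_{hol}(hm):\int_{\mathcal M}|f|\,h(\psi,\psi)\,dm<\infty\}$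 is semibounded and closed (its domain is complete in the form norm). -/

import Mathlib

open Bundle MeasureTheory Filter Topology Set
open scoped Manifold ContDiff

noncomputable section

namespace BerezinToeplitz

/-- The model space `ℂⁿ` of an `n`-dimensional complex manifold. -/
abbrev Cn (n : ℕ) : Type := EuclideanSpace ℂ (Fin n)

/-- A complex (holomorphic) manifold is a real analytic manifold. -/
instance realManifold {n : ℕ} {M : Type*} [TopologicalSpace M] [ChartedSpace (Cn n) M]
    [h : IsManifold 𝓘(ℂ, Cn n) ω M] : IsManifold 𝓘(ℝ, Cn n) ω M := by
  refine isManifold_of_contDiffOn 𝓘(ℝ, Cn n) ω M fun e e' he he' => ?_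
  have h1 : e.symm ≫ₕ e' ∈ contDiffGroupoid ω 𝓘(ℂ, Cn n) := HasGroupoid.compatible he he'
  rw [contDiffGroupoid, mem_groupoid_of_pregroupoid] at h1
  have h2 := h1.1
  simp only [contDiffPregroupoid, modelWithCornersSelf_coe,
    modelWithCornersSelf_coe_symm, Function.comp_id, Function.id_comp, Set.preimage_id,
    Set.range_id, Set.inter_univ] at h2 ⊢
  exact h2.restrict_scalars ℝ

section Kahler

/-! ### The base manifold -/

variable {n : ℕ} {M : Type*} [TopologicalSpace M] [ChartedSpace (Cn n) M]

/-- The real tangent space at `x`. As always in Mathlib it is a copy of the model space `ℂⁿ`,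
identified with it through the preferred chart `chartAt x`. -/
abbrev T (n : ℕ) {M : Type*} [TopologicalSpace M] [ChartedSpace (Cn n) M] (x : M) : Type :=
  TangentSpace 𝓘(ℝ, Cn n) x

/-- The almost complex structure `J` on `T_x M`: multiplication by `i` (charts are holomorphic). -/
def J {x : M} (v : T n x) : T n x := (fun w : Cn n => Complex.I • w) v

/-- The real tangent vector at `(chartAt x₀)⁻¹ y` that has the coordinates `v` in `chartAt x₀`. -/
def coordVec (x₀ : M) (y v : Cn n) : T n ((chartAt (Cn n) x₀).symm y) :=
  mfderiv 𝓘(ℝ, Cn n) 𝓘(ℝ, Cn n) (chartAt (Cn n) x₀).symm y v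

variable [RiemannianBundle (fun x : M => TangentSpace 𝓘(ℝ, Cn n) x)]

/-- The coordinate expression `g_y(v, w)` of the Riemannian metric in the chart `chartAt x₀`. -/
def gChart (x₀ : M) (y v w : Cn n) : ℝ := inner ℝ (coordVec x₀ y v) (coordVec x₀ y w)

/-- The coordinate expression of the fundamental two-form `ω(v, w) = g(J v, w)`. -/
def omegaChart (x₀ : M) (y v w : Cn n) : ℝ := gChart x₀ y (Complex.I • v) w

/-- The Riemannian metric `g` is the real part of a Kähler metric: it is compatible with `J`
and `dω = 0`. -/
structure IsKahler (n : ℕ) (M : Type*) [TopologicalSpace M] [ChartedSpace (Cn n) M]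
    [RiemannianBundle (fun x : M => TangentSpace 𝓘(ℝ, Cn n) x)] : Prop where
  inner_J : ∀ (x : M) (v w : T n x), inner ℝ (J v) (J w) = inner ℝ v w
  closed : ∀ (x₀ : M), ∀ y ∈ (chartAt (Cn n) x₀).target, ∀ u v w : Cn n,
    fderiv ℝ (fun z => omegaChart x₀ z v w) y u + fderiv ℝ (fun z => omegaChart x₀ z w u) y v
      + fderiv ℝ (fun z => omegaChart x₀ z u v) y w = 0

/-- The real basis `∂/∂x₁, …, ∂/∂xₙ, ∂/∂y₁, …, ∂/∂yₙ` of `ℂⁿ`. -/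
def realBasis (n : ℕ) : Fin n ⊕ Fin n → Cn n :=
  Sum.elim (fun k => EuclideanSpace.single k 1) (fun k => EuclideanSpace.single k Complex.I)

/-- The Riemannian volume density `√(det g)` in the chart `chartAt x₀`. -/
def volDensity (x₀ : M) (y : Cn n) : ℝ :=
  Real.sqrt (Matrix.det (Matrix.of fun i j => gChart x₀ y (realBasis n i) (realBasis n j)))

/-- The measure `√(det g) dλ` of the chart `chartAt x₀`, transported to the domain of the chart
(and zero elsewhere). -/
def chartMeasure [MeasurableSpace M] (x₀ : M) : Measure M :=
  Measure.map (chartAt (Cn n) x₀).symm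
    (((volume : Measure (Cn n)).restrict (chartAt (Cn n) x₀).target).withDensity
      fun y => ENNReal.ofReal (volDensity x₀ y))

/-- The Riemannian volume measure `m`. By the change of variables formula the measures
`chartMeasure x₀` agree on the overlaps of the chart domains, and their supremum is the
measure obtained from them by glueing. -/
def volMeasure (n : ℕ) (M : Type*) [TopologicalSpace M] [ChartedSpace (Cn n) M]
    [RiemannianBundle (fun x : M => TangentSpace 𝓘(ℝ, Cn n) x)] [MeasurableSpace M] :
    Measure M :=
  ⨆ x₀ : M, chartMeasure (n := n) x₀

/-- `e₁, …, eₙ` is a unitary frame at `x`, that is, `e₁, …, eₙ, J e₁, …, J eₙ` is an orthonormal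
basis of the real tangent space. -/
def IsUnitaryFrame (x : M) (e : Fin n → T n x) : Prop :=
  ∀ j k, inner ℝ (e j) (e k) = (if j = k then (1 : ℝ) else 0) ∧ inner ℝ (e j) (J (e k)) = (0 : ℝ)

/-- A unitary frame at `x` (one exists as soon as the metric is compatible with `J`). All the
expressions below in which it occurs are traces, which do not depend on its choice. -/
def unitaryFrame (x : M) : Fin n → T n x := Classical.epsilon (IsUnitaryFrame x)

/-- The complexified tangent space; the pair `(a, b)` stands for `a + i b`. -/
abbrev TC (n : ℕ) {M : Type*} [TopologicalSpace M] [ChartedSpace (Cn n) M] (x : M) : Type :=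
  T n x × T n x

/-- The antiholomorphic vector `Z̄ = (e + i J e) / √2`. -/
def Zbar {x : M} (e : T n x) : TC n x := ((Real.sqrt 2)⁻¹ • e, (Real.sqrt 2)⁻¹ • J e)

/-- The holomorphic vector `Z = (e - i J e) / √2`. -/
def Z {x : M} (e : T n x) : TC n x := ((Real.sqrt 2)⁻¹ • e, -((Real.sqrt 2)⁻¹ • J e))

end Kahler

/-! ### The line bundle -/

section Bundle

variable {n : ℕ} {M : Type*} [TopologicalSpace M] [ChartedSpace (Cn n) M]
  {L : M → Type*} [∀ x, AddCommGroup (L x)] [∀ x, Module ℂ (L x)] [∀ x, TopologicalSpace (L x)]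
  [TopologicalSpace (TotalSpace ℂ L)] [FiberBundle ℂ L]

/-- The coordinate of the section `ψ` in the preferred trivialization at `x₀`. -/
def coord (ψ : Π x, L x) (x₀ x : M) : ℂ := (trivializationAt ℂ L x₀ ⟨x, ψ x⟩).2

/-- The local (holomorphic) frame given by the preferred trivialization at `x₀`. -/
def frame (L : M → Type*) [∀ x, AddCommGroup (L x)] [∀ x, TopologicalSpace (L x)]
    [TopologicalSpace (TotalSpace ℂ L)] [FiberBundle ℂ L] (x₀ x : M) : L x :=
  (trivializationAt ℂ L x₀).symm x 1

variable (n L) in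
/-- A smooth Hermitian metric on the fibres of the line bundle `L`, conjugate linear in the first
argument. -/
structure HermitianMetric where
  toFun : ∀ x, L x →ₗ⋆[ℂ] L x →ₗ[ℂ] ℂ
  conj_symm : ∀ x (u v : L x), (starRingEnd ℂ) (toFun x u v) = toFun x v u
  pos : ∀ x (u : L x), u ≠ 0 → 0 < (toFun x u u).re
  smooth : ∀ x₀, ContMDiffOn 𝓘(ℝ, Cn n) 𝓘(ℝ, ℂ) ∞
    (fun x => toFun x (frame L x₀ x) (frame L x₀ x)) (trivializationAt ℂ L x₀).baseSet

variable (h : HermitianMetric n L)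

/-- The function `x ↦ h_x(ψ(x), φ(x))`. -/
def hProd (ψ φ : Π x, L x) (x : M) : ℂ := h.toFun x (ψ x) (φ x)

/-- The function `x ↦ h_x(ψ(x), ψ(x))`. -/
def hSq (ψ : Π x, L x) (x : M) : ℝ := (h.toFun x (ψ x) (ψ x)).re

/-- `log h(s, s)` for the preferred holomorphic frame `s` at `x`, in the chart `chartAt x`. -/
def logH (x : M) (y : Cn n) : ℝ :=
  Real.log (hSq h (frame L x) ((chartAt (Cn n) x).symm y))

/-- The connection form `θ = ∂ log h(s, s)` of the preferred holomorphic frame `s` at `x`,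
in the chart `chartAt x`: the `(1,0)`-part `θ(v) = (d log h(s,s)(v) - i d log h(s,s)(iv)) / 2`. -/
def connForm (x : M) (y v : Cn n) : ℂ :=
  ((fderiv ℝ (logH h x) y v : ℂ) - Complex.I * (fderiv ℝ (logH h x) y (Complex.I • v) : ℂ)) / 2

/-- The connection `∇` compatible with the Hermitian metric and with the holomorphic structure
(the Chern connection): `∇_v (u s) = (du(v) + θ(v) u) s` at `x`, where `s` is the preferred
holomorphic frame at `x`. -/
def nabla (ψ : Π x, L x) (x : M) (v : T n x) : L x :=
  (fderiv ℝ (fun y => coord ψ x ((chartAt (Cn n) x).symm y)) (chartAt (Cn n) x x) v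
    + connForm h x (chartAt (Cn n) x x) v * coord ψ x x) • frame L x x

/-- The complex linear extension of `v ↦ ∇_v ψ` to the complexified tangent space. -/
def nablaC (ψ : Π x, L x) (x : M) (X : TC n x) : L x :=
  nabla h ψ x X.1 + Complex.I • nabla h ψ x X.2

/-- The curvature `R_{v,w}` of `∇` at `x`. For a line bundle
`R_{v,w} = [∇_v, ∇_w] - ∇_[v,w]` is multiplication by the number `dθ(v, w)`. -/
def curvature (x : M) (v w : T n x) : ℂ :=
  fderiv ℝ (fun y => connForm h x y w) (chartAt (Cn n) x x) v
    - fderiv ℝ (fun y => connForm h x y v) (chartAt (Cn n) x x) w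

/-- The complex bilinear extension of the curvature. -/
def curvatureC (x : M) (X Y : TC n x) : ℂ :=
  curvature h x X.1 Y.1 - curvature h x X.2 Y.2
    + Complex.I * (curvature h x X.1 Y.2 + curvature h x X.2 Y.1)

section Sections

/-- A smooth section with compact support. -/
def IsTestSection (n : ℕ) {M : Type*} [TopologicalSpace M] [ChartedSpace (Cn n) M]
    {L : M → Type*} [∀ x, AddCommGroup (L x)] [∀ x, TopologicalSpace (L x)]
    [TopologicalSpace (TotalSpace ℂ L)] [FiberBundle ℂ L] (ψ : Π x, L x) : Prop :=
  ContMDiff 𝓘(ℝ, Cn n) (𝓘(ℝ, Cn n).prod 𝓘(ℝ, ℂ)) ∞ (fun x => TotalSpace.mk' ℂ x (ψ x)) ∧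
    IsCompact (closure {x | ψ x ≠ 0})

/-- A holomorphic section: complex differentiable. -/
def IsHolomorphicSection (n : ℕ) {M : Type*} [TopologicalSpace M] [ChartedSpace (Cn n) M]
    {L : M → Type*} [∀ x, AddCommGroup (L x)] [∀ x, TopologicalSpace (L x)]
    [TopologicalSpace (TotalSpace ℂ L)] [FiberBundle ℂ L] (ψ : Π x, L x) : Prop :=
  MDifferentiable 𝓘(ℂ, Cn n) (𝓘(ℂ, Cn n).prod 𝓘(ℂ, ℂ)) (fun x => TotalSpace.mk' ℂ x (ψ x))

end Sections

variable [RiemannianBundle (fun x : M => TangentSpace 𝓘(ℝ, Cn n) x)]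

/-- The curvature term `ρ = ∑ₖ R_{Z̄ₖ, Zₖ}`. The sum is a real number because `R` takes
imaginary values on real tangent vectors. -/
def rho (x : M) : ℝ :=
  (∑ k, curvatureC h x (Zbar (unitaryFrame x k)) (Z (unitaryFrame x k))).re

/-- `Tr^{TM} h(∇ψ, ∇ψ)`, the sum of `h(∇_E ψ, ∇_E ψ)` over the orthonormal basis
`e₁, …, eₙ, J e₁, …, J eₙ` of the real tangent space. -/
def traceTM (ψ : Π x, L x) (x : M) : ℝ :=
  ∑ k, ((h.toFun x (nabla h ψ x (unitaryFrame x k)) (nabla h ψ x (unitaryFrame x k))).re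
    + (h.toFun x (nabla h ψ x (J (unitaryFrame x k))) (nabla h ψ x (J (unitaryFrame x k)))).re)

/-- `Tr^{(0,1)} h(∇ψ, ∇ψ) = ∑ₖ h(∇_{Z̄ₖ} ψ, ∇_{Z̄ₖ} ψ)`. -/
def trace01 (ψ : Π x, L x) (x : M) : ℝ :=
  ∑ k, (h.toFun x (nablaC h ψ x (Zbar (unitaryFrame x k)))
    (nablaC h ψ x (Zbar (unitaryFrame x k)))).re

variable [MeasurableSpace M]

/-- `‖ψ‖²` in `L²(hm)`. -/
def normSq (ψ : Π x, L x) : ℝ := ∫ x, hSq h ψ x ∂(volMeasure n M)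

/-- The quadratic form `(ψ, q ψ)` of multiplication by the real function `q`. -/
def potential (q : M → ℝ) (ψ : Π x, L x) : ℝ := ∫ x, q x * hSq h ψ x ∂(volMeasure n M)

/-- `(ψ, q ψ)` for a nonnegative function `q`, as an element of `[0, ∞]`. -/
def potentialENN (q : M → ℝ) (ψ : Π x, L x) : ENNReal :=
  ∫⁻ x, ENNReal.ofReal (q x * hSq h ψ x) ∂(volMeasure n M)

/-- `ψ` is a measurable section (measurable in local trivializations, almost everywhere) with
`∫ h(ψ, ψ) dm < ∞`. -/
def MemL2 (ψ : Π x, L x) : Prop :=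
  (∀ x₀, AEMeasurable (coord ψ x₀)
    ((volMeasure n M).restrict (trivializationAt ℂ L x₀).baseSet)) ∧
  potentialENN h (fun _ => 1) ψ < ⊤

/-- The form `𝓔^L(ψ, ψ)` of the negative Bochner Laplacian. -/
def bochnerForm (ψ : Π x, L x) : ℝ := ∫ x, traceTM h ψ x ∂(volMeasure n M)

/-- The form `𝓔^{(0,•)}(ψ, ψ)` of the negative holomorphic Laplacian. -/
def holForm (ψ : Π x, L x) : ℝ := ∫ x, trace01 h ψ x ∂(volMeasure n M)

/-- The Bochner Schrödinger form `S^L_{D,q}(ψ, ψ) = D 𝓔^L(ψ, ψ) + (ψ, q ψ)`. -/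
def bochnerSchrodinger (D : ℝ) (q : M → ℝ) (ψ : Π x, L x) : ℝ :=
  D * bochnerForm h ψ + potential h q ψ

/-- The holomorphic Schrödinger form `S^{(0,•)}_{D,q}(ψ, ψ) = D 𝓔^{(0,•)}(ψ, ψ) + (ψ, q ψ)`. -/
def holSchrodinger (D : ℝ) (q : M → ℝ) (ψ : Π x, L x) : ℝ :=
  D * holForm h ψ + potential h q ψ

/-- The form core: smooth compactly supported sections `ψ` with `(ψ, f⁺ψ) < ∞`. -/
def formCore (f : M → ℝ) : Set (Π x, L x) :=
  {ψ | IsTestSection n ψ ∧ potentialENN h f⁺ ψ < ⊤}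

/-- `u` is a sequence in the form core that converges to `ψ ∈ L²(hm)` in `L²(hm)` and is Cauchy
for the form `S^L_{D,f⁺}` (hence for the form norm). -/
def FormApprox (D : ℝ) (f : M → ℝ) (ψ : Π x, L x) (u : ℕ → Π x, L x) : Prop :=
  MemL2 h ψ ∧ (∀ l, u l ∈ formCore h f) ∧
  Tendsto (fun l => normSq h (u l - ψ)) atTop (𝓝 0) ∧
  ∀ ε > 0, ∃ N, ∀ k ≥ N, ∀ l ≥ N, bochnerSchrodinger h D f⁺ (u k - u l) < ε

/-- The form domain of the Schrödinger forms: the closure of the form core in the form norm. -/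
def formDomain (D : ℝ) (f : M → ℝ) : Set (Π x, L x) :=
  {ψ | ∃ u, FormApprox h D f ψ u}

/-! ### The Berezin–Toeplitz form -/

/-- The form domain `Q(t_f)`: holomorphic `ψ ∈ L²(hm)` with `∫ |f| h(ψ, ψ) dm < ∞`. -/
def toeplitzDomain (f : M → ℝ) : Set (Π x, L x) :=
  {ψ | IsHolomorphicSection n ψ ∧ MemL2 h ψ ∧ potentialENN h (fun x => |f x|) ψ < ⊤}

/-- The Berezin–Toeplitz form `t_f(ψ, φ) = ∫ f h(ψ, φ) dm`. -/
def toeplitzForm (f : M → ℝ) (ψ φ : Π x, L x) : ℂ :=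
  ∫ x, (f x : ℂ) * hProd h ψ φ x ∂(volMeasure n M)

/-- `c` is a lower bound of the quadratic form `q` with domain `Q`. -/
def IsLowerBound (Q : Set (Π x, L x)) (q : (Π x, L x) → ℝ) (c : ℝ) : Prop :=
  ∀ ψ ∈ Q, c * normSq h ψ ≤ q ψ

/-- The quadratic form `q` with domain `Q` is semibounded. -/
def IsSemibounded (Q : Set (Π x, L x)) (q : (Π x, L x) → ℝ) : Prop :=
  ∃ c, IsLowerBound h Q q c

/-- The semibounded quadratic form `q` with domain `Q` is closed: if `c` is a lower bound, then `Q`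
is complete in the form norm `(q(ψ) + (1 - c) ‖ψ‖²)^{1/2}`. -/
def IsClosedForm (Q : Set (Π x, L x)) (q : (Π x, L x) → ℝ) : Prop :=
  ∀ c, IsLowerBound h Q q c → ∀ u : ℕ → Π x, L x, (∀ l, u l ∈ Q) →
    (∀ ε > 0, ∃ N, ∀ k ≥ N, ∀ l ≥ N,
      q (u k - u l) + (1 - c) * normSq h (u k - u l) < ε) →
    ∃ ψ ∈ Q, Tendsto (fun l => q (u l - ψ) + (1 - c) * normSq h (u l - ψ)) atTop (𝓝 0)

end Bundle

end BerezinToeplitz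

end

/-!
The bridge between the two kinetic energies is the Bochner–Kodaira–Weitzenböck formula
`2 𝓔^{(0,•)}(ψ, ψ) = 𝓔^L(ψ, ψ) + ∫ ρ h(ψ, ψ) dm` for smooth compactly supported sections
(`IsTestSection.two_mul_holForm`). Pointwise, in one complex direction `v`, the densities
`|∇_v ψ + i ∇_{iv} ψ|²` and `|∇_v ψ|² + |∇_{iv} ψ|²` differ by a curvature term and by
`dγ(v, iv)` with `γ = Im h(ψ, ∇ψ)` (`weitzenbock_direction`). Summed over a unitary frame, the last
term is the contraction of `dγ` with the Kähler form `ω`. Its integral vanishes: since `dω = 0`, the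
Poisson tensor of `ω`, multiplied by the volume density, is divergence free
(`IsKahlerOn.divergence_poisson`, `IsKahlerOn.integral_trG_eq_zero`), and sections without small
support are cut into pieces by functions with `∑ φᵢ² = 1`
(`IsTestSection.integral_weitz_eq_zero`). No Stokes theorem on manifolds is needed.

On the core this gives `S^{(0,•)}_{2D,f}(ψ, ψ) = S^L_{D,f⁺}(ψ, ψ) - (ψ, (f⁻ - Dρ) ψ)`, so by the
hypothesis the form is at least `(1 - κ) S^L_{D,f⁺}(ψ, ψ) - b' ‖ψ‖²`, and it is bounded in the norm
of `S^L_{D,f⁺} + ‖·‖²`. A quadratic form that is bounded in this norm converges along sequences that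
are Cauchy in it, which gives the semiboundedness of the holomorphic Schrödinger form
(`semibounded_holSchrodinger`).

For the Toeplitz form completeness enters. Closed balls are compact (Hopf–Rinow,
`isCompact_closedBall_of_length_space`), and mollifying the distance function locally
(`exists_mollification`) gives smooth compactly supported cutoffs `χ` that tend to `1` and whose
gradients tend uniformly to `0` (`exists_cutoff`). If `ψ` is holomorphic, then `∇_{Z̄} (χ ψ)` only
contains the derivative of `χ`. Hence the kinetic term of `χ ψ` tends to `0`, and the lower bound on
the core turns into `(1 - κ) (ψ, f⁺ ψ) - b' ‖ψ‖² ≤ t_f(ψ, ψ)` (`le_potential_of_mem`). Together with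
a lower bound of the form this makes the form norm of `t_f` equivalent to the norm of `L²` with the
weight `1 + |f|` (`potential_abs_le`). Completeness of the domain in that norm
(`isClosedForm_toeplitz`) follows from the mean value property, by which `L²` convergence of
holomorphic sections is locally uniform (`exists_norm_loc_sq_le`, `exists_holomorphic_limit`), and
from Fatou's lemma (`lintegral_hSq_sub_le`).
-/

noncomputable section

set_option linter.unusedSectionVars false

namespace BerezinToeplitz

/-! ### Holomorphic functions on `ℂⁿ` -/

section SeveralVariables

variable {n : ℕ}

/-- Lebesgue measure on `ℂⁿ` is invariant under multiplication by unit scalars. -/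
theorem measurePreserving_unit_smul (c : ℂ) (hc : ‖c‖ = 1) :
    MeasurePreserving (fun v : Cn n => c • v) volume volume := by
  have hc0 : c ≠ 0 := by
    intro h; simp [h] at hc
  let e : Cn n ≃ₗᵢ[ℝ] Cn n :=
    { toFun := fun v => c • v
      invFun := fun v => c⁻¹ • v
      map_add' := fun v w => smul_add _ _ _
      map_smul' := fun r v => smul_comm _ _ _
      left_inv := fun v => by simp [smul_smul, hc0]
      right_inv := fun v => by simp [smul_smul, hc0]
      norm_map' := fun v => by
        change ‖c • v‖ = ‖v‖
        rw [norm_smul, hc, one_mul] }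
  exact e.measurePreserving

/-- Averaging over the circle action does not change the integral. -/
theorem integral_eq_integral_circleAverage (g : Cn n → ℂ) (hg : Continuous g)
    (hgc : HasCompactSupport g) :
    ∫ v, g v = ∫ v, Real.circleAverage (fun ζ : ℂ => g (ζ • v)) 0 1 := by
  have hint : Integrable g := hg.integrable_of_hasCompactSupport hgc
  -- each rotation preserves the integral; the rest is Fubini
  have h1 : ∀ θ : ℝ, ∫ v, g (circleMap 0 1 θ • v) = ∫ v, g v := fun θ => by
    have hm := measurePreserving_unit_smul (n := n) (circleMap 0 1 θ) (by simp)
    have := integral_map (μ := (volume : Measure (Cn n))) hm.measurable.aemeasurable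
      (f := g) (hg.aestronglyMeasurable)
    rw [hm.map_eq] at this
    exact this.symm
  obtain ⟨R, hR⟩ := hgc.isCompact.isBounded.subset_closedBall (0 : Cn n)
  have hcont : Continuous (fun p : ℝ × Cn n => g (circleMap 0 1 p.1 • p.2)) := by
    refine hg.comp ((continuous_circleMap 0 1).comp continuous_fst |>.smul continuous_snd)
  have hprod : Integrable (Function.uncurry fun (θ : ℝ) (v : Cn n) => g (circleMap 0 1 θ • v))
      ((volume.restrict (uIoc 0 (2 * Real.pi))).prod volume) := by
    have h2 : IntegrableOn (fun p : ℝ × Cn n => g (circleMap 0 1 p.1 • p.2))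
        (Icc 0 (2 * Real.pi) ×ˢ Metric.closedBall 0 R) (volume.prod volume) :=
      hcont.continuousOn.integrableOn_compact
        (isCompact_Icc.prod (isCompact_closedBall _ _))
    rw [uIoc_of_le (by positivity)]
    have h3 : IntegrableOn (fun p : ℝ × Cn n => g (circleMap 0 1 p.1 • p.2))
        (Ioc 0 (2 * Real.pi) ×ˢ univ) (volume.prod volume) := by
      have h4 := h2.mono_set (prod_mono_left (t := Metric.closedBall (0 : Cn n) R)
        (Ioc_subset_Icc_self (a := (0:ℝ)) (b := 2 * Real.pi)))
      refine h4.of_forall_sdiff_eq_zero (measurableSet_Ioc.prod MeasurableSet.univ) ?_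
      rintro ⟨θ, v⟩ ⟨⟨hθ, -⟩, hv⟩
      by_contra hne
      apply hv
      refine ⟨hθ, ?_⟩
      have : circleMap 0 1 θ • v ∈ Metric.closedBall (0 : Cn n) R :=
        hR (subset_tsupport _ hne)
      simpa [norm_smul] using this
    have := h3
    rw [IntegrableOn, ← Measure.prod_restrict, Measure.restrict_univ] at this
    exact this
  simp only [Real.circleAverage]
  rw [integral_smul]
  have h5 : ∫ v : Cn n, ∫ θ in (0:ℝ)..2 * Real.pi, g (circleMap 0 1 θ • v)
      = ∫ θ in (0:ℝ)..2 * Real.pi, ∫ v : Cn n, g (circleMap 0 1 θ • v) := by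
    rw [intervalIntegral_integral_swap hprod]
  rw [h5]
  simp only [h1]
  rw [intervalIntegral.integral_const, smul_smul]
  have : (2 * Real.pi)⁻¹ * (2 * Real.pi - 0) = 1 := by
    field_simp; simp
  rw [this, one_smul]

/-- A continuous function that is holomorphic on complex lines. Both conditions pass to locally
uniform limits, and they imply that the function is holomorphic on an open set. -/
structure LineHolomorphicOn (f : Cn n → ℂ) (Ω : Set (Cn n)) : Prop where
  continuousOn : ContinuousOn f Ω
  line : ∀ y v, DifferentiableOn ℂ (fun ζ : ℂ => f (y + ζ • v)) {ζ | y + ζ • v ∈ Ω}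

theorem _root_.DifferentiableOn.lineHolomorphicOn {f : Cn n → ℂ} {Ω : Set (Cn n)}
    (hf : DifferentiableOn ℂ f Ω) : LineHolomorphicOn f Ω :=
  ⟨hf.continuousOn, fun y v => hf.comp (by fun_prop) fun _ h => h⟩

theorem LineHolomorphicOn.mono {f : Cn n → ℂ} {Ω Ω' : Set (Cn n)}
    (hf : LineHolomorphicOn f Ω) (h : Ω' ⊆ Ω) : LineHolomorphicOn f Ω' :=
  ⟨hf.continuousOn.mono h, fun y v => (hf.line y v).mono fun _ hz => h hz⟩

/-- The one-variable mean value property, on the complex line through `y` in the direction `v`. -/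
theorem LineHolomorphicOn.circleAverage {f : Cn n → ℂ} {y : Cn n} {R : ℝ}
    (hf : LineHolomorphicOn f (Metric.ball y R)) {v : Cn n} (hv : ‖v‖ < R) :
    Real.circleAverage (fun ζ : ℂ => f (y + ζ • v)) 0 1 = f y := by
  have := DiffContOnCl.circleAverage (f := fun ζ : ℂ => f (y + ζ • v)) (c := 0) (R := 1)
    ((hf.line y v).diffContOnCl_ball (c := 0) (R := |1|) ?_)
  · simpa using this
  · intro ζ hζ
    simp only [Metric.mem_ball, dist_self_add_left, mem_ofPred_eq, norm_smul]
    simp at hζ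
    nlinarith [norm_nonneg v]

/-- A radial bump function supported in the ball of radius `r`. The weight must be invariant under
the circle action `v ↦ ζ v`, so that the mean value property on complex lines applies to it. -/
def radialBump (r : ℝ) (v : Cn n) : ℝ := Real.smoothTransition (r ^ 2 - ‖v‖ ^ 2)

theorem contDiff_radialBump (r : ℝ) : ContDiff ℝ ∞ (radialBump r : Cn n → ℝ) :=
  Real.smoothTransition.contDiff.comp (contDiff_const.sub (contDiff_norm_sq ℝ))

theorem radialBump_nonneg (r : ℝ) (v : Cn n) : 0 ≤ radialBump r v :=
  Real.smoothTransition.nonneg _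

theorem radialBump_le_one (r : ℝ) (v : Cn n) : radialBump r v ≤ 1 :=
  Real.smoothTransition.le_one _

theorem radialBump_eq_zero {r : ℝ} (hr : 0 < r) {v : Cn n} (hv : r ≤ ‖v‖) :
    radialBump r v = 0 :=
  Real.smoothTransition.zero_of_nonpos (by nlinarith [norm_nonneg v])

theorem radialBump_smul (r : ℝ) (c : ℂ) (hc : ‖c‖ = 1) (v : Cn n) :
    radialBump r (c • v) = radialBump r v := by
  simp [radialBump, norm_smul, hc]

theorem radialBump_neg (r : ℝ) (v : Cn n) : radialBump r (-v) = radialBump r v := by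
  simp [radialBump]

theorem tsupport_radialBump {r : ℝ} (hr : 0 < r) :
    tsupport (radialBump r : Cn n → ℝ) ⊆ Metric.closedBall 0 r := by
  refine closure_minimal (fun v hv => ?_) Metric.isClosed_closedBall
  by_contra h
  simp only [Metric.mem_closedBall, dist_zero_right, not_le] at h
  exact hv (radialBump_eq_zero hr h.le)

theorem hasCompactSupport_radialBump {r : ℝ} (hr : 0 < r) :
    HasCompactSupport (radialBump r : Cn n → ℝ) :=
  (isCompact_closedBall _ _).of_isClosed_subset (isClosed_tsupport _) (tsupport_radialBump hr)

theorem integral_radialBump_pos {r : ℝ} (hr : 0 < r) :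
    0 < ∫ v : Cn n, radialBump r v := by
  refine (contDiff_radialBump r).continuous.integral_pos_of_hasCompactSupport_nonneg_nonzero
    (hasCompactSupport_radialBump hr) (fun v => radialBump_nonneg r v) (x := 0) ?_
  exact (Real.smoothTransition.pos_of_pos (by simp; positivity)).ne'

/-- The mean value property of holomorphic functions for radial weights: the integral is first
averaged over the circle action, and on each complex line the average is the value at `y`. -/
theorem LineHolomorphicOn.integral_radialBump_mul {f : Cn n → ℂ} {y : Cn n} {r R : ℝ}
    (hf : LineHolomorphicOn f (Metric.ball y R)) (hr : 0 < r) (hrR : r < R) :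
    ∫ v, (radialBump r v : ℂ) * f (y + v) = (∫ v : Cn n, radialBump r v : ℝ) * f y := by
  have hcont : Continuous fun v : Cn n => (radialBump r v : ℂ) * f (y + v) := by
    rw [continuous_iff_continuousAt]
    intro v
    rcases lt_or_ge ‖v‖ R with hv | hv
    · refine ContinuousAt.mul ?_ ?_
      · exact (Complex.continuous_ofReal.comp (contDiff_radialBump r).continuous).continuousAt
      · have h1 : ContinuousAt f (y + v) :=
          hf.continuousOn.continuousAt (Metric.isOpen_ball.mem_nhds (by simpa using hv))
        exact ContinuousAt.comp (f := fun v => y + v) h1 (by fun_prop)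
    · have : (fun v : Cn n => (radialBump r v : ℂ) * f (y + v)) =ᶠ[𝓝 v] fun _ => 0 := by
        have : ∀ᶠ w in 𝓝 v, r < ‖w‖ :=
          continuous_norm.continuousAt.eventually (lt_mem_nhds (by linarith))
        filter_upwards [this] with w hw
        simp [radialBump_eq_zero hr hw.le]
      exact continuousAt_const.congr this.symm
  have hsupp : HasCompactSupport fun v : Cn n => (radialBump r v : ℂ) * f (y + v) := by
    refine HasCompactSupport.mul_right ?_
    exact (hasCompactSupport_radialBump hr).comp_left (g := fun x : ℝ => (x : ℂ)) (by simp)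
  rw [integral_eq_integral_circleAverage _ hcont hsupp, ← integral_complex_ofReal,
    ← integral_mul_const]
  refine integral_congr_ae (Eventually.of_forall fun v => ?_)
  have h1 : Real.circleAverage (fun ζ : ℂ => (radialBump r (ζ • v) : ℂ) * f (y + ζ • v)) 0 1
      = Real.circleAverage ((radialBump r v : ℂ) • fun ζ : ℂ => f (y + ζ • v)) 0 1 := by
    refine Real.circleAverage_congr_sphere fun ζ hζ => ?_
    simp only [abs_one, mem_sphere_iff_norm, sub_zero] at hζ
    simp [radialBump_smul r ζ hζ]
  simp only [h1]
  rw [Real.circleAverage_smul, smul_eq_mul]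
  rcases lt_or_ge ‖v‖ R with hv | hv
  · rw [hf.circleAverage hv]
  · simp [radialBump_eq_zero hr (hrR.le.trans hv)]

/-- Holomorphic functions of several variables are smooth: by the mean value property they are
locally convolutions with a smooth function. -/
theorem LineHolomorphicOn.contDiffOn {f : Cn n → ℂ} {Ω : Set (Cn n)}
    (hf : LineHolomorphicOn f Ω) (hΩ : IsOpen Ω) : ContDiffOn ℝ ∞ f Ω := by
  intro y₀ hy₀
  obtain ⟨R, hR, hball⟩ := Metric.isOpen_iff.1 hΩ y₀ hy₀
  set r := R / 4 with hrdef
  have hr : 0 < r := by positivity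
  -- near `y₀` the function is the convolution of its truncation `F` with a radial bump
  set F : Cn n → ℂ := (Metric.closedBall y₀ (2 * r)).indicator f with hF
  have hFint : Integrable F := by
    rw [hF, integrable_indicator_iff Metric.isClosed_closedBall.measurableSet]
    refine (hf.continuousOn.mono ?_).integrableOn_compact (isCompact_closedBall _ _)
    exact (Metric.closedBall_subset_ball (by linarith)).trans hball
  have hconv : ContDiff ℝ ∞ (convolution F (radialBump r : Cn n → ℝ)
      (ContinuousLinearMap.lsmul ℝ ℝ).flip volume) :=
    (hasCompactSupport_radialBump hr).contDiff_convolution_right _ hFint.locallyIntegrable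
      (contDiff_radialBump r)
  set c : ℝ := ∫ v : Cn n, radialBump r v with hc
  have hcpos : 0 < c := integral_radialBump_pos hr
  have heq : f =ᶠ[𝓝 y₀] fun y => c⁻¹ • (convolution F (radialBump r : Cn n → ℝ)
      (ContinuousLinearMap.lsmul ℝ ℝ).flip volume y) := by
    filter_upwards [Metric.ball_mem_nhds y₀ hr] with y hy
    have hyR : Metric.ball y (2 * r) ⊆ Ω := by
      refine (Metric.ball_subset_ball' ?_).trans hball
      have := Metric.mem_ball.1 hy
      linarith
    have h1 := (hf.mono hyR).integral_radialBump_mul hr (by linarith)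
    have h2 : convolution F (radialBump r : Cn n → ℝ)
        (ContinuousLinearMap.lsmul ℝ ℝ).flip volume y
        = ∫ v, (radialBump r v : ℂ) * f (y + v) := by
      rw [convolution_def]
      rw [← integral_add_left_eq_self (μ := (volume : Measure (Cn n)))
        (fun t => ((ContinuousLinearMap.lsmul ℝ ℝ).flip (F t)) (radialBump r (y - t))) y]
      refine integral_congr_ae (Eventually.of_forall fun v => ?_)
      simp only [ContinuousLinearMap.flip_apply, ContinuousLinearMap.lsmul_apply]
      rw [show y - (y + v) = -v by abel, radialBump_neg]
      rcases lt_or_ge ‖v‖ r with hv | hv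
      · have hmem : y + v ∈ Metric.closedBall y₀ (2 * r) := by
          rw [Metric.mem_closedBall, dist_eq_norm]
          rw [Metric.mem_ball, dist_eq_norm] at hy
          calc ‖y + v - y₀‖ = ‖(y - y₀) + v‖ := by congr 1; abel
            _ ≤ ‖y - y₀‖ + ‖v‖ := norm_add_le _ _
            _ ≤ 2 * r := by linarith
        rw [hF, indicator_of_mem hmem]
        simp
      · simp [radialBump_eq_zero hr hv]
    rw [h2, h1, ← hc, Complex.real_smul, ← mul_assoc, ← Complex.ofReal_mul,
      inv_mul_cancel₀ hcpos.ne']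
    simp
  exact ((hconv.const_smul c⁻¹).contDiffAt.congr_of_eventuallyEq heq).contDiffWithinAt

/-- The value of a holomorphic function at the centre of a ball is controlled by its `L²` norm. This
is the mean value property of the holomorphic function `f ^ 2`. -/
theorem enorm_sq_mul_le_lintegral {f : Cn n → ℂ} {y : Cn n} {r R : ℝ}
    (hf : DifferentiableOn ℂ f (Metric.ball y R)) (hr : 0 < r) (hrR : r < R) :
    ENNReal.ofReal (∫ v : Cn n, radialBump r v) * ‖f y‖ₑ ^ 2 ≤
      ∫⁻ z in Metric.ball y r, ‖f z‖ₑ ^ 2 := by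
  have h1 := (hf.pow 2).lineHolomorphicOn.integral_radialBump_mul hr hrR
  have hc := integral_radialBump_pos (n := n) hr
  have h2 : ENNReal.ofReal (∫ v : Cn n, radialBump r v) * ‖f y‖ₑ ^ 2
      = ‖((∫ v : Cn n, radialBump r v : ℝ) : ℂ) * (f ^ 2) y‖ₑ := by
    rw [enorm_mul, Pi.pow_apply, enorm_pow]
    congr 1
    rw [← ofReal_norm, Complex.norm_real, Real.norm_of_nonneg hc.le]
  rw [h2, ← h1]
  calc ‖∫ v : Cn n, (radialBump r v : ℂ) * (f ^ 2) (y + v)‖ₑ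
      ≤ ∫⁻ v : Cn n, ‖(radialBump r v : ℂ) * (f ^ 2) (y + v)‖ₑ :=
        enorm_integral_le_lintegral_enorm _
    _ ≤ ∫⁻ v : Cn n, (Metric.ball y r).indicator (fun z => ‖f z‖ₑ ^ 2) (y + v) := by
        refine lintegral_mono fun v => ?_
        rcases lt_or_ge ‖v‖ r with hv | hv
        · rw [indicator_of_mem (by simpa using hv)]
          rw [enorm_mul, Pi.pow_apply, enorm_pow]
          refine mul_le_of_le_one_left' ?_
          rw [← ofReal_norm, Complex.norm_real, Real.norm_of_nonneg (radialBump_nonneg _ _)]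
          simpa using radialBump_le_one r v
        · simp [radialBump_eq_zero hr hv]
    _ = ∫⁻ z, (Metric.ball y r).indicator (fun z => ‖f z‖ₑ ^ 2) z :=
        lintegral_add_left_eq_self (μ := (volume : Measure (Cn n))) _ y
    _ = _ := lintegral_indicator Metric.isOpen_ball.measurableSet _

/-- Complex differentiability from real differentiability and holomorphy on complex lines. -/
theorem LineHolomorphicOn.differentiableOn {f : Cn n → ℂ} {Ω : Set (Cn n)}
    (hf : LineHolomorphicOn f Ω) (hΩ : IsOpen Ω) : DifferentiableOn ℂ f Ω := by
  intro y hy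
  have hreal : DifferentiableAt ℝ f y :=
    ((hf.contDiffOn hΩ).contDiffAt (hΩ.mem_nhds hy)).differentiableAt (by simp)
  suffices DifferentiableAt ℂ f y from this.differentiableWithinAt
  rw [differentiableAt_iff_restrictScalars ℝ hreal]
  have hlin : ∀ v : Cn n, ∀ c : ℂ, fderiv ℝ f y (c • v) = c • fderiv ℝ f y v := by
    intro v c
    have hg : DifferentiableAt ℂ (fun ζ : ℂ => f (y + ζ • v)) 0 := by
      refine (hf.line y v).differentiableAt ?_
      refine IsOpen.mem_nhds (hΩ.preimage (f := fun ζ : ℂ => y + ζ • v) (by fun_prop)) ?_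
      simpa using hy
    have hR := hg.hasFDerivAt.restrictScalars ℝ
    have hcomp : HasFDerivAt (fun ζ : ℂ => f (y + ζ • v))
        ((fderiv ℝ f y).comp
          ((ContinuousLinearMap.id ℂ ℂ).smulRight v |>.restrictScalars ℝ)) 0 := by
      have h0 : HasFDerivAt (fun ζ : ℂ => y + ζ • v)
          ((ContinuousLinearMap.id ℂ ℂ).smulRight v |>.restrictScalars ℝ) 0 := by
        have := ((hasFDerivAt_id (𝕜 := ℂ) (0:ℂ)).smul_const v).const_add y
        exact this.restrictScalars ℝ
      have h1 : HasFDerivAt f (fderiv ℝ f y) (y + (0:ℂ) • v) := by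
        simpa using hreal.hasFDerivAt
      exact h1.comp (0:ℂ) h0
    have hu := hR.unique hcomp
    have e1 := congrArg (fun L => L c) hu
    have e2 := congrArg (fun L => L 1) hu
    simp only [ContinuousLinearMap.coe_restrictScalars', ContinuousLinearMap.comp_apply,
      ContinuousLinearMap.smulRight_apply, ContinuousLinearMap.id_apply, one_smul] at e1 e2
    rw [← e1, ← e2, ← map_smul, smul_eq_mul, mul_one]
  refine ⟨{ toFun := fderiv ℝ f y, map_add' := map_add _, map_smul' := fun c v => hlin v c,
            cont := (fderiv ℝ f y).cont }, ?_⟩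
  ext v
  rfl

/-- Locally uniform limits of holomorphic functions of several variables are holomorphic. -/
theorem _root_.TendstoLocallyUniformlyOn.differentiableOn_Cn {F : ℕ → Cn n → ℂ} {f : Cn n → ℂ}
    {Ω : Set (Cn n)} (hΩ : IsOpen Ω) (h : TendstoLocallyUniformlyOn F f atTop Ω)
    (hF : ∀ k, DifferentiableOn ℂ (F k) Ω) : DifferentiableOn ℂ f Ω := by
  refine LineHolomorphicOn.differentiableOn ⟨?_, fun y v => ?_⟩ hΩ
  · exact h.continuousOn (Frequently.of_forall fun k => (hF k).continuousOn)
  · have h1 : TendstoLocallyUniformlyOn (fun k (ζ : ℂ) => F k (y + ζ • v)) (fun ζ => f (y + ζ • v))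
        atTop {ζ : ℂ | y + ζ • v ∈ Ω} :=
      h.comp (fun ζ : ℂ => y + ζ • v) (fun _ h => h) (by fun_prop)
    refine h1.differentiableOn (Eventually.of_forall fun k => (hF k).lineHolomorphicOn.line y v) ?_
    exact hΩ.preimage (f := fun ζ : ℂ => y + ζ • v) (by fun_prop)

end SeveralVariables

/-! ### Hermitian forms and traces -/

section LinearAlgebra

variable {n : ℕ}

/-- `realBasis n` as a basis of the real vector space `ℂⁿ`. -/
def realBasisB (n : ℕ) : Module.Basis (Fin n ⊕ Fin n) ℝ (Cn n) :=
  Module.Basis.ofEquivFun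
    { toFun := fun v => Sum.elim (fun k => (v k).re) (fun k => (v k).im)
      invFun := fun c => WithLp.toLp 2 fun k => ⟨c (Sum.inl k), c (Sum.inr k)⟩
      map_add' := fun v w => by ext k; rcases k with k | k <;> simp
      map_smul' := fun r v => by ext (k | k) <;> simp
      left_inv := fun v => by ext k; simp
      right_inv := fun c => by ext (k | k) <;> simp }

@[simp]
theorem coe_realBasisB : ⇑(realBasisB n) = realBasis n := by
  ext i k
  rw [realBasisB, Module.Basis.coe_ofEquivFun]
  rcases i with i | i <;> by_cases h : k = i <;>
    simp [realBasis, h, Complex.ext_iff, Pi.single_apply]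

/-- A real bilinear form on `ℂⁿ` which is the real part of a Hermitian metric. -/
structure IsHermitianForm (G : LinearMap.BilinForm ℝ (Cn n)) : Prop where
  symm : ∀ v w, G v w = G w v
  pos : ∀ v, v ≠ 0 → 0 < G v v
  smul_I : ∀ v w, G (Complex.I • v) (Complex.I • w) = G v w

theorem IsHermitianForm.smul_I_left {G : LinearMap.BilinForm ℝ (Cn n)} (hG : IsHermitianForm G)
    (v w : Cn n) : G (Complex.I • v) w = -G v (Complex.I • w) := by
  have := hG.smul_I v (Complex.I • w)
  rw [smul_smul, Complex.I_mul_I, neg_one_smul, map_neg] at this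
  linarith

/-- `e` is a unitary frame for the Hermitian form `G`. -/
def UnitaryFor (G : LinearMap.BilinForm ℝ (Cn n)) (e : Fin n → Cn n) : Prop :=
  ∀ j k, G (e j) (e k) = (if j = k then (1 : ℝ) else 0) ∧ G (e j) (Complex.I • e k) = 0

theorem exists_orthonormal_of_core {V : Type*} [AddCommGroup V] [Module ℂ V]
    [FiniteDimensional ℂ V] (hV : Module.finrank ℂ V = n) (c : InnerProductSpace.Core ℂ V) :
    ∃ e : Fin n → V, ∀ j k, c.inner (e j) (e k) = if j = k then 1 else 0 := by
  let _ : NormedAddCommGroup V := c.toNormedAddCommGroup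
  let _ : InnerProductSpace ℂ V := InnerProductSpace.ofCore c.toCore
  let b := stdOrthonormalBasis ℂ V
  let σ := finCongr hV
  refine ⟨fun i => b (σ.symm i), fun j k => ?_⟩
  have := orthonormal_iff_ite.1 b.orthonormal (σ.symm j) (σ.symm k)
  simpa using this

/-- Gram–Schmidt for the Hermitian inner product `G(v, w) + i G(i v, w)`. -/
theorem IsHermitianForm.exists_unitaryFor {G : LinearMap.BilinForm ℝ (Cn n)}
    (hG : IsHermitianForm G) : ∃ e, UnitaryFor G e := by
  let c : InnerProductSpace.Core ℂ (Cn n) :=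
    { inner := fun v w => ⟨G v w, G (Complex.I • v) w⟩
      conj_inner_symm := fun v w => by
        apply Complex.ext
        · simp [hG.symm v w]
        · simp [hG.smul_I_left w v, hG.symm w]
      re_inner_nonneg := fun v => by
        rcases eq_or_ne v 0 with rfl | hv
        · simp
        · simpa using (hG.pos v hv).le
      add_left := fun u v w => by
        apply Complex.ext <;> simp
      smul_left := fun v w r => by
        have hr : r • v = r.re • v + r.im • (Complex.I • v) := by
          conv_lhs => rw [← Complex.re_add_im r, add_smul, mul_smul]
          rfl
        have hr2 : Complex.I • (r • v) = r.re • (Complex.I • v) - r.im • v := by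
          rw [hr, smul_add, smul_comm Complex.I r.re, smul_comm Complex.I r.im,
            smul_smul Complex.I, Complex.I_mul_I, neg_one_smul, smul_neg, sub_eq_add_neg]
        apply Complex.ext
        · change G (r • v) w = _
          rw [hr]
          simp
        · change G (Complex.I • r • v) w = _
          rw [hr2]
          simp
          ring
      definite := fun v hv => by
        by_contra h
        have := congrArg Complex.re hv
        simp only [Complex.zero_re] at this
        exact (hG.pos v h).ne' this }
  obtain ⟨e, he⟩ := exists_orthonormal_of_core (n := n) (by simp) c
  refine ⟨e, fun j k => ⟨?_, ?_⟩⟩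
  · have h1 : G (e j) (e k) = Complex.re (if j = k then 1 else 0) := congrArg Complex.re (he j k)
    rw [apply_ite Complex.re] at h1
    simpa using h1
  · have h2 : G (Complex.I • e j) (e k) = Complex.im (if j = k then 1 else 0) :=
      congrArg Complex.im (he j k)
    rw [apply_ite Complex.im] at h2
    simp only [Complex.one_im, Complex.zero_im, ite_self] at h2
    rw [hG.smul_I_left] at h2
    linarith

/-- The Gram matrix of a bilinear form in the standard real basis of `ℂⁿ`. -/
def gram (G : LinearMap.BilinForm ℝ (Cn n)) : Matrix (Fin n ⊕ Fin n) (Fin n ⊕ Fin n) ℝ :=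
  Matrix.of fun i j => G (realBasis n i) (realBasis n j)

theorem gram_apply (G : LinearMap.BilinForm ℝ (Cn n)) (i j) :
    gram G i j = G (realBasis n i) (realBasis n j) := rfl

/-- The trace of the bilinear form `B` with respect to `G`, written with the inverse Gram matrix, so
that its smooth dependence on `G` is visible. -/
def trG (G : LinearMap.BilinForm ℝ (Cn n)) (B : Cn n → Cn n → ℝ) : ℝ :=
  ∑ i, ∑ j, (gram G)⁻¹ i j * B (realBasis n i) (realBasis n j)

/-- The real orthonormal family `e₁, …, eₙ, i e₁, …, i eₙ`. -/
def realFrame (e : Fin n → Cn n) : Fin n ⊕ Fin n → Cn n :=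
  Sum.elim e fun k => Complex.I • e k

theorem UnitaryFor.realFrame_apply {G : LinearMap.BilinForm ℝ (Cn n)} (hG : IsHermitianForm G)
    {e : Fin n → Cn n} (he : UnitaryFor G e) (i j : Fin n ⊕ Fin n) :
    G (realFrame e i) (realFrame e j) = if i = j then 1 else 0 := by
  rcases i with i | i <;> rcases j with j | j
  · simpa [realFrame] using (he i j).1
  · simpa [realFrame] using (he i j).2
  · have := hG.smul_I_left (e i) (e j)
    simp only [realFrame, Sum.elim_inr, Sum.elim_inl, this, (he i j).2]
    simp
  · simpa [realFrame, hG.smul_I] using (he i j).1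

/-- Bilinear expansion in the standard real basis. -/
theorem bilin_eq_sum (B : LinearMap.BilinForm ℝ (Cn n)) (v w : Cn n) :
    B v w = ∑ i, ∑ j, (realBasisB n).repr v i * (realBasisB n).repr w j * gram B i j := by
  conv_lhs => rw [← (realBasisB n).sum_repr v, ← (realBasisB n).sum_repr w]
  simp only [map_sum, LinearMap.sum_apply, map_smul, LinearMap.smul_apply, smul_eq_mul,
    gram_apply, coe_realBasisB]
  simp only [Finset.mul_sum]
  rw [Finset.sum_comm]
  refine Finset.sum_congr rfl fun i _ => Finset.sum_congr rfl fun j _ => by ring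

theorem UnitaryFor.gram_inv {G : LinearMap.BilinForm ℝ (Cn n)} (hG : IsHermitianForm G)
    {e : Fin n → Cn n} (he : UnitaryFor G e) :
    let A : Matrix (Fin n ⊕ Fin n) (Fin n ⊕ Fin n) ℝ :=
      Matrix.of fun i j => (realBasisB n).repr (realFrame e i) j
    A.transpose * A * gram G = 1 := by
  intro A
  have h1 : A * (gram G * A.transpose) = 1 := by
    ext i j
    rw [← Matrix.mul_assoc, Matrix.one_apply, ← he.realFrame_apply hG i j, bilin_eq_sum]
    simp only [Matrix.mul_apply, Matrix.transpose_apply, A, Matrix.of_apply, Finset.sum_mul]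
    rw [Finset.sum_comm]
    refine Finset.sum_congr rfl fun k _ => Finset.sum_congr rfl fun l _ => by ring
  have h2 := mul_eq_one_comm.1 h1
  rw [Matrix.mul_assoc] at h2
  exact mul_eq_one_comm.1 h2

/-- The trace over a unitary frame does not depend on the frame. -/
theorem UnitaryFor.sum_eq_trG {G : LinearMap.BilinForm ℝ (Cn n)} (hG : IsHermitianForm G)
    {e : Fin n → Cn n} (he : UnitaryFor G e) (B : LinearMap.BilinForm ℝ (Cn n)) :
    ∑ k, (B (e k) (e k) + B (Complex.I • e k) (Complex.I • e k)) = trG G fun v w => B v w := by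
  have h1 := he.gram_inv hG
  simp only at h1
  rw [trG, Matrix.inv_eq_left_inv h1]
  have h2 : ∑ k, (B (e k) (e k) + B (Complex.I • e k) (Complex.I • e k))
      = ∑ i, B (realFrame e i) (realFrame e i) := by
    rw [Fintype.sum_sum_type, Finset.sum_add_distrib]
    rfl
  rw [h2]
  simp only [bilin_eq_sum B, Matrix.mul_apply, Matrix.transpose_apply, Matrix.of_apply,
    Finset.sum_mul]
  rw [Finset.sum_comm]
  refine Finset.sum_congr rfl fun i _ => ?_
  rw [Finset.sum_comm]
  refine Finset.sum_congr rfl fun j _ => Finset.sum_congr rfl fun k _ => ?_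
  have : B (realBasis n i) (realBasis n j) = gram B i j := rfl
  simp only [← bilin_eq_sum, this]

theorem IsHermitianForm.isUnit_det {G : LinearMap.BilinForm ℝ (Cn n)} (hG : IsHermitianForm G) :
    IsUnit (gram G).det := by
  obtain ⟨e, he⟩ := hG.exists_unitaryFor
  exact (Matrix.isUnit_iff_isUnit_det _).1
    (IsUnit.of_mul_eq_one _ (mul_eq_one_comm.1 (he.gram_inv hG)))

theorem IsHermitianForm.det_pos {G : LinearMap.BilinForm ℝ (Cn n)} (hG : IsHermitianForm G) :
    0 < (gram G).det := by
  obtain ⟨e, he⟩ := hG.exists_unitaryFor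
  have h1 := congrArg Matrix.det (he.gram_inv hG)
  simp only [Matrix.det_mul, Matrix.det_transpose, Matrix.det_one] at h1
  rcases eq_or_ne (gram G).det 0 with h | h
  · simp [h] at h1
  · by_contra hneg
    nlinarith [mul_self_nonneg (Matrix.det (Matrix.of fun i j =>
      (realBasisB n).repr (realFrame e i) j)), lt_of_le_of_ne (not_lt.1 hneg) h]

end LinearAlgebra

/-! ### Derivatives of determinants and inverse matrices -/

section MatrixCalculus

variable {E : Type*} [NormedAddCommGroup E] [NormedSpace ℝ E] {ι : Type*} [Fintype ι]
  [DecidableEq ι] {Ω : Set E} {k : WithTop ℕ∞}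

theorem contDiffOn_matrix_det {M : E → Matrix ι ι ℝ}
    (hM : ∀ i j, ContDiffOn ℝ k (fun y => M y i j) Ω) :
    ContDiffOn ℝ k (fun y => (M y).det) Ω := by
  simp only [Matrix.det_apply']
  exact ContDiffOn.sum fun σ _ => contDiffOn_const.mul (contDiffOn_prod fun i _ => hM _ _)

theorem contDiffOn_matrix_inv {M : E → Matrix ι ι ℝ}
    (hM : ∀ i j, ContDiffOn ℝ k (fun y => M y i j) Ω)
    (hdet : ∀ y ∈ Ω, (M y).det ≠ 0) (i j : ι) : ContDiffOn ℝ k (fun y => (M y)⁻¹ i j) Ω := by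
  simp only [Matrix.inv_def, Matrix.smul_apply, smul_eq_mul, Ring.inverse_eq_inv',
    Matrix.adjugate_apply]
  refine ((contDiffOn_matrix_det hM).inv hdet).mul (contDiffOn_matrix_det fun a b => ?_)
  simp only [Matrix.updateRow_apply]
  split_ifs
  · exact contDiffOn_const
  · exact hM _ _

/-- Jacobi's formula for the derivative of a determinant. -/
theorem fderiv_matrix_det {M : E → Matrix ι ι ℝ} {y : E}
    (hM : ∀ i j, DifferentiableAt ℝ (fun z => M z i j) y) (v : E) :
    fderiv ℝ (fun z => (M z).det) y v
      = ∑ i, ∑ j, (M y).adjugate j i * fderiv ℝ (fun z => M z i j) y v := by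
  have hrow : ∀ i, HasFDerivAt (fun z => M z i)
      (ContinuousLinearMap.pi fun j => fderiv ℝ (fun z => M z i j) y) y := fun i =>
    hasFDerivAt_pi.2 fun j => (hM i j).hasFDerivAt
  let D : ContinuousMultilinearMap ℝ (fun _ : ι => ι → ℝ) ℝ :=
    { toMultilinearMap := (Matrix.detRowAlternating (R := ℝ) (n := ι)).toMultilinearMap
      cont := by
        change Continuous fun A : ι → ι → ℝ => Matrix.det (Matrix.of A)
        exact Continuous.matrix_det continuous_id }
  have h := HasFDerivAt.multilinear_comp (f := D) hrow
  have h2 : HasFDerivAt (fun z => (M z).det) _ y := h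
  rw [h2.fderiv]
  simp only [sum_apply, ContinuousLinearMap.comp_apply]
  refine Finset.sum_congr rfl fun i _ => ?_
  have h3 : ∀ r : ι → ℝ, (D.toContinuousLinearMap (fun i => M y i) i) r
      = ((M y).updateRow i r).det := fun r => rfl
  rw [h3, ← Matrix.cramer_transpose_apply, Matrix.cramer_eq_adjugate_mulVec, Matrix.mulVec,
    dotProduct]
  refine Finset.sum_congr rfl fun j _ => ?_
  rw [← Matrix.adjugate_transpose, Matrix.transpose_apply]
  rfl

end MatrixCalculus

/-! ### The Poisson tensor of a Hermitian form -/

section Divergence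

variable {n : ℕ}

/-- Multiplication by `i` in the standard real basis. -/
def matJ (n : ℕ) : Matrix (Fin n ⊕ Fin n) (Fin n ⊕ Fin n) ℝ :=
  Matrix.of fun l j => (realBasisB n).repr (Complex.I • realBasis n j) l

theorem I_smul_realBasis (j : Fin n ⊕ Fin n) :
    Complex.I • realBasis n j = ∑ l, matJ n l j • realBasis n l := by
  conv_lhs => rw [← (realBasisB n).sum_repr (Complex.I • realBasis n j)]
  simp [matJ]

theorem matJ_mul_matJ : matJ n * matJ n = -1 := by
  ext i j
  have h1 : Complex.I • Complex.I • realBasis n j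
      = ∑ l, matJ n l j • (Complex.I • realBasis n l) := by
    conv_lhs => rw [I_smul_realBasis]
    rw [Finset.smul_sum]
    exact Finset.sum_congr rfl fun l _ => smul_comm _ _ _
  have h2 := congrArg (fun v => (realBasisB n).repr v i) h1
  simp only [smul_smul, Complex.I_mul_I, neg_one_smul, map_neg, map_sum, map_smul,
    Finsupp.coe_neg, Pi.neg_apply, Finsupp.coe_finsetSum, Finset.sum_apply, Finsupp.coe_smul,
    Pi.smul_apply, smul_eq_mul] at h2
  rw [Matrix.mul_apply, Matrix.neg_apply, Matrix.one_apply]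
  have h3 : (realBasisB n).repr (realBasis n j) i = if i = j then 1 else 0 := by
    rw [← coe_realBasisB, Module.Basis.repr_self, Finsupp.single_apply]
    simp only [eq_comm]
  rw [← h3, h2]
  exact Finset.sum_congr rfl fun l _ => mul_comm _ _

/-- The Poisson tensor of a Hermitian form, in the standard real basis. Up to the sign it is the
inverse of the matrix `omegaMat G` of the fundamental two-form. -/
def poisson (G : LinearMap.BilinForm ℝ (Cn n)) : Matrix (Fin n ⊕ Fin n) (Fin n ⊕ Fin n) ℝ :=
  (gram G)⁻¹ * (matJ n).transpose

/-- The matrix of the fundamental two-form `G(i v, w)` of a Hermitian form. -/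
def omegaMat (G : LinearMap.BilinForm ℝ (Cn n)) : Matrix (Fin n ⊕ Fin n) (Fin n ⊕ Fin n) ℝ :=
  Matrix.of fun a b => G (Complex.I • realBasis n a) (realBasis n b)

theorem omegaMat_eq (G : LinearMap.BilinForm ℝ (Cn n)) :
    omegaMat G = (matJ n).transpose * gram G := by
  ext a b
  simp [omegaMat, I_smul_realBasis, Matrix.mul_apply, gram_apply]

theorem matJ_transpose_mul : (matJ n).transpose * (matJ n).transpose = -1 := by
  rw [← Matrix.transpose_mul, matJ_mul_matJ, Matrix.transpose_neg, Matrix.transpose_one]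

variable {G : LinearMap.BilinForm ℝ (Cn n)}

theorem IsHermitianForm.omegaMat_mul_poisson (hG : IsHermitianForm G) :
    omegaMat G * poisson G = -1 := by
  rw [omegaMat_eq, poisson, Matrix.mul_assoc, ← Matrix.mul_assoc (gram G),
    Matrix.mul_nonsing_inv _ hG.isUnit_det, Matrix.one_mul, matJ_transpose_mul]

theorem IsHermitianForm.poisson_mul_omegaMat (hG : IsHermitianForm G) :
    poisson G * omegaMat G = -1 := by
  rw [omegaMat_eq, poisson, Matrix.mul_assoc, ← Matrix.mul_assoc (matJ n).transpose,
    matJ_transpose_mul, neg_one_mul, mul_neg, Matrix.nonsing_inv_mul _ hG.isUnit_det]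

theorem IsHermitianForm.omegaMat_antisymm (hG : IsHermitianForm G) (a b) :
    omegaMat G a b = -omegaMat G b a := by
  simp only [omegaMat, Matrix.of_apply]
  rw [hG.smul_I_left, hG.symm]

theorem IsHermitianForm.poisson_transpose (hG : IsHermitianForm G) :
    (poisson G).transpose = -poisson G := by
  have hW : (omegaMat G).transpose = -omegaMat G := by
    ext a b
    exact hG.omegaMat_antisymm b a
  have h1 := congrArg Matrix.transpose hG.omegaMat_mul_poisson
  rw [Matrix.transpose_mul, hW, Matrix.transpose_neg, Matrix.transpose_one, mul_neg, neg_inj] at h1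
  have h2 : ((poisson G).transpose + poisson G) * omegaMat G = 0 := by
    rw [add_mul, h1, hG.poisson_mul_omegaMat, add_neg_cancel]
  have h3 := congrArg (· * poisson G) h2
  simp only [zero_mul, Matrix.mul_assoc, hG.omegaMat_mul_poisson, mul_neg, mul_one] at h3
  exact eq_neg_of_add_eq_zero_left (neg_eq_zero.1 h3)

theorem IsHermitianForm.poisson_antisymm (hG : IsHermitianForm G) (a b) :
    poisson G a b = -poisson G b a := congrFun (congrFun hG.poisson_transpose b) a

/-- The trace with respect to `G` of `(v, w) ↦ β(v, i w)` is the contraction of `β` with the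
Poisson tensor. -/
theorem trG_comp_I (β : LinearMap.BilinForm ℝ (Cn n)) :
    trG G (fun v w => β v (Complex.I • w))
      = ∑ i, ∑ l, poisson G i l * β (realBasis n i) (realBasis n l) := by
  simp only [trG, I_smul_realBasis, map_sum, map_smul, smul_eq_mul, poisson, Matrix.mul_apply,
    Matrix.transpose_apply, Finset.mul_sum, Finset.sum_mul]
  refine Finset.sum_congr rfl fun i _ => ?_
  rw [Finset.sum_comm]
  refine Finset.sum_congr rfl fun l _ => Finset.sum_congr rfl fun j _ => by ring

/-- The algebraic content of `d ω = 0` for the divergence of the Poisson tensor: `w i` stands for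
the `i`-th partial derivative of the matrix of `ω`, `P * w i * P` for that of the Poisson tensor
`P`, and `2⁻¹ * (P * w b).trace` for minus the logarithmic derivative of the volume density. -/
theorem sum_poisson_deriv {ι : Type*} [Fintype ι] [DecidableEq ι] {P : Matrix ι ι ℝ}
    {w : ι → Matrix ι ι ℝ} (hP : ∀ a b, P a b = -P b a) (hw : ∀ i a b, w i a b = -w i b a)
    (hcyc : ∀ i a b, w i a b + w a b i + w b i a = 0) (l : ι) :
    ∑ i, (P * w i * P) i l = 2⁻¹ * ∑ b, (P * w b).trace * P b l := by
  have key : ∀ b, ∑ i, ∑ a, P i a * w i a b = 2⁻¹ * (P * w b).trace := by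
    intro b
    have h0 : ∑ i, ∑ a, P i a * (w i a b + w a b i + w b i a) = 0 := by simp [hcyc]
    simp only [mul_add, Finset.sum_add_distrib] at h0
    -- by antisymmetry, two of the three terms of the cyclic sum contribute equally
    have h1 : ∑ i, ∑ a, P i a * w a b i = ∑ i, ∑ a, P i a * w i a b := by
      rw [Finset.sum_comm]
      refine Finset.sum_congr rfl fun i _ => Finset.sum_congr rfl fun a _ => ?_
      rw [hP a i, hw i b a]; ring
    have h2 : ∑ i, ∑ a, P i a * w b i a = -(P * w b).trace := by
      simp only [Matrix.trace, Matrix.diag, Matrix.mul_apply, ← Finset.sum_neg_distrib]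
      refine Finset.sum_congr rfl fun i _ => Finset.sum_congr rfl fun a _ => ?_
      rw [hw b i a]; ring
    rw [h1, h2] at h0
    linarith
  simp only [Matrix.mul_apply (M := P * w _), Matrix.mul_apply (M := P)]
  rw [Finset.sum_comm, Finset.mul_sum]
  refine Finset.sum_congr rfl fun b _ => ?_
  rw [← Finset.sum_mul, key b]
  ring

end Divergence

/-! ### The divergence theorem for Kähler metrics -/

section Integration

variable {n : ℕ} {Ω K : Set (Cn n)}

theorem integrable_mul_of_compact_subset (hK : IsCompact K) (hKΩ : K ⊆ Ω)
    {u g : Cn n → ℝ} (hu : ContinuousOn u Ω) (hg : Continuous g) (hg0 : ∀ y ∉ K, g y = 0) :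
    Integrable fun y => u y * g y := by
  have h1 : IntegrableOn (fun y => u y * g y) K :=
    ((hu.mono hKΩ).mul hg.continuousOn).integrableOn_compact hK
  refine (integrableOn_iff_integrable_of_support_subset fun y hy => ?_).1 h1
  by_contra h
  exact hy (by simp [hg0 y h])

theorem fderiv_eq_zero_of_notMem (hK : IsCompact K) {g : Cn n → ℝ} (hg0 : ∀ y ∉ K, g y = 0)
    {y : Cn n} (hy : y ∉ K) : fderiv ℝ g y = 0 := by
  have : g =ᶠ[𝓝 y] fun _ => 0 := by
    filter_upwards [hK.isClosed.isOpen_compl.mem_nhds hy] with z hz using hg0 z hz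
  rw [this.fderiv_eq]
  simp

/-- Integration by parts against a compactly supported function. -/
theorem integral_mul_fderiv_of_compact_subset (hΩ : IsOpen Ω) (hK : IsCompact K) (hKΩ : K ⊆ Ω)
    {u g : Cn n → ℝ} (hu : ContDiffOn ℝ 1 u Ω) (hg : ContDiff ℝ 1 g) (hg0 : ∀ y ∉ K, g y = 0)
    (v : Cn n) : ∫ y, u y * fderiv ℝ g y v = -∫ y, fderiv ℝ u y v * g y := by
  have hts : tsupport g ⊆ K :=
    closure_minimal (fun y hy => by by_contra h; exact hy (hg0 y h)) hK.isClosed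
  have hdu : ContinuousOn (fun y => fderiv ℝ u y v) Ω :=
    (hu.continuousOn_fderiv_of_isOpen hΩ le_rfl).clm_apply continuousOn_const
  refine integral_mul_fderiv_eq_neg_fderiv_mul_of_integrable
    (integrable_mul_of_compact_subset hK hKΩ hdu hg.continuous hg0)
    (integrable_mul_of_compact_subset hK hKΩ hu.continuousOn
      ((hg.continuous_fderiv (by simp)).clm_apply continuous_const) fun y hy => by
        simp [fderiv_eq_zero_of_notMem hK hg0 hy])
    (integrable_mul_of_compact_subset hK hKΩ hu.continuousOn hg.continuous hg0)
    (fun y hy => (hu.contDiffAt (hΩ.mem_nhds (hKΩ (hts hy)))).differentiableAt (by simp))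
    (fun y _ => hg.contDiffAt.differentiableAt (by simp))

/-- The Hermitian form `G` depends smoothly on the point of `Ω` and its fundamental two-form is
closed. -/
structure IsKahlerOn (G : Cn n → LinearMap.BilinForm ℝ (Cn n)) (Ω : Set (Cn n)) : Prop where
  isOpen : IsOpen Ω
  isHermitianForm : ∀ y ∈ Ω, IsHermitianForm (G y)
  contDiffOn : ∀ v w, ContDiffOn ℝ ∞ (fun y => G y v w) Ω
  closed : ∀ y ∈ Ω, ∀ u v w : Cn n,
    fderiv ℝ (fun z => G z (Complex.I • v) w) y u + fderiv ℝ (fun z => G z (Complex.I • w) u) y v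
      + fderiv ℝ (fun z => G z (Complex.I • u) v) y w = 0

variable {G : Cn n → LinearMap.BilinForm ℝ (Cn n)}

theorem IsKahlerOn.contDiffOn_det (hG : IsKahlerOn G Ω) :
    ContDiffOn ℝ ∞ (fun y => (gram (G y)).det) Ω :=
  contDiffOn_matrix_det fun _ _ => hG.contDiffOn _ _

theorem IsKahlerOn.contDiffOn_sqrt_det (hG : IsKahlerOn G Ω) :
    ContDiffOn ℝ ∞ (fun y => √(gram (G y)).det) Ω :=
  hG.contDiffOn_det.sqrt fun y hy => ((hG.isHermitianForm y hy).det_pos).ne'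

theorem IsKahlerOn.contDiffOn_inv (hG : IsKahlerOn G Ω) (i j) :
    ContDiffOn ℝ ∞ (fun y => (gram (G y))⁻¹ i j) Ω :=
  contDiffOn_matrix_inv (fun _ _ => hG.contDiffOn _ _)
    (fun y hy => ((hG.isHermitianForm y hy).det_pos).ne') i j

theorem IsKahlerOn.contDiffOn_poisson (hG : IsKahlerOn G Ω) (i j) :
    ContDiffOn ℝ ∞ (fun y => poisson (G y) i j) Ω := by
  simp only [poisson, Matrix.mul_apply]
  exact ContDiffOn.sum fun l _ => (hG.contDiffOn_inv i l).mul contDiffOn_const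

/-- On a Kähler manifold the Poisson tensor is divergence free. Differentiating `ω P = -1` gives
`∂ᵢP = P (∂ᵢω) P`, Jacobi's formula gives the derivative of the volume density, and both terms of
the product rule cancel by `sum_poisson_deriv`. -/
theorem IsKahlerOn.divergence_poisson (hG : IsKahlerOn G Ω) {y : Cn n} (hy : y ∈ Ω)
    (l : Fin n ⊕ Fin n) :
    ∑ i, fderiv ℝ (fun z => poisson (G z) i l * √(gram (G z)).det) y (realBasis n i) = 0 := by
  have hnhds := hG.isOpen.mem_nhds hy
  have hGy := hG.isHermitianForm y hy
  have dP : ∀ i j, DifferentiableAt ℝ (fun z => poisson (G z) i j) y := fun i j =>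
    ((hG.contDiffOn_poisson i j).contDiffAt hnhds).differentiableAt (by simp)
  have dG : ∀ i j, DifferentiableAt ℝ (fun z => gram (G z) i j) y := fun i j =>
    ((hG.contDiffOn _ _).contDiffAt hnhds).differentiableAt (by simp)
  have dW : ∀ i j, DifferentiableAt ℝ (fun z => omegaMat (G z) i j) y := fun i j =>
    ((hG.contDiffOn _ _).contDiffAt hnhds).differentiableAt (by simp)
  have dS : DifferentiableAt ℝ (fun z => √(gram (G z)).det) y :=
    (hG.contDiffOn_sqrt_det.contDiffAt hnhds).differentiableAt (by simp)
  have ddet : DifferentiableAt ℝ (fun z => (gram (G z)).det) y :=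
    (hG.contDiffOn_det.contDiffAt hnhds).differentiableAt (by simp)
  set P := poisson (G y) with hP
  set S := √(gram (G y)).det with hS
  have hSpos : 0 < S := Real.sqrt_pos.2 hGy.det_pos
  let g : (Fin n ⊕ Fin n) → Matrix (Fin n ⊕ Fin n) (Fin n ⊕ Fin n) ℝ := fun i =>
    Matrix.of fun a b => fderiv ℝ (fun z => gram (G z) a b) y (realBasis n i)
  let w : (Fin n ⊕ Fin n) → Matrix (Fin n ⊕ Fin n) (Fin n ⊕ Fin n) ℝ := fun i =>
    Matrix.of fun a b => fderiv ℝ (fun z => omegaMat (G z) a b) y (realBasis n i)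
  let p : (Fin n ⊕ Fin n) → Matrix (Fin n ⊕ Fin n) (Fin n ⊕ Fin n) ℝ := fun i =>
    Matrix.of fun a b => fderiv ℝ (fun z => poisson (G z) a b) y (realBasis n i)
  have hw : ∀ i, w i = (matJ n).transpose * g i := by
    intro i
    ext a b
    have h1 : (fun z => omegaMat (G z) a b) = fun z => ∑ c, matJ n c a * gram (G z) c b := by
      funext z
      rw [omegaMat_eq, Matrix.mul_apply]; rfl
    simp only [w, g, Matrix.of_apply, Matrix.mul_apply, Matrix.transpose_apply]
    rw [h1, fderiv_fun_sum fun c _ => (dG c b).const_mul _, sum_apply]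
    refine Finset.sum_congr rfl fun c _ => ?_
    rw [fderiv_const_mul (dG c b)]
    rfl
  have hp : ∀ i, p i = P * w i * P := by
    intro i
    have h1 : w i * P + omegaMat (G y) * p i = 0 := by
      ext a c
      have h2 : (fun z => ∑ b, omegaMat (G z) a b * poisson (G z) b c) =ᶠ[𝓝 y]
          fun _ => (-1 : Matrix (Fin n ⊕ Fin n) (Fin n ⊕ Fin n) ℝ) a c := by
        filter_upwards [hnhds] with z hz
        rw [← (hG.isHermitianForm z hz).omegaMat_mul_poisson, Matrix.mul_apply]
      have h3 := h2.fderiv_eq (𝕜 := ℝ)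
      rw [fderiv_fun_sum fun b _ => (dW a b).fun_mul (dP b c)] at h3
      have h4 := congrArg (fun L : Cn n →L[ℝ] ℝ => L (realBasis n i)) h3
      simp only [sum_apply, fderiv_fun_const, Pi.zero_apply,
        zero_apply] at h4
      rw [Matrix.zero_apply, ← h4, Matrix.add_apply, Matrix.mul_apply, Matrix.mul_apply,
        ← Finset.sum_add_distrib]
      refine Finset.sum_congr rfl fun b _ => ?_
      rw [fderiv_fun_mul (dW a b) (dP b c)]
      simp [w, p, hP]
      ring
    have h2 := congrArg (fun A => P * A) h1
    simp only [mul_add, mul_zero, ← Matrix.mul_assoc] at h2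
    rw [hP, hGy.poisson_mul_omegaMat, neg_one_mul, ← hP, ← sub_eq_add_neg, sub_eq_zero] at h2
    exact h2.symm
  have hds : ∀ i, fderiv ℝ (fun z => √(gram (G z)).det) y (realBasis n i)
      = -(2⁻¹ * (P * w i).trace * S) := by
    intro i
    have h1 : (P * w i) = -((gram (G y))⁻¹ * g i) := by
      rw [hw, hP, poisson, Matrix.mul_assoc, ← Matrix.mul_assoc (matJ n).transpose,
        matJ_transpose_mul, neg_one_mul, mul_neg]
    have h2 : ((gram (G y))⁻¹ * g i).trace * (gram (G y)).det
        = fderiv ℝ (fun z => (gram (G z)).det) y (realBasis n i) := by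
      rw [fderiv_matrix_det dG, Matrix.trace, Finset.sum_comm, Finset.sum_mul]
      refine Finset.sum_congr rfl fun a _ => ?_
      rw [Matrix.diag, Matrix.mul_apply, Finset.sum_mul]
      refine Finset.sum_congr rfl fun b _ => ?_
      rw [Matrix.inv_def, Ring.inverse_eq_inv', Matrix.smul_apply, smul_eq_mul]
      have := hGy.det_pos.ne'
      simp only [g, Matrix.of_apply]
      field_simp
    rw [h1, Matrix.trace_neg]
    have h3 := (ddet.hasFDerivAt.sqrt hGy.det_pos.ne').fderiv
    rw [h3, smul_apply, ← h2, smul_eq_mul, ← hS]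
    have h4 : (gram (G y)).det = S * S := (Real.mul_self_sqrt hGy.det_pos.le).symm
    rw [h4]
    field_simp
  have hterm : ∀ i, fderiv ℝ (fun z => poisson (G z) i l * √(gram (G z)).det) y (realBasis n i)
      = S * (P * w i * P) i l - 2⁻¹ * S * ((P * w i).trace * P i l) := by
    intro i
    rw [fderiv_fun_mul (dP i l) dS]
    simp only [add_apply, FunLike.coe_smul, Pi.smul_apply, smul_eq_mul, hds]
    rw [← hp i, ← hP, ← hS]
    simp only [p, Matrix.of_apply]
    ring
  have halg := sum_poisson_deriv (P := P) (w := w) (fun a b => hGy.poisson_antisymm a b)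
    (fun i a b => ?_) (fun i a b => ?_) l
  · simp only [hterm, Finset.sum_sub_distrib, ← Finset.mul_sum]
    rw [halg]
    ring
  · have h1 : (fun z => omegaMat (G z) a b) =ᶠ[𝓝 y] fun z => -omegaMat (G z) b a := by
      filter_upwards [hnhds] with z hz using (hG.isHermitianForm z hz).omegaMat_antisymm a b
    simp only [w, Matrix.of_apply]
    rw [h1.fderiv_eq, fderiv_fun_neg]
    rfl
  · exact hG.closed y hy _ _ _

/-- For a compactly supported one-form `γ` on a Kähler manifold the integral of the contraction of
`dγ` with the fundamental two-form vanishes: integrate by parts, and use that the Poisson tensor is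
divergence free. -/
theorem IsKahlerOn.integral_trG_eq_zero (hG : IsKahlerOn G Ω) (hK : IsCompact K) (hKΩ : K ⊆ Ω)
    {γ : Cn n → Cn n →ₗ[ℝ] ℝ} (hγ : ∀ v, ContDiff ℝ 1 fun y => γ y v)
    (hγ0 : ∀ y ∉ K, γ y = 0) :
    ∫ y, trG (G y) (fun v w => fderiv ℝ (fun z => γ z (Complex.I • w)) y v
      - fderiv ℝ (fun z => γ z v) y (Complex.I • w)) * √(gram (G y)).det = 0 := by
  have hγd : ∀ v y, DifferentiableAt ℝ (fun z => γ z v) y := fun v y =>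
    (hγ v).contDiffAt.differentiableAt (by simp)
  have hγ0' : ∀ v, ∀ y ∉ K, γ y v = 0 := fun v y hy => by simp [hγ0 y hy]
  have hPS : ∀ i l, ContDiffOn ℝ 1 (fun z => poisson (G z) i l * √(gram (G z)).det) Ω := fun i l =>
    ((hG.contDiffOn_poisson i l).mul hG.contDiffOn_sqrt_det).of_le (by simp)
  -- the integrand is twice the contraction of the Poisson tensor with the derivative of `γ`
  have hpt : ∀ y, trG (G y) (fun v w => fderiv ℝ (fun z => γ z (Complex.I • w)) y v
      - fderiv ℝ (fun z => γ z v) y (Complex.I • w)) * √(gram (G y)).det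
      = 2 * ∑ l, ∑ i, poisson (G y) i l * √(gram (G y)).det *
          fderiv ℝ (fun z => γ z (realBasis n l)) y (realBasis n i) := by
    intro y
    by_cases hy : y ∈ K
    · have hGy := hG.isHermitianForm y (hKΩ hy)
      let β : LinearMap.BilinForm ℝ (Cn n) := LinearMap.mk₂ ℝ
        (fun v w => fderiv ℝ (fun z => γ z w) y v - fderiv ℝ (fun z => γ z v) y w)
        (fun v v' w => by
          simp only [map_add]
          rw [fderiv_fun_add (hγd _ _) (hγd _ _), add_apply]; ring)
        (fun c v w => by
          simp only [map_smul, smul_eq_mul]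
          rw [fderiv_const_mul (hγd _ _), FunLike.coe_smul, Pi.smul_apply, smul_eq_mul]; ring)
        (fun v w w' => by
          simp only [map_add]
          rw [fderiv_fun_add (hγd _ _) (hγd _ _), add_apply]; ring)
        (fun c v w => by
          simp only [map_smul, smul_eq_mul]
          rw [fderiv_const_mul (hγd _ _), FunLike.coe_smul, Pi.smul_apply, smul_eq_mul]; ring)
      have h1 := trG_comp_I (G := G y) β
      have h2 : ∑ i, ∑ l, poisson (G y) i l * β (realBasis n i) (realBasis n l)
          = 2 * ∑ l, ∑ i, poisson (G y) i l *
            fderiv ℝ (fun z => γ z (realBasis n l)) y (realBasis n i) := by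
        simp only [β, LinearMap.mk₂_apply, mul_sub, Finset.sum_sub_distrib]
        have h3 : ∑ i, ∑ l, poisson (G y) i l *
            fderiv ℝ (fun z => γ z (realBasis n i)) y (realBasis n l)
            = -∑ l, ∑ i, poisson (G y) i l *
            fderiv ℝ (fun z => γ z (realBasis n l)) y (realBasis n i) := by
          simp only [← Finset.sum_neg_distrib]
          refine Finset.sum_congr rfl fun i _ => Finset.sum_congr rfl fun l _ => ?_
          rw [hGy.poisson_antisymm i l]; ring
        rw [h3, Finset.sum_comm]
        ring
      have h4 : trG (G y) (fun v w => fderiv ℝ (fun z => γ z (Complex.I • w)) y v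
          - fderiv ℝ (fun z => γ z v) y (Complex.I • w)) = trG (G y)
          (fun v w => β v (Complex.I • w)) := rfl
      rw [h4, h1, h2, mul_assoc, Finset.sum_mul]
      congr 1
      refine Finset.sum_congr rfl fun l _ => ?_
      rw [Finset.sum_mul]
      refine Finset.sum_congr rfl fun i _ => by ring
    · have h1 : ∀ v, fderiv ℝ (fun z => γ z v) y = 0 := fun v =>
        fderiv_eq_zero_of_notMem hK (hγ0' v) hy
      simp [trG, h1]
  simp only [hpt]
  have hint : ∀ i l, Integrable fun y => poisson (G y) i l * √(gram (G y)).det *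
      fderiv ℝ (fun z => γ z (realBasis n l)) y (realBasis n i) := fun i l =>
    integrable_mul_of_compact_subset hK hKΩ (hPS i l).continuousOn
      (((hγ _).continuous_fderiv (by simp)).clm_apply continuous_const) fun y hy => by
        simp [fderiv_eq_zero_of_notMem hK (hγ0' _) hy]
  have hint2 : ∀ i l, Integrable fun y =>
      fderiv ℝ (fun z => poisson (G z) i l * √(gram (G z)).det) y (realBasis n i) *
        γ y (realBasis n l) := fun i l =>
    integrable_mul_of_compact_subset hK hKΩ
      (((hPS i l).continuousOn_fderiv_of_isOpen hG.isOpen le_rfl).clm_apply continuousOn_const)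
      (hγ _).continuous (hγ0' _)
  rw [integral_const_mul, integral_finsetSum _ fun l _ => integrable_finsetSum _
    fun i _ => hint i l]
  have hl : ∀ l, ∫ y, ∑ i, poisson (G y) i l * √(gram (G y)).det *
      fderiv ℝ (fun z => γ z (realBasis n l)) y (realBasis n i) = 0 := by
    intro l
    rw [integral_finsetSum _ fun i _ => hint i l]
    have h1 : ∀ i, ∫ y, poisson (G y) i l * √(gram (G y)).det *
        fderiv ℝ (fun z => γ z (realBasis n l)) y (realBasis n i)
        = -∫ y, fderiv ℝ (fun z => poisson (G z) i l * √(gram (G z)).det) y (realBasis n i) *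
          γ y (realBasis n l) := fun i =>
      integral_mul_fderiv_of_compact_subset hG.isOpen hK hKΩ (hPS i l) (hγ _) (hγ0' _) _
    simp only [h1, Finset.sum_neg_distrib]
    rw [← integral_finsetSum _ fun i _ => hint2 i l]
    simp only [← Finset.sum_mul]
    rw [neg_eq_zero]
    refine integral_eq_zero_of_ae (Eventually.of_forall fun y => ?_)
    by_cases hy : y ∈ K
    · simp [hG.divergence_poisson (hKΩ hy) l]
    · simp [hγ0' _ y hy]
  rw [Finset.sum_eq_zero fun l _ => hl l, mul_zero]

end Integration

/-! ### Changes of coordinates -/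

section Charts

variable {n : ℕ} {M : Type*} [TopologicalSpace M] [ChartedSpace (Cn n) M]

/-- The change of coordinates from `chartAt x₀` to `chartAt x`. -/
def trans (x₀ x : M) (y : Cn n) : Cn n := chartAt (Cn n) x ((chartAt (Cn n) x₀).symm y)

/-- The set of coordinates in `chartAt x₀` of the points in the domain of `chartAt x`. -/
def transDomain (x₀ x : M) : Set (Cn n) :=
  (chartAt (Cn n) x₀).target ∩ (chartAt (Cn n) x₀).symm ⁻¹' (chartAt (Cn n) x).source

theorem isOpen_transDomain (x₀ x : M) : IsOpen (transDomain (n := n) x₀ x) :=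
  (chartAt (Cn n) x₀).isOpen_inter_preimage_symm (chartAt (Cn n) x).open_source

theorem trans_mem {x₀ x : M} {y : Cn n} (hy : y ∈ transDomain x₀ x) :
    trans x₀ x y ∈ transDomain x x₀ := by
  refine ⟨(chartAt (Cn n) x).map_source hy.2, ?_⟩
  simp only [trans, mem_preimage]
  rw [(chartAt (Cn n) x).left_inv hy.2]
  exact (chartAt (Cn n) x₀).map_target hy.1

theorem symm_trans {x₀ x : M} {y : Cn n} (hy : y ∈ transDomain x₀ x) :
    (chartAt (Cn n) x).symm (trans x₀ x y) = (chartAt (Cn n) x₀).symm y :=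
  (chartAt (Cn n) x).left_inv hy.2

theorem trans_trans_apply {x₀ x : M} {y : Cn n} (hy : y ∈ transDomain x₀ x) :
    trans x x₀ (trans x₀ x y) = y := by
  rw [trans, symm_trans hy, (chartAt (Cn n) x₀).right_inv hy.1]

theorem chart_mem_transDomain {x₀ x p : M} (hp : p ∈ (chartAt (Cn n) x₀).source)
    (hp' : p ∈ (chartAt (Cn n) x).source) : chartAt (Cn n) x₀ p ∈ transDomain (n := n) x₀ x := by
  refine ⟨(chartAt (Cn n) x₀).map_source hp, ?_⟩
  rwa [mem_preimage, (chartAt (Cn n) x₀).left_inv hp]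

theorem trans_chart {x₀ x p : M} (hp : p ∈ (chartAt (Cn n) x₀).source) :
    trans x₀ x (chartAt (Cn n) x₀ p) = chartAt (Cn n) x p := by
  rw [trans, (chartAt (Cn n) x₀).left_inv hp]

theorem fderiv_trans_self {x : M} {y : Cn n} (hy : y ∈ (chartAt (Cn n) x).target) (v : Cn n) :
    fderiv ℝ (trans (n := n) x x) y v = v := by
  have heq : trans (n := n) x x =ᶠ[𝓝 y] id := by
    filter_upwards [(chartAt (Cn n) x).open_target.mem_nhds hy] with z hz
    exact (chartAt (Cn n) x).right_inv hz
  rw [heq.fderiv_eq]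
  simp

theorem coordVec_add (x₀ : M) (y v w : Cn n) :
    coordVec x₀ y (v + w) = coordVec x₀ y v + coordVec x₀ y w :=
  map_add (mfderiv 𝓘(ℝ, Cn n) 𝓘(ℝ, Cn n) (chartAt (Cn n) x₀).symm y) v w

theorem coordVec_smul (x₀ : M) (y : Cn n) (c : ℝ) (v : Cn n) :
    coordVec x₀ y (c • v) = c • coordVec x₀ y v :=
  map_smul (mfderiv 𝓘(ℝ, Cn n) 𝓘(ℝ, Cn n) (chartAt (Cn n) x₀).symm y) c v

section Complex

variable [IsManifold 𝓘(ℂ, Cn n) ω M]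

theorem contDiffOn_trans_complex (x₀ x : M) :
    ContDiffOn ℂ ω (trans (n := n) x₀ x) (transDomain x₀ x) := by
  rw [← contMDiffOn_iff_contDiffOn]
  exact (contMDiffOn_chart (I := 𝓘(ℂ, Cn n)) (x := x)).comp
    ((contMDiffOn_chart_symm (I := 𝓘(ℂ, Cn n)) (x := x₀)).mono inter_subset_left) inter_subset_right

theorem contDiffAt_trans {x₀ x : M} {y : Cn n} (hy : y ∈ transDomain x₀ x) :
    ContDiffAt ℝ ω (trans (n := n) x₀ x) y :=
  ((contDiffOn_trans_complex x₀ x).contDiffAt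
    ((isOpen_transDomain x₀ x).mem_nhds hy)).restrict_scalars ℝ

theorem differentiableAt_trans {x₀ x : M} {y : Cn n} (hy : y ∈ transDomain x₀ x) :
    DifferentiableAt ℝ (trans (n := n) x₀ x) y :=
  (contDiffAt_trans hy).differentiableAt (by simp)

theorem _root_.DifferentiableAt.fderiv_real_smul {E F : Type*} [NormedAddCommGroup E]
    [NormedSpace ℂ E] [NormedSpace ℝ E] [IsScalarTower ℝ ℂ E] [NormedAddCommGroup F]
    [NormedSpace ℂ F] [NormedSpace ℝ F] [IsScalarTower ℝ ℂ F] {f : E → F} {y : E}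
    (hf : DifferentiableAt ℂ f y) (c : ℂ) (v : E) :
    fderiv ℝ f y (c • v) = c • fderiv ℝ f y v := by
  rw [hf.fderiv_restrictScalars ℝ]
  simp

theorem fderiv_trans_smul {x₀ x : M} {y : Cn n} (hy : y ∈ transDomain x₀ x) (c : ℂ) (v : Cn n) :
    fderiv ℝ (trans (n := n) x₀ x) y (c • v) = c • fderiv ℝ (trans x₀ x) y v :=
  (((contDiffOn_trans_complex x₀ x).contDiffAt
    ((isOpen_transDomain x₀ x).mem_nhds hy)).differentiableAt (by simp)).fderiv_real_smul c v

theorem fderiv_trans_comp {x₀ x₁ x₂ : M} {y : Cn n} (h1 : y ∈ transDomain x₀ x₁)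
    (h2 : y ∈ transDomain x₀ x₂) (v : Cn n) :
    fderiv ℝ (trans (n := n) x₀ x₂) y v
      = fderiv ℝ (trans x₁ x₂) (trans x₀ x₁ y) (fderiv ℝ (trans x₀ x₁) y v) := by
  have h3 : trans x₀ x₁ y ∈ transDomain x₁ x₂ := by
    refine ⟨(trans_mem h1).1, ?_⟩
    rw [mem_preimage, symm_trans h1]
    exact h2.2
  have heq : trans (n := n) x₀ x₂ =ᶠ[𝓝 y] trans x₁ x₂ ∘ trans x₀ x₁ := by
    filter_upwards [(isOpen_transDomain x₀ x₁).mem_nhds h1] with z hz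
    simp only [Function.comp, trans]
    rw [(chartAt (Cn n) x₁).left_inv hz.2]
  rw [heq.fderiv_eq, fderiv_comp _ (differentiableAt_trans h3) (differentiableAt_trans h1)]
  rfl

theorem fderiv_trans_left_inv {x₀ x : M} {y : Cn n} (hy : y ∈ transDomain x₀ x) (v : Cn n) :
    fderiv ℝ (trans x x₀) (trans x₀ x y) (fderiv ℝ (trans (n := n) x₀ x) y v) = v := by
  rw [← fderiv_trans_comp hy ⟨hy.1, (chartAt (Cn n) x₀).map_target hy.1⟩, fderiv_trans_self hy.1]

theorem mdifferentiableAt_chart_symm {x₀ : M} {y : Cn n} (hy : y ∈ (chartAt (Cn n) x₀).target) :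
    MDifferentiableAt 𝓘(ℝ, Cn n) 𝓘(ℝ, Cn n) (chartAt (Cn n) x₀).symm y :=
  ((contMDiffOn_chart_symm (I := 𝓘(ℝ, Cn n)) (n := ω) (x := x₀)).contMDiffAt
    ((chartAt (Cn n) x₀).open_target.mem_nhds hy)).mdifferentiableAt (by simp)

/-- Tangent vectors at `p` are coordinate vectors of the preferred chart at `p`, so that `coordVec`
is the derivative of a change of coordinates. -/
theorem coordVec_eq {x₀ : M} {y : Cn n} (hy : y ∈ (chartAt (Cn n) x₀).target) (v : Cn n) :
    coordVec x₀ y v = fderiv ℝ (trans x₀ ((chartAt (Cn n) x₀).symm y)) y v := by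
  rw [coordVec, (mdifferentiableAt_chart_symm hy).mfderiv]
  simp only [modelWithCornersSelf_coe, range_id, fderivWithin_univ]
  rfl

theorem contMDiffOn_coordVec (x₀ : M) (v : Cn n) :
    ContMDiffOn 𝓘(ℝ, Cn n) (𝓘(ℝ, Cn n).prod 𝓘(ℝ, Cn n)) ∞
      (fun y => (⟨(chartAt (Cn n) x₀).symm y, coordVec x₀ y v⟩ : TangentBundle 𝓘(ℝ, Cn n) M))
      (chartAt (Cn n) x₀).target := by
  have h1 := (contMDiffOn_chart_symm (I := 𝓘(ℝ, Cn n)) (n := ω)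
    (x := x₀)).contMDiffOn_tangentMapWithin
    (m := ∞) (by simp) (chartAt (Cn n) x₀).open_target.uniqueMDiffOn
  have h2 : ContMDiffOn 𝓘(ℝ, Cn n) (𝓘(ℝ, Cn n).prod 𝓘(ℝ, Cn n)) ∞
      (fun y => (⟨y, v⟩ : TangentBundle 𝓘(ℝ, Cn n) (Cn n))) (chartAt (Cn n) x₀).target := by
    exact contMDiffOn_vectorSpace_iff_contDiffOn.2 contDiffOn_const
  have h3 := h1.comp h2 (fun y hy => hy)
  refine h3.congr fun y hy => ?_
  simp only [Function.comp, tangentMapWithin]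
  rw [mfderivWithin_of_isOpen (chartAt (Cn n) x₀).open_target hy]
  rfl

end Complex

end Charts

/-! ### The metric in charts -/

section Metric

variable {n : ℕ} {M : Type*} [TopologicalSpace M] [ChartedSpace (Cn n) M]
  [RiemannianBundle (fun x : M => TangentSpace 𝓘(ℝ, Cn n) x)]

/-- The Riemannian inner product of two tangent vectors at `p`. -/
def innerT (p : M) (v w : T n p) : ℝ := inner ℝ v w

theorem innerT_add_left (p : M) (u v w : T n p) :
    innerT p (u + v) w = innerT p u w + innerT p v w := inner_add_left _ _ _

theorem innerT_comm (p : M) (v w : T n p) : innerT p v w = innerT p w v := real_inner_comm _ _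

theorem innerT_smul_left (p : M) (c : ℝ) (v w : T n p) :
    innerT p (c • v) w = c * innerT p v w := real_inner_smul_left _ _ _

theorem innerT_add_right (p : M) (u v w : T n p) :
    innerT p u (v + w) = innerT p u v + innerT p u w := inner_add_right _ _ _

theorem innerT_smul_right (p : M) (c : ℝ) (v w : T n p) :
    innerT p v (c • w) = c * innerT p v w := real_inner_smul_right _ _ _

theorem innerT_self_pos (p : M) (v : T n p) (hv : v ≠ 0) : 0 < innerT p v v :=
  real_inner_self_pos.2 hv

/-- The Riemannian metric at `p`, as a bilinear form on `ℂⁿ` (via the preferred chart at `p`). -/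
def gForm (p : M) : LinearMap.BilinForm ℝ (Cn n) :=
  LinearMap.mk₂ ℝ (fun v w : Cn n => innerT p v w)
    (fun v v' w => innerT_add_left p v v' w)
    (fun c v w => innerT_smul_left p c v w)
    (fun v w w' => innerT_add_right p v w w')
    (fun c v w => innerT_smul_right p c v w)

theorem gChart_add_left (x₀ : M) (y u v w : Cn n) :
    gChart x₀ y (u + v) w = gChart x₀ y u w + gChart x₀ y v w := by
  simp only [gChart, coordVec_add]
  exact innerT_add_left _ _ _ _

theorem gChart_smul_left (x₀ : M) (y : Cn n) (c : ℝ) (v w : Cn n) :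
    gChart x₀ y (c • v) w = c * gChart x₀ y v w := by
  simp only [gChart, coordVec_smul]
  exact innerT_smul_left _ _ _ _

theorem gChart_comm (x₀ : M) (y v w : Cn n) : gChart x₀ y v w = gChart x₀ y w v :=
  innerT_comm _ _ _

/-- The metric in the chart `chartAt x₀`, as a bilinear form. -/
def gC (x₀ : M) (y : Cn n) : LinearMap.BilinForm ℝ (Cn n) :=
  LinearMap.mk₂ ℝ (gChart x₀ y)
    (fun v v' w => gChart_add_left x₀ y v v' w)
    (fun c v w => gChart_smul_left x₀ y c v w)
    (fun v w w' => by
      rw [gChart_comm x₀ y v w, gChart_comm x₀ y v w', gChart_comm, gChart_add_left])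
    (fun c v w => by rw [gChart_comm x₀ y v w, gChart_comm, gChart_smul_left]; rfl)

theorem gC_apply (x₀ : M) (y v w : Cn n) : gC x₀ y v w = gChart x₀ y v w := rfl

theorem volDensity_eq (x₀ : M) (y : Cn n) : volDensity x₀ y = √(gram (gC x₀ y)).det := rfl

theorem isHermitianForm_gForm (hK : IsKahler n M) (p : M) : IsHermitianForm (gForm (n := n) p) where
  symm v w := innerT_comm p v w
  pos v hv := innerT_self_pos p v hv
  smul_I v w := hK.inner_J p v w

/-- The unitary frame at `p`, as a family of vectors of `ℂⁿ`. -/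
def uFrame (p : M) : Fin n → Cn n := fun k => unitaryFrame (n := n) p k

theorem unitaryFor_uFrame (hK : IsKahler n M) (p : M) :
    UnitaryFor (gForm p) (uFrame (n := n) p) := by
  have h : ∃ e, IsUnitaryFrame (n := n) p e := (isHermitianForm_gForm hK p).exists_unitaryFor
  exact Classical.epsilon_spec h

variable [IsManifold 𝓘(ℂ, Cn n) ω M]

theorem gC_eq {x₀ : M} {y : Cn n} (hy : y ∈ (chartAt (Cn n) x₀).target) (v w : Cn n) :
    gC x₀ y v w = gForm ((chartAt (Cn n) x₀).symm y)
      (fderiv ℝ (trans x₀ ((chartAt (Cn n) x₀).symm y)) y v)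
      (fderiv ℝ (trans x₀ ((chartAt (Cn n) x₀).symm y)) y w) := by
  rw [gC_apply, gChart, coordVec_eq hy, coordVec_eq hy]
  rfl

/-- The transformation law of the metric. -/
theorem gC_trans {x₀ x : M} {y : Cn n} (hy : y ∈ transDomain x₀ x) (v w : Cn n) :
    gC x₀ y v w = gC x (trans x₀ x y) (fderiv ℝ (trans x₀ x) y v) (fderiv ℝ (trans x₀ x) y w) := by
  have hmem : y ∈ transDomain x₀ ((chartAt (Cn n) x₀).symm y) :=
    ⟨hy.1, mem_chart_source _ _⟩
  rw [gC_eq hy.1, gC_eq (trans_mem hy).1, symm_trans hy, fderiv_trans_comp hy hmem,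
    fderiv_trans_comp hy hmem]

theorem gForm_eq {x₀ x : M} (hx : x ∈ (chartAt (Cn n) x₀).source) (v w : Cn n) :
    gForm x v w = gC x₀ (chartAt (Cn n) x₀ x) (fderiv ℝ (trans x x₀) (chartAt (Cn n) x x) v)
      (fderiv ℝ (trans x x₀) (chartAt (Cn n) x x) w) := by
  have h0 := mem_chart_source (Cn n) x
  have h1 := chart_mem_transDomain h0 hx
  rw [← trans_chart h0, ← gC_trans h1, gC_eq h1.1, (chartAt (Cn n) x).left_inv h0,
    fderiv_trans_self h1.1, fderiv_trans_self h1.1]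

theorem isHermitianForm_gC (hK : IsKahler n M) {x₀ : M} {y : Cn n}
    (hy : y ∈ (chartAt (Cn n) x₀).target) : IsHermitianForm (gC x₀ y) := by
  have hmem : y ∈ transDomain x₀ ((chartAt (Cn n) x₀).symm y) := ⟨hy, mem_chart_source _ _⟩
  have hH := isHermitianForm_gForm hK ((chartAt (Cn n) x₀).symm y)
  refine ⟨fun v w => ?_, fun v hv => ?_, fun v w => ?_⟩
  · rw [gC_eq hy, gC_eq hy, hH.symm]
  · rw [gC_eq hy]
    refine hH.pos _ fun h => hv ?_
    rw [← fderiv_trans_left_inv hmem v, h, map_zero]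
  · rw [gC_eq hy, gC_eq hy, fderiv_trans_smul hmem, fderiv_trans_smul hmem, hH.smul_I]

theorem unitaryFor_gC {x₀ x : M} (hx : x ∈ (chartAt (Cn n) x₀).source) {e : Fin n → Cn n}
    (he : UnitaryFor (gForm x) e) :
    UnitaryFor (gC x₀ (chartAt (Cn n) x₀ x))
      (fun k => fderiv ℝ (trans x x₀) (chartAt (Cn n) x x) (e k)) := by
  have h1 := chart_mem_transDomain (mem_chart_source (Cn n) x) hx
  intro j k
  have h2 := he j k
  rw [gForm_eq hx, gForm_eq hx, fderiv_trans_smul h1] at h2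
  exact h2

variable [IsContMDiffRiemannianBundle 𝓘(ℝ, Cn n) ∞ (Cn n)
      (fun x : M => TangentSpace 𝓘(ℝ, Cn n) x)]

theorem contDiffOn_gC (x₀ : M) (v w : Cn n) :
    ContDiffOn ℝ ∞ (fun y => gC x₀ y v w) (chartAt (Cn n) x₀).target := by
  rw [← contMDiffOn_iff_contDiffOn]
  exact (contMDiffOn_coordVec x₀ v).inner_bundle (contMDiffOn_coordVec x₀ w)

theorem isKahlerOn_gC (hK : IsKahler n M) (x₀ : M) :
    IsKahlerOn (gC (n := n) x₀) (chartAt (Cn n) x₀).target where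
  isOpen := (chartAt (Cn n) x₀).open_target
  isHermitianForm _ hy := isHermitianForm_gC hK hy
  contDiffOn v w := contDiffOn_gC x₀ v w
  closed := hK.closed x₀

end Metric

/-! ### Levi forms -/

section Levi

variable {n : ℕ}

/-- The Hessian of `φ`. -/
def hess {F : Type*} [NormedAddCommGroup F] [NormedSpace ℝ F] (φ : Cn n → F) (y v w : Cn n) : F :=
  fderiv ℝ (fderiv ℝ φ) y v w

/-- The Levi form of `φ`, the Laplacian of `φ` on the complex line spanned by `v`. -/
def lev {F : Type*} [NormedAddCommGroup F] [NormedSpace ℝ F] (φ : Cn n → F) (y v : Cn n) : F :=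
  hess φ y v v + hess φ y (Complex.I • v) (Complex.I • v)

section SecondDerivative
variable {F : Type*} [NormedAddCommGroup F] [NormedSpace ℝ F] {φ : Cn n → F} {y : Cn n}

theorem _root_.ContDiffAt.differentiableAt_fderiv (hφ : ContDiffAt ℝ 2 φ y) :
    DifferentiableAt ℝ (fderiv ℝ φ) y :=
  (hφ.fderiv_right (m := 1) (by norm_num)).differentiableAt (by simp)

theorem fderiv_fderiv_apply (hφ : ContDiffAt ℝ 2 φ y) (v w : Cn n) :
    fderiv ℝ (fun z => fderiv ℝ φ z w) y v = hess φ y v w := by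
  rw [fderiv_clm_apply hφ.differentiableAt_fderiv (by fun_prop)]
  simp [hess]

theorem hess_comm (hφ : ContDiffAt ℝ 2 φ y) (v w : Cn n) : hess φ y v w = hess φ y w v :=
  hφ.isSymmSndFDerivAt (by simp) v w

theorem hess_neg_left (v w : Cn n) : hess φ y (-v) w = -hess φ y v w := by
  simp [hess]

theorem hess_neg_right (v w : Cn n) : hess φ y v (-w) = -hess φ y v w := by
  simp [hess]

end SecondDerivative

theorem _root_.ContDiffAt.eventually_differentiableAt_complex {F : Type*} [NormedAddCommGroup F]
    [NormedSpace ℂ F] {φ : Cn n → F} {y : Cn n} (hφ : ContDiffAt ℂ ω φ y) :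
    ∀ᶠ z in 𝓝 y, DifferentiableAt ℂ φ z :=
  (hφ.eventually (by simp)).mono fun _ hz => hz.differentiableAt (by simp)

/-- Holomorphic functions are harmonic on complex lines. -/
theorem lev_eq_zero_of_holomorphic {F : Type*} [NormedAddCommGroup F] [NormedSpace ℂ F]
    {φ : Cn n → F} {y : Cn n} (hφ : ContDiffAt ℂ ω φ y) (v : Cn n) : lev φ y v = 0 := by
  have hR : ContDiffAt ℝ 2 φ y := hφ.restrict_scalars ℝ |>.of_le le_top
  have h1 : ∀ v w, hess φ y v (Complex.I • w) = Complex.I • hess φ y v w := by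
    intro v w
    rw [← fderiv_fderiv_apply hR, ← fderiv_fderiv_apply hR]
    have h2 : (fun z => fderiv ℝ φ z (Complex.I • w)) =ᶠ[𝓝 y]
        fun z => Complex.I • fderiv ℝ φ z w := by
      filter_upwards [hφ.eventually_differentiableAt_complex] with z hz
      exact hz.fderiv_real_smul _ _
    rw [h2.fderiv_eq, fderiv_fun_const_smul
      (hR.differentiableAt_fderiv.clm_apply (by fun_prop))]
    rfl
  rw [lev, h1, hess_comm hR (Complex.I • v) v, h1, smul_smul, Complex.I_mul_I, neg_one_smul,
    add_neg_cancel]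

/-- The Levi form is invariant under holomorphic changes of coordinates: the second derivative of
`τ` enters through its own Levi form, which vanishes. -/
theorem lev_comp {φ : Cn n → ℝ} {τ : Cn n → Cn n} {y : Cn n} (hτ : ContDiffAt ℂ ω τ y)
    (hφ : ContDiffAt ℝ 2 φ (τ y)) (v : Cn n) :
    lev (φ ∘ τ) y v = lev φ (τ y) (fderiv ℝ τ y v) := by
  have hτR : ContDiffAt ℝ 2 τ y := hτ.restrict_scalars ℝ |>.of_le le_top
  have hτd : DifferentiableAt ℝ τ y := hτR.differentiableAt (by simp)
  have key : ∀ w, hess (φ ∘ τ) y w w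
      = hess φ (τ y) (fderiv ℝ τ y w) (fderiv ℝ τ y w) + fderiv ℝ φ (τ y) (hess τ y w w) := by
    intro w
    rw [← fderiv_fderiv_apply (hφ.comp y hτR)]
    have h1 : (fun z => fderiv ℝ (φ ∘ τ) z w) =ᶠ[𝓝 y]
        fun z => fderiv ℝ φ (τ z) (fderiv ℝ τ z w) := by
      have e1 : ∀ᶠ z in 𝓝 y, DifferentiableAt ℝ τ z :=
        (hτR.eventually (by simp)).mono fun _ hz => hz.differentiableAt (by simp)
      have e2 : ∀ᶠ z in 𝓝 y, DifferentiableAt ℝ φ (τ z) :=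
        hτd.continuousAt.eventually ((hφ.eventually (by simp)).mono
          fun _ hz => hz.differentiableAt (by simp))
      filter_upwards [e1, e2] with z h1 h2
      rw [fderiv_comp z h2 h1]
      rfl
    have h2 : DifferentiableAt ℝ (fun z => fderiv ℝ φ (τ z)) y :=
      hφ.differentiableAt_fderiv.comp y hτd
    have h3 : DifferentiableAt ℝ (fun z => fderiv ℝ τ z w) y :=
      hτR.differentiableAt_fderiv.clm_apply (by fun_prop)
    rw [h1.fderiv_eq, fderiv_clm_apply h2 h3]
    have h4 : fderiv ℝ (fun z => fderiv ℝ φ (τ z)) y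
        = (fderiv ℝ (fderiv ℝ φ) (τ y)).comp (fderiv ℝ τ y) :=
      fderiv_comp y hφ.differentiableAt_fderiv hτd
    simp only [add_apply, ContinuousLinearMap.comp_apply, ContinuousLinearMap.flip_apply, h4]
    rw [fderiv_fderiv_apply hτR]
    rw [add_comm]
    rfl
  have h5 : fderiv ℝ τ y (Complex.I • v) = Complex.I • fderiv ℝ τ y v :=
    (hτ.differentiableAt (by simp)).fderiv_real_smul _ _
  have h6 := lev_eq_zero_of_holomorphic hτ v
  rw [lev] at h6
  rw [lev, key, key, h5, lev]
  have h7 : fderiv ℝ φ (τ y) (hess τ y v v)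
      + fderiv ℝ φ (τ y) (hess τ y (Complex.I • v) (Complex.I • v)) = 0 := by
    rw [← map_add, h6, map_zero]
  linear_combination h7

theorem hess_sub {φ ψ : Cn n → ℝ} {y : Cn n} (hφ : ContDiffAt ℝ 2 φ y) (hψ : ContDiffAt ℝ 2 ψ y)
    (v w : Cn n) : hess (fun z => φ z - ψ z) y v w = hess φ y v w - hess ψ y v w := by
  have h1 : fderiv ℝ (fun z => φ z - ψ z) =ᶠ[𝓝 y] fun z => fderiv ℝ φ z - fderiv ℝ ψ z := by
    filter_upwards [hφ.eventually (by simp), hψ.eventually (by simp)] with z h1 h2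
    exact fderiv_fun_sub (h1.differentiableAt (by simp)) (h2.differentiableAt (by simp))
  rw [hess, h1.fderiv_eq, fderiv_fun_sub hφ.differentiableAt_fderiv hψ.differentiableAt_fderiv]
  rfl

theorem hess_re {F : Cn n → ℂ} {y : Cn n} (hF : ContDiffAt ℝ 2 F y) (v w : Cn n) :
    hess (fun z => (F z).re) y v w = (hess F y v w).re := by
  have h1 : fderiv ℝ (fun z => (F z).re) =ᶠ[𝓝 y] fun z => Complex.reCLM.comp (fderiv ℝ F z) := by
    filter_upwards [hF.eventually (by simp)] with z h1
    exact (Complex.reCLM.hasFDerivAt.comp z (h1.differentiableAt (by simp)).hasFDerivAt).fderiv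
  have h2 := (((ContinuousLinearMap.compL ℝ (Cn n) ℂ ℝ) Complex.reCLM).hasFDerivAt.comp y
    hF.differentiableAt_fderiv.hasFDerivAt).fderiv
  rw [hess, h1.fderiv_eq]
  have h3 : fderiv ℝ (fun z => Complex.reCLM.comp (fderiv ℝ F z)) y = _ := h2
  rw [h3]
  rfl

end Levi

/-! ### Frames of the line bundle and the connection form -/

section LineBundle

variable {n : ℕ} {M : Type*} [TopologicalSpace M] [ChartedSpace (Cn n) M]
  {L : M → Type*} [∀ x, AddCommGroup (L x)] [∀ x, Module ℂ (L x)] [∀ x, TopologicalSpace (L x)]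
  [TopologicalSpace (TotalSpace ℂ L)] [FiberBundle ℂ L]

/-- The coordinate of the section `ψ` in the preferred frame and chart at `x₀`. -/
def loc (ψ : Π x, L x) (x₀ : M) (y : Cn n) : ℂ := coord ψ x₀ ((chartAt (Cn n) x₀).symm y)

variable (n L) in
/-- The set of points where the preferred chart and frame at `x₀` are defined. -/
def bset (x₀ : M) : Set M := (chartAt (Cn n) x₀).source ∩ (trivializationAt ℂ L x₀).baseSet

variable (n L) in
/-- The set of coordinates of the points of `bset n L x₀`. -/
def bdom (x₀ : M) : Set (Cn n) :=
  (chartAt (Cn n) x₀).target ∩ (chartAt (Cn n) x₀).symm ⁻¹' (trivializationAt ℂ L x₀).baseSet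

theorem isOpen_bdom (x₀ : M) : IsOpen (bdom n L x₀) :=
  (chartAt (Cn n) x₀).isOpen_inter_preimage_symm (trivializationAt ℂ L x₀).open_baseSet

theorem isOpen_bset (x₀ : M) : IsOpen (bset n L x₀) :=
  (chartAt (Cn n) x₀).open_source.inter (trivializationAt ℂ L x₀).open_baseSet

theorem mem_bset_self (x : M) : x ∈ bset n L x :=
  ⟨mem_chart_source _ _, mem_baseSet_trivializationAt _ _ _⟩

theorem chart_mem_bdom {x₀ x : M} (hx : x ∈ bset n L x₀) : chartAt (Cn n) x₀ x ∈ bdom n L x₀ :=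
  ⟨(chartAt (Cn n) x₀).map_source hx.1, by
    rw [mem_preimage, (chartAt (Cn n) x₀).left_inv hx.1]; exact hx.2⟩

theorem chart_symm_mem_bset {x₀ : M} {y : Cn n} (hy : y ∈ bdom n L x₀) :
    (chartAt (Cn n) x₀).symm y ∈ bset n L x₀ :=
  ⟨(chartAt (Cn n) x₀).map_target hy.1, hy.2⟩

theorem loc_chart (ψ : Π x, L x) {x₀ x : M} (hx : x ∈ (chartAt (Cn n) x₀).source) :
    loc ψ x₀ (chartAt (Cn n) x₀ x) = coord ψ x₀ x := by
  rw [loc, (chartAt (Cn n) x₀).left_inv hx]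

variable [VectorBundle ℂ ℂ L]

theorem coord_smul_frame (ψ : Π x, L x) {x₀ p : M} (hp : p ∈ (trivializationAt ℂ L x₀).baseSet) :
    coord ψ x₀ p • frame L x₀ p = ψ p := by
  rw [frame, ← Trivialization.symmₗ_apply (R := ℂ) _ hp, ← map_smul, smul_eq_mul, mul_one,
    Trivialization.symmₗ_apply _ hp]
  exact (trivializationAt ℂ L x₀).symm_apply_apply_mk hp (ψ p)

theorem coord_eq_linear (ψ : Π x, L x) {x p : M} (hp : p ∈ (trivializationAt ℂ L x).baseSet) :
    coord ψ x p = Trivialization.linearMapAt ℂ (trivializationAt ℂ L x) p (ψ p) := by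
  rw [Trivialization.linearMapAt_apply, if_pos hp]
  rfl

theorem coord_add (ψ φ : Π x, L x) {x p : M} (hp : p ∈ (trivializationAt ℂ L x).baseSet) :
    coord (ψ + φ) x p = coord ψ x p + coord φ x p := by
  simp only [coord_eq_linear _ hp, Pi.add_apply, map_add]

theorem coord_sub (ψ φ : Π x, L x) {x p : M} (hp : p ∈ (trivializationAt ℂ L x).baseSet) :
    coord (ψ - φ) x p = coord ψ x p - coord φ x p := by
  simp only [coord_eq_linear _ hp, Pi.sub_apply, map_sub]

theorem coord_smul (χ : M → ℂ) (ψ : Π x, L x) {x p : M}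
    (hp : p ∈ (trivializationAt ℂ L x).baseSet) :
    coord (fun q => χ q • ψ q) x p = χ p * coord ψ x p := by
  simp only [coord_eq_linear _ hp, map_smul, smul_eq_mul]

/-- Change of frame. -/
theorem coord_eq (ψ : Π x, L x) {x₀ x p : M} (hp₀ : p ∈ (trivializationAt ℂ L x₀).baseSet)
    (hp : p ∈ (trivializationAt ℂ L x).baseSet) :
    coord ψ x p = coord (frame L x₀) x p * coord ψ x₀ p := by
  rw [coord_eq_linear _ hp, coord_eq_linear _ hp]
  conv_lhs => rw [← coord_smul_frame ψ hp₀, map_smul, smul_eq_mul, mul_comm]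

theorem coord_frame_self {x p : M} (hp : p ∈ (trivializationAt ℂ L x).baseSet) :
    coord (frame L x) x p = 1 :=
  congrArg Prod.snd ((trivializationAt ℂ L x).apply_mk_symm hp 1)

theorem coord_frame_ne_zero {x₀ x p : M} (hp₀ : p ∈ (trivializationAt ℂ L x₀).baseSet)
    (hp : p ∈ (trivializationAt ℂ L x).baseSet) : coord (frame L x₀) x p ≠ 0 := by
  intro h
  have := coord_eq (frame L x) hp₀ hp
  rw [coord_frame_self hp, h, zero_mul] at this
  exact one_ne_zero this

theorem frame_ne_zero {x p : M} (hp : p ∈ (trivializationAt ℂ L x).baseSet) : frame L x p ≠ 0 := by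
  intro h
  have := coord_frame_self hp
  rw [coord_eq_linear _ hp, h, map_zero] at this
  exact zero_ne_one this

variable [IsManifold 𝓘(ℂ, Cn n) ω M] [ContMDiffVectorBundle ω ℂ L 𝓘(ℂ, Cn n)]

/-- The transition functions are holomorphic. -/
theorem contDiffAt_loc_frame {x₀ x : M} {y : Cn n} (hy : y ∈ bdom n L x)
    (hy' : (chartAt (Cn n) x).symm y ∈ (trivializationAt ℂ L x₀).baseSet) :
    ContDiffAt ℂ ω (loc (frame L x₀) x) y := by
  have h1 : ContMDiffAt 𝓘(ℂ, Cn n) 𝓘(ℂ, ℂ →L[ℂ] ℂ) ω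
      (fun b => (Trivialization.coordChangeL ℂ (trivializationAt ℂ L x₀) (trivializationAt ℂ L x) b
        : ℂ →L[ℂ] ℂ))
      ((chartAt (Cn n) x).symm y) :=
    contMDiffAt_coordChangeL hy' hy.2
  have h2 : ContMDiffAt 𝓘(ℂ, Cn n) 𝓘(ℂ, Cn n) ω (chartAt (Cn n) x).symm y :=
    (contMDiffOn_chart_symm (I := 𝓘(ℂ, Cn n)) (x := x)).contMDiffAt
      ((chartAt (Cn n) x).open_target.mem_nhds hy.1)
  have h3 := (h1.comp y h2).contDiffAt
  have h4 := h3.clm_apply (contDiffAt_const (c := (1 : ℂ)))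
  refine h4.congr_of_eventuallyEq ?_
  have hopen : IsOpen ((chartAt (Cn n) x).target ∩ (chartAt (Cn n) x).symm ⁻¹'
      (trivializationAt ℂ L x₀).baseSet) :=
    (chartAt (Cn n) x).isOpen_inter_preimage_symm (trivializationAt ℂ L x₀).open_baseSet
  filter_upwards [(isOpen_bdom x).mem_nhds hy, hopen.mem_nhds ⟨hy.1, hy'⟩] with z hz hz'
  exact ((trivializationAt ℂ L x₀).coordChangeL_apply (R := ℂ) (trivializationAt ℂ L x)
    ⟨hz'.2, hz.2⟩ 1).symm

section HermitianMetric

variable (h : HermitianMetric n L)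

theorem hSq_smul (c : ℂ) (p : M) (s : L p) :
    (h.toFun p (c • s) (c • s)).re = ‖c‖ ^ 2 * (h.toFun p s s).re := by
  rw [map_smul, map_smulₛₗ, LinearMap.smul_apply, smul_eq_mul, smul_eq_mul, ← mul_assoc,
    mul_comm c, ← Complex.normSq_eq_conj_mul_self, Complex.re_ofReal_mul, Complex.normSq_eq_norm_sq]

/-- The function `h(s, s)` of the preferred frame `s` at `x₀`, in the preferred chart. -/
def hFrame (x₀ : M) (y : Cn n) : ℝ := hSq h (frame L x₀) ((chartAt (Cn n) x₀).symm y)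

theorem hFrame_pos {x₀ : M} {y : Cn n} (hy : y ∈ bdom n L x₀) : 0 < hFrame h x₀ y :=
  h.pos _ _ (frame_ne_zero hy.2)

theorem contDiffOn_hFrame (x₀ : M) : ContDiffOn ℝ ∞ (hFrame h x₀) (bdom n L x₀) := by
  have h1 := (h.smooth x₀).comp ((contMDiffOn_chart_symm (I := 𝓘(ℝ, Cn n)) (n := ω)
    (x := x₀)).of_le le_top |>.mono inter_subset_left) inter_subset_right
  rw [contMDiffOn_iff_contDiffOn] at h1
  exact Complex.reCLM.contDiff.comp_contDiffOn h1

theorem contDiffOn_logH (x₀ : M) : ContDiffOn ℝ ∞ (logH h x₀) (bdom n L x₀) :=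
  (contDiffOn_hFrame h x₀).log fun _ hy => (hFrame_pos h hy).ne'

theorem contDiffAt_logH {x₀ : M} {y : Cn n} (hy : y ∈ bdom n L x₀) :
    ContDiffAt ℝ 2 (logH h x₀) y :=
  ((contDiffOn_logH h x₀).contDiffAt ((isOpen_bdom x₀).mem_nhds hy)).of_le ENat.LEInfty.out

theorem hSq_eq (ψ : Π x, L x) {x₀ p : M} (hp : p ∈ (trivializationAt ℂ L x₀).baseSet) :
    hSq h ψ p = ‖coord ψ x₀ p‖ ^ 2 * hSq h (frame L x₀) p := by
  rw [hSq, ← coord_smul_frame ψ hp, hSq_smul]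
  rfl

/-- A local holomorphic logarithm of the transition function, normalized to vanish at the centre. -/
def logTrans (L : M → Type*) [∀ x, AddCommGroup (L x)] [∀ x, TopologicalSpace (L x)]
    [TopologicalSpace (TotalSpace ℂ L)] [FiberBundle ℂ L] (x₀ x : M) (y : Cn n) : ℂ :=
  Complex.log (loc (frame L x₀) x y / loc (frame L x₀) x (chartAt (Cn n) x x))

variable {x₀ x : M}

theorem contDiffAt_logTrans (hx : x ∈ bset n L x₀) :
    ContDiffAt ℂ ω (logTrans L x₀ x) (chartAt (Cn n) x x) := by
  have hx' := chart_mem_bdom (mem_bset_self (L := L) (n := n) x)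
  have h1 : ContDiffAt ℂ ω (loc (frame L x₀) x) (chartAt (Cn n) x x) := by
    refine contDiffAt_loc_frame hx' ?_
    rw [(chartAt (Cn n) x).left_inv (mem_chart_source _ _)]
    exact hx.2
  have h0 : loc (frame L x₀) x (chartAt (Cn n) x x) ≠ 0 := by
    rw [loc_chart _ (mem_chart_source _ _)]
    exact coord_frame_ne_zero hx.2 (mem_baseSet_trivializationAt _ _ _)
  refine ContDiffAt.comp (g := Complex.log) _ (Complex.contDiffAt_log ?_) (h1.div_const _)
  rw [div_self h0]
  exact Complex.one_mem_slitPlane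

/-- `logTrans` has the logarithmic derivative of the transition function. -/
theorem fderiv_logTrans (hx : x ∈ bset n L x₀) (v : Cn n) :
    coord (frame L x₀) x x * fderiv ℝ (logTrans L x₀ x) (chartAt (Cn n) x x) v =
      fderiv ℝ (loc (frame L x₀) x) (chartAt (Cn n) x x) v := by
  have hx' := chart_mem_bdom (mem_bset_self (L := L) (n := n) x)
  have h1 : ContDiffAt ℂ ω (loc (frame L x₀) x) (chartAt (Cn n) x x) := by
    refine contDiffAt_loc_frame hx' ?_
    rw [(chartAt (Cn n) x).left_inv (mem_chart_source _ _)]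
    exact hx.2
  have h0 : loc (frame L x₀) x (chartAt (Cn n) x x) ≠ 0 := by
    rw [loc_chart _ (mem_chart_source _ _)]
    exact coord_frame_ne_zero hx.2 (mem_baseSet_trivializationAt _ _ _)
  have hd : HasFDerivAt (loc (frame L x₀) x) _ (chartAt (Cn n) x x) :=
    (h1.differentiableAt (by simp)).hasFDerivAt
  have h2 := ((hd.mul_const (loc (frame L x₀) x (chartAt (Cn n) x x))⁻¹).clog (by
    rw [mul_inv_cancel₀ h0]; exact Complex.one_mem_slitPlane)).restrictScalars ℝ
  have h3 : HasFDerivAt (logTrans L x₀ x) _ (chartAt (Cn n) x x) := h2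
  rw [h3.fderiv, (hd.restrictScalars ℝ).fderiv, mul_inv_cancel₀ h0, inv_one, one_smul,
    ← loc_chart (n := n) (frame L x₀) (mem_chart_source (Cn n) x)]
  simp only [ContinuousLinearMap.coe_restrictScalars', FunLike.coe_smul, Pi.smul_apply, smul_eq_mul]
  rw [← mul_assoc, mul_inv_cancel₀ h0, one_mul]

theorem eventually_mem_bset (hx : x ∈ bset n L x₀) :
    ∀ᶠ y in 𝓝 (chartAt (Cn n) x x), y ∈ bdom n L x ∧ y ∈ transDomain x x₀ ∧
      trans x x₀ y ∈ bdom n L x₀ ∧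
      (chartAt (Cn n) x).symm y ∈ (trivializationAt ℂ L x₀).baseSet := by
  have hx' := chart_mem_bdom (mem_bset_self (L := L) (n := n) x)
  have hopen : IsOpen ((chartAt (Cn n) x).target ∩ (chartAt (Cn n) x).symm ⁻¹'
      (trivializationAt ℂ L x₀).baseSet) :=
    (chartAt (Cn n) x).isOpen_inter_preimage_symm (trivializationAt ℂ L x₀).open_baseSet
  filter_upwards [(isOpen_bdom x).mem_nhds hx', (isOpen_transDomain x x₀).mem_nhds
    (chart_mem_transDomain (mem_chart_source _ _) hx.1), hopen.mem_nhds ⟨hx'.1, by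
      rw [mem_preimage, (chartAt (Cn n) x).left_inv (mem_chart_source _ _)]; exact hx.2⟩]
    with y h1 h2 h3
  refine ⟨h1, h2, ⟨(trans_mem h2).1, ?_⟩, h3.2⟩
  rw [mem_preimage, symm_trans h2]
  exact h3.2

/-- A change of frame adds the real part of a holomorphic function to the weight `log h(s, s)`. -/
theorem logH_eventuallyEq (hx : x ∈ bset n L x₀) :
    logH h x =ᶠ[𝓝 (chartAt (Cn n) x x)] fun y => (logH h x₀ ∘ trans x x₀) y
      - (2 * logTrans L x₀ x y + (2 * Real.log ‖coord (frame L x₀) x x‖ : ℝ)).re := by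
  filter_upwards [eventually_mem_bset hx] with y ⟨h1, h2, h3, h4⟩
  have hne := coord_frame_ne_zero h4 h1.2
  have hne0 := coord_frame_ne_zero hx.2 (mem_baseSet_trivializationAt ℂ L x)
  have hp := hFrame_pos h h1
  have e1 : logH h x₀ (trans x x₀ y) = Real.log
      (‖coord (frame L x₀) x ((chartAt (Cn n) x).symm y)‖ ^ 2
      * hFrame h x y) := by
    rw [logH, symm_trans h2, hSq_eq h (frame L x₀) h1.2]
    rfl
  rw [Function.comp, e1, Real.log_mul (by positivity) hp.ne', Real.log_pow]
  have e2 : (logTrans L x₀ x y).re = Real.log ‖coord (frame L x₀) x ((chartAt (Cn n) x).symm y)‖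
      - Real.log ‖coord (frame L x₀) x x‖ := by
    rw [logTrans, Complex.log_re, norm_div, Real.log_div, loc_chart _ (mem_chart_source _ _)]
    · rfl
    · exact norm_ne_zero_iff.2 hne
    · rw [loc_chart _ (mem_chart_source _ _)]
      exact norm_ne_zero_iff.2 hne0
  have e3 : logH h x y = Real.log (hFrame h x y) := rfl
  rw [e3]
  simp only [Complex.add_re, Complex.ofReal_re, Complex.mul_re, Complex.re_ofNat, Complex.im_ofNat,
    zero_mul, sub_zero, e2]
  push_cast
  ring

theorem contDiffAt_corr (hx : x ∈ bset n L x₀) : ContDiffAt ℂ ω (fun y => 2 * logTrans L x₀ x y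
      + ((2 * Real.log ‖coord (frame L x₀) x x‖ : ℝ) : ℂ)) (chartAt (Cn n) x x) :=
  (contDiffAt_const.mul (contDiffAt_logTrans hx)).add contDiffAt_const

theorem contDiffAt_transC (hx : x ∈ bset n L x₀) :
    ContDiffAt ℂ ω (trans (n := n) x x₀) (chartAt (Cn n) x x) :=
  (contDiffOn_trans_complex x x₀).contDiffAt ((isOpen_transDomain x x₀).mem_nhds
    (chart_mem_transDomain (mem_chart_source _ _) hx.1))

/-- The Levi form of the weight does not depend on the chart and the frame. -/
theorem lev_logH (hx : x ∈ bset n L x₀) (v : Cn n) :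
    lev (logH h x) (chartAt (Cn n) x x) v =
      lev (logH h x₀) (chartAt (Cn n) x₀ x) (fderiv ℝ (trans x x₀) (chartAt (Cn n) x x) v) := by
  have hτ := contDiffAt_transC hx
  have htr : trans x x₀ (chartAt (Cn n) x x) = chartAt (Cn n) x₀ x :=
    trans_chart (mem_chart_source _ _)
  have hφ : ContDiffAt ℝ 2 (logH h x₀) (trans x x₀ (chartAt (Cn n) x x)) := by
    rw [htr]; exact contDiffAt_logH h (chart_mem_bdom hx)
  have hF := contDiffAt_corr hx
  have hFR : ContDiffAt ℝ 2 _ (chartAt (Cn n) x x) := (hF.restrict_scalars ℝ).of_le le_top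
  have hre := Complex.reCLM.contDiff.contDiffAt.comp (chartAt (Cn n) x x) hFR
  have hcomp := hφ.comp (chartAt (Cn n) x x) ((hτ.restrict_scalars ℝ).of_le le_top)
  have h0 := lev_eq_zero_of_holomorphic hF v
  have e : ∀ w, hess (logH h x) (chartAt (Cn n) x x) w w
      = hess (logH h x₀ ∘ trans x x₀) (chartAt (Cn n) x x) w w
        - (hess (fun y => 2 * logTrans L x₀ x y
      + ((2 * Real.log ‖coord (frame L x₀) x x‖ : ℝ) : ℂ)) (chartAt (Cn n) x x) w w).re := by
    intro w
    have h1 := hess_sub hcomp hre w w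
    rw [← hess_re hFR, hess, (logH_eventuallyEq h hx).fderiv.fderiv_eq]
    exact h1
  rw [lev] at h0
  have h0' := congrArg Complex.re h0
  rw [Complex.add_re, Complex.zero_re] at h0'
  rw [← htr, ← lev_comp hτ hφ, lev, lev, e, e]
  linarith

/-- The connection form changes by the logarithmic derivative of the transition function. -/
theorem connForm_eq (hx : x ∈ bset n L x₀) (v : Cn n) :
    connForm h x (chartAt (Cn n) x x) v =
      connForm h x₀ (chartAt (Cn n) x₀ x) (fderiv ℝ (trans x x₀) (chartAt (Cn n) x x) v)
        - fderiv ℝ (logTrans L x₀ x) (chartAt (Cn n) x x) v := by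
  have hτ := contDiffAt_transC hx
  have hτd : DifferentiableAt ℝ (trans (n := n) x x₀) (chartAt (Cn n) x x) :=
    (hτ.restrict_scalars ℝ).differentiableAt (by simp)
  have htr : trans x x₀ (chartAt (Cn n) x x) = chartAt (Cn n) x₀ x :=
    trans_chart (mem_chart_source _ _)
  have hφ : DifferentiableAt ℝ (logH h x₀) (trans x x₀ (chartAt (Cn n) x x)) := by
    rw [htr]; exact (contDiffAt_logH h (chart_mem_bdom hx)).differentiableAt (by simp)
  have hF := contDiffAt_logTrans hx
  have hFd : DifferentiableAt ℂ (logTrans L x₀ x) (chartAt (Cn n) x x) :=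
    hF.differentiableAt (by simp)
  have hFdR : DifferentiableAt ℝ (logTrans L x₀ x) (chartAt (Cn n) x x) := hFd.restrictScalars ℝ
  have hd : ∀ w, fderiv ℝ (logH h x) (chartAt (Cn n) x x) w
      = fderiv ℝ (logH h x₀) (chartAt (Cn n) x₀ x) (fderiv ℝ (trans x x₀) (chartAt (Cn n) x x) w)
        - 2 * (fderiv ℝ (logTrans L x₀ x) (chartAt (Cn n) x x) w).re := by
    intro w
    rw [(logH_eventuallyEq h hx).fderiv_eq]
    have h1 := (hφ.hasFDerivAt.comp (chartAt (Cn n) x x) hτd.hasFDerivAt).sub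
      (Complex.reCLM.hasFDerivAt.comp (chartAt (Cn n) x x)
        ((hFdR.hasFDerivAt.const_mul 2).add_const
          ((2 * Real.log ‖coord (frame L x₀) x x‖ : ℝ) : ℂ)))
    have h2 : HasFDerivAt (fun y => (logH h x₀ ∘ trans x x₀) y
      - (2 * logTrans L x₀ x y + (2 * Real.log ‖coord (frame L x₀) x x‖ : ℝ)).re) _ _ := h1
    rw [h2.fderiv, htr]
    simp
  have hlin : fderiv ℝ (logTrans L x₀ x) (chartAt (Cn n) x x) (Complex.I • v)
      = Complex.I * fderiv ℝ (logTrans L x₀ x) (chartAt (Cn n) x x) v := hFd.fderiv_real_smul _ _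
  have hτlin : fderiv ℝ (trans (n := n) x x₀) (chartAt (Cn n) x x) (Complex.I • v)
      = Complex.I • fderiv ℝ (trans x x₀) (chartAt (Cn n) x x) v :=
    (hτ.differentiableAt (by simp)).fderiv_real_smul _ _
  rw [connForm, connForm, hd, hd, hlin, hτlin]
  apply Complex.ext
  · simp
    ring
  · simp
    ring

/-- The covariant derivative in the preferred frame and chart at `x₀`. -/
def locNabla (ψ : Π x, L x) (x₀ : M) (y v : Cn n) : ℂ :=
  fderiv ℝ (loc ψ x₀) y v + connForm h x₀ y v * loc ψ x₀ y

/-- The covariant derivative does not depend on the chart and the frame. -/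
theorem nabla_eq (ψ : Π x, L x) (hx : x ∈ bset n L x₀)
    (hψ : DifferentiableAt ℝ (loc ψ x₀) (chartAt (Cn n) x₀ x)) (v : Cn n) :
    nabla h ψ x v = locNabla h ψ x₀ (chartAt (Cn n) x₀ x)
      (fderiv ℝ (trans x x₀) (chartAt (Cn n) x x) v) • frame L x₀ x := by
  have hτ := contDiffAt_transC hx
  have hτd : DifferentiableAt ℝ (trans (n := n) x x₀) (chartAt (Cn n) x x) :=
    (hτ.restrict_scalars ℝ).differentiableAt (by simp)
  have htr : trans x x₀ (chartAt (Cn n) x x) = chartAt (Cn n) x₀ x :=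
    trans_chart (mem_chart_source _ _)
  have hxx := chart_mem_bdom (mem_bset_self (L := L) (n := n) x)
  have hG : DifferentiableAt ℝ (loc (frame L x₀) x) (chartAt (Cn n) x x) := by
    refine ((contDiffAt_loc_frame hxx ?_).differentiableAt (by simp)).restrictScalars ℝ
    rw [(chartAt (Cn n) x).left_inv (mem_chart_source _ _)]
    exact hx.2
  have heq : (fun y => coord ψ x ((chartAt (Cn n) x).symm y)) =ᶠ[𝓝 (chartAt (Cn n) x x)]
      fun y => loc (frame L x₀) x y * loc ψ x₀ (trans x x₀ y) := by
    filter_upwards [eventually_mem_bset hx] with y ⟨h1, h2, h3, h4⟩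
    rw [coord_eq ψ h4 h1.2, loc, loc, symm_trans h2]
  rw [← htr] at hψ
  have hder := (hG.hasFDerivAt.mul (hψ.hasFDerivAt.comp (chartAt (Cn n) x x) hτd.hasFDerivAt))
  have hder' : HasFDerivAt (fun y => loc (frame L x₀) x y * loc ψ x₀ (trans x x₀ y)) _
    (chartAt (Cn n) x x) := hder
  have hfr : coord (frame L x₀) x x • frame L x x = frame L x₀ x :=
    coord_smul_frame _ (mem_baseSet_trivializationAt _ _ _)
  have key : fderiv ℝ (fun y => coord ψ x ((chartAt (Cn n) x).symm y)) (chartAt (Cn n) x x) v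
      + connForm h x (chartAt (Cn n) x x) v * coord ψ x x
      = locNabla h ψ x₀ (chartAt (Cn n) x₀ x) (fderiv ℝ (trans x x₀) (chartAt (Cn n) x x) v)
        * coord (frame L x₀) x x := by
    rw [heq.fderiv_eq, hder'.fderiv, connForm_eq h hx,
      coord_eq ψ hx.2 (mem_baseSet_trivializationAt ℂ L x)]
    simp only [Function.comp, htr, add_apply, FunLike.coe_smul, Pi.smul_apply, smul_eq_mul,
      ContinuousLinearMap.comp_apply, locNabla, loc_chart (n := n) _ (mem_chart_source (Cn n) x),
      loc_chart (n := n) _ hx.1, ← fderiv_logTrans hx]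
    ring
  have : nabla h ψ x v = (fderiv ℝ (fun y => coord ψ x ((chartAt (Cn n) x).symm y))
    (chartAt (Cn n) x x) v + connForm h x (chartAt (Cn n) x x) v * coord ψ x x) • frame L x x := rfl
  rw [this, key, mul_smul, hfr]

end HermitianMetric

end LineBundle

/-! ### Smooth and holomorphic sections -/

section SectionRegularity

variable {n : ℕ} {M : Type*} [TopologicalSpace M] [ChartedSpace (Cn n) M]
  {L : M → Type*} [∀ x, AddCommGroup (L x)] [∀ x, Module ℂ (L x)] [∀ x, TopologicalSpace (L x)]
  [TopologicalSpace (TotalSpace ℂ L)] [FiberBundle ℂ L] [VectorBundle ℂ ℂ L]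
  [IsManifold 𝓘(ℂ, Cn n) ω M] [ContMDiffVectorBundle ω ℂ L 𝓘(ℂ, Cn n)]

variable (n) in
/-- A smooth section. -/
def IsSmoothSection (ψ : Π x, L x) : Prop :=
  ContMDiff 𝓘(ℝ, Cn n) (𝓘(ℝ, Cn n).prod 𝓘(ℝ, ℂ)) ∞ (fun x => TotalSpace.mk' ℂ x (ψ x))

/-- A section in the frame at `x₀` is the transition function times the section in the frame at a
neighbouring point, where smoothness and holomorphy are formulated. -/
theorem loc_eventuallyEq (ψ : Π x, L x) {x₀ : M} {y : Cn n} (hy : y ∈ bdom n L x₀) :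
    loc ψ x₀ =ᶠ[𝓝 y] fun z => loc (frame L ((chartAt (Cn n) x₀).symm y)) x₀ z *
      coord ψ ((chartAt (Cn n) x₀).symm y) ((chartAt (Cn n) x₀).symm z) := by
  have hopen : IsOpen ((chartAt (Cn n) x₀).target ∩ (chartAt (Cn n) x₀).symm ⁻¹'
      (trivializationAt ℂ L ((chartAt (Cn n) x₀).symm y)).baseSet) :=
    (chartAt (Cn n) x₀).isOpen_inter_preimage_symm
      (trivializationAt ℂ L ((chartAt (Cn n) x₀).symm y)).open_baseSet
  filter_upwards [(isOpen_bdom x₀).mem_nhds hy, hopen.mem_nhds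
    ⟨hy.1, mem_baseSet_trivializationAt _ _ _⟩] with z hz hz'
  exact coord_eq ψ hz'.2 hz.2

theorem IsSmoothSection.contDiffOn_loc {ψ : Π x, L x} (hψ : IsSmoothSection n ψ) (x₀ : M) :
    ContDiffOn ℝ ∞ (loc ψ x₀) (bdom n L x₀) := by
  intro y hy
  refine ContDiffAt.contDiffWithinAt ?_
  refine ContDiffAt.congr_of_eventuallyEq ?_ (loc_eventuallyEq ψ hy)
  have h1 := (contMDiffAt_section _).1 (hψ ((chartAt (Cn n) x₀).symm y))
  have h2 : ContMDiffAt 𝓘(ℝ, Cn n) 𝓘(ℝ, Cn n) ∞ (chartAt (Cn n) x₀).symm y :=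
    ((contMDiffOn_chart_symm (I := 𝓘(ℝ, Cn n)) (n := ω) (x := x₀)).contMDiffAt
      ((chartAt (Cn n) x₀).open_target.mem_nhds hy.1)).of_le le_top
  have h3 := (h1.comp y h2).contDiffAt
  have h4 : ContDiffAt ℂ ω (loc (frame L ((chartAt (Cn n) x₀).symm y)) x₀) y :=
    contDiffAt_loc_frame hy (mem_baseSet_trivializationAt _ _ _)
  exact ((h4.restrict_scalars ℝ).of_le le_top).mul h3

theorem IsSmoothSection.contDiffAt_loc {ψ : Π x, L x} (hψ : IsSmoothSection n ψ) {x₀ : M} {y : Cn n}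
    (hy : y ∈ bdom n L x₀) : ContDiffAt ℝ ∞ (loc ψ x₀) y :=
  (hψ.contDiffOn_loc x₀).contDiffAt ((isOpen_bdom x₀).mem_nhds hy)

theorem coord_eventuallyEq_loc (ψ : Π x, L x) (x : M) :
    (fun p => (trivializationAt ℂ L x ⟨p, ψ p⟩).2) =ᶠ[𝓝 x] loc ψ x ∘ chartAt (Cn n) x := by
  filter_upwards [(chartAt (Cn n) x).open_source.mem_nhds (mem_chart_source _ _)] with p hp
  exact (loc_chart ψ hp).symm

theorem isSmoothSection_of_loc {ψ : Π x, L x}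
    (h : ∀ x, ContDiffAt ℝ ∞ (loc ψ x) (chartAt (Cn n) x x)) : IsSmoothSection n ψ := by
  intro x
  refine (contMDiffAt_section x).2 ?_
  refine ContMDiffAt.congr_of_eventuallyEq ?_ (coord_eventuallyEq_loc (n := n) ψ x)
  have h2 : ContMDiffAt 𝓘(ℝ, Cn n) 𝓘(ℝ, Cn n) ∞ (chartAt (Cn n) x) x :=
    ((contMDiffOn_chart (I := 𝓘(ℝ, Cn n)) (n := ω) (x := x)).contMDiffAt
      ((chartAt (Cn n) x).open_source.mem_nhds (mem_chart_source _ _))).of_le le_top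
  exact (h x).contMDiffAt.comp x h2

theorem IsHolomorphicSection.differentiableOn_loc {ψ : Π x, L x} (hψ : IsHolomorphicSection n ψ)
    (x₀ : M) : DifferentiableOn ℂ (loc ψ x₀) (bdom n L x₀) := by
  intro y hy
  refine DifferentiableAt.differentiableWithinAt ?_
  refine DifferentiableAt.congr_of_eventuallyEq ?_ (loc_eventuallyEq ψ hy)
  have h1 := ((mdifferentiableAt_totalSpace _ _).1 (hψ ((chartAt (Cn n) x₀).symm y))).2
  have h2 : MDifferentiableAt 𝓘(ℂ, Cn n) 𝓘(ℂ, Cn n) (chartAt (Cn n) x₀).symm y :=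
    ((contMDiffOn_chart_symm (I := 𝓘(ℂ, Cn n)) (n := ω) (x := x₀)).contMDiffAt
      ((chartAt (Cn n) x₀).open_target.mem_nhds hy.1)).mdifferentiableAt (by simp)
  have h3 := (h1.comp y h2).differentiableAt
  have h4 : ContDiffAt ℂ ω (loc (frame L ((chartAt (Cn n) x₀).symm y)) x₀) y :=
    contDiffAt_loc_frame hy (mem_baseSet_trivializationAt _ _ _)
  exact (h4.differentiableAt (by simp)).mul h3

theorem isHolomorphicSection_of_loc {ψ : Π x, L x}
    (h : ∀ x, DifferentiableAt ℂ (loc ψ x) (chartAt (Cn n) x x)) : IsHolomorphicSection n ψ := by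
  intro x
  refine (mdifferentiableAt_totalSpace _ _).2 ⟨mdifferentiableAt_id, ?_⟩
  refine MDifferentiableAt.congr_of_eventuallyEq ?_ (coord_eventuallyEq_loc (n := n) ψ x)
  have h2 : MDifferentiableAt 𝓘(ℂ, Cn n) 𝓘(ℂ, Cn n) (chartAt (Cn n) x) x :=
    ((contMDiffOn_chart (I := 𝓘(ℂ, Cn n)) (n := ω) (x := x)).contMDiffAt
      ((chartAt (Cn n) x).open_source.mem_nhds (mem_chart_source _ _))).mdifferentiableAt (by simp)
  exact (h x).mdifferentiableAt.comp x h2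

/-- Holomorphic functions of several variables are smooth. -/
theorem IsHolomorphicSection.isSmoothSection {ψ : Π x, L x} (hψ : IsHolomorphicSection n ψ) :
    IsSmoothSection n ψ :=
  isSmoothSection_of_loc fun x =>
    ((hψ.differentiableOn_loc x).lineHolomorphicOn.contDiffOn (isOpen_bdom x)).contDiffAt
      ((isOpen_bdom x).mem_nhds (chart_mem_bdom (mem_bset_self x)))

end SectionRegularity

/-! ### The pointwise Weitzenböck identity -/

section Pointwise

variable {n : ℕ} {M : Type*} [TopologicalSpace M] [ChartedSpace (Cn n) M]
  {L : M → Type*} [∀ x, AddCommGroup (L x)] [∀ x, Module ℂ (L x)] [∀ x, TopologicalSpace (L x)]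
  [TopologicalSpace (TotalSpace ℂ L)] [FiberBundle ℂ L] [VectorBundle ℂ ℂ L]
  [IsManifold 𝓘(ℂ, Cn n) ω M] [ContMDiffVectorBundle ω ℂ L 𝓘(ℂ, Cn n)]
  [RiemannianBundle (fun x : M => TangentSpace 𝓘(ℝ, Cn n) x)]
  (h : HermitianMetric n L)

/-- The covariant derivative, with tangent vectors viewed as vectors of `ℂⁿ`. -/
def nab (ψ : Π x, L x) (x : M) (v : Cn n) : L x := nabla h ψ x v

/-- The real part of the coordinate of a section. -/
def locRe (ψ : Π x, L x) (x₀ : M) (y : Cn n) : ℝ := (loc ψ x₀ y).re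

/-- The imaginary part of the coordinate of a section. -/
def locIm (ψ : Π x, L x) (x₀ : M) (y : Cn n) : ℝ := (loc ψ x₀ y).im

theorem traceTM_eq_sum (ψ : Π x, L x) (x : M) :
    traceTM h ψ x = ∑ k, ((h.toFun x (nab h ψ x (uFrame x k)) (nab h ψ x (uFrame x k))).re
    + (h.toFun x (nab h ψ x (Complex.I • uFrame x k)) (nab h ψ x (Complex.I • uFrame x k))).re) :=
      rfl

theorem connForm_add (x₀ : M) (y v w : Cn n) :
    connForm h x₀ y (v + w) = connForm h x₀ y v + connForm h x₀ y w := by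
  simp only [connForm, smul_add, map_add, Complex.ofReal_add]
  ring

theorem connForm_smul (x₀ : M) (y : Cn n) (c : ℝ) (v : Cn n) :
    connForm h x₀ y (c • v) = c * connForm h x₀ y v := by
  simp only [connForm, smul_comm Complex.I c, map_smul, smul_eq_mul, Complex.ofReal_mul]
  ring

theorem locNabla_add (ψ : Π x, L x) (x₀ : M) (y v w : Cn n) :
    locNabla h ψ x₀ y (v + w) = locNabla h ψ x₀ y v + locNabla h ψ x₀ y w := by
  simp only [locNabla, map_add, connForm_add]
  ring

theorem locNabla_smul (ψ : Π x, L x) (x₀ : M) (y : Cn n) (c : ℝ) (v : Cn n) :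
    locNabla h ψ x₀ y (c • v) = c * locNabla h ψ x₀ y v := by
  simp only [locNabla, map_smul, connForm_smul, Complex.real_smul]
  ring

theorem nab_smul (ψ : Π x, L x) (x : M) (c : ℝ) (v : Cn n) :
    nab h ψ x (c • v) = (c : ℂ) • nab h ψ x v := by
  have h1 : ∀ w : Cn n, nab h ψ x w = (fderiv ℝ (loc ψ x) (chartAt (Cn n) x x) w
      + connForm h x (chartAt (Cn n) x x) w * coord ψ x x) • frame L x x := fun w => rfl
  rw [h1, h1, smul_smul, map_smul, connForm_smul, Complex.real_smul]
  congr 1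
  ring

theorem trace01_eq_sum (ψ : Π x, L x) (x : M) :
    trace01 h ψ x = ∑ k, 2⁻¹ * (h.toFun x
      (nab h ψ x (uFrame x k) + Complex.I • nab h ψ x (Complex.I • uFrame x k))
      (nab h ψ x (uFrame x k) + Complex.I • nab h ψ x (Complex.I • uFrame x k))).re := by
  refine Finset.sum_congr rfl fun k _ => ?_
  have h1 : nablaC h ψ x (Zbar (unitaryFrame x k)) = (((√2)⁻¹ : ℝ) : ℂ) •
      (nab h ψ x (uFrame x k) + Complex.I • nab h ψ x (Complex.I • uFrame x k)) := by
    rw [smul_add, smul_comm _ Complex.I, ← nab_smul, ← nab_smul]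
    rfl
  rw [h1, hSq_smul]
  congr 1
  rw [Complex.norm_real, Real.norm_eq_abs, sq_abs, inv_pow, Real.sq_sqrt (by norm_num)]

variable {x₀ x : M}

/-- The unitary frame at `x` in the coordinates of the chart at `x₀`. -/
def frameAt (x₀ x : M) (k : Fin n) : Cn n :=
  fderiv ℝ (trans x x₀) (chartAt (Cn n) x x) (uFrame x k)

theorem nab_eq (ψ : Π x, L x) (hx : x ∈ bset n L x₀)
    (hψ : DifferentiableAt ℝ (loc ψ x₀) (chartAt (Cn n) x₀ x)) (k : Fin n) :
    nab h ψ x (uFrame x k) = locNabla h ψ x₀ (chartAt (Cn n) x₀ x) (frameAt x₀ x k) •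
      frame L x₀ x :=
  nabla_eq h ψ hx hψ _

theorem nab_I_eq (ψ : Π x, L x) (hx : x ∈ bset n L x₀)
    (hψ : DifferentiableAt ℝ (loc ψ x₀) (chartAt (Cn n) x₀ x)) (k : Fin n) :
    nab h ψ x (Complex.I • uFrame x k) =
      locNabla h ψ x₀ (chartAt (Cn n) x₀ x) (Complex.I • frameAt x₀ x k) • frame L x₀ x := by
  rw [frameAt, ← fderiv_trans_smul (chart_mem_transDomain (mem_chart_source _ _) hx.1)]
  exact nabla_eq h ψ hx hψ _

theorem hFrame_chart (hx : x ∈ bset n L x₀) :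
    hFrame h x₀ (chartAt (Cn n) x₀ x) = (h.toFun x (frame L x₀ x) (frame L x₀ x)).re := by
  rw [hFrame, (chartAt (Cn n) x₀).left_inv hx.1]
  rfl

theorem traceTM_eq (ψ : Π x, L x) (hx : x ∈ bset n L x₀)
    (hψ : DifferentiableAt ℝ (loc ψ x₀) (chartAt (Cn n) x₀ x)) :
    traceTM h ψ x = ∑ k, (‖locNabla h ψ x₀ (chartAt (Cn n) x₀ x) (frameAt x₀ x k)‖ ^ 2
      + ‖locNabla h ψ x₀ (chartAt (Cn n) x₀ x) (Complex.I • frameAt x₀ x k)‖ ^ 2)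
      * hFrame h x₀ (chartAt (Cn n) x₀ x) := by
  rw [traceTM_eq_sum]
  refine Finset.sum_congr rfl fun k _ => ?_
  rw [nab_eq h ψ hx hψ, nab_I_eq h ψ hx hψ, hSq_smul, hSq_smul, hFrame_chart h hx, add_mul]

theorem trace01_eq (ψ : Π x, L x) (hx : x ∈ bset n L x₀)
    (hψ : DifferentiableAt ℝ (loc ψ x₀) (chartAt (Cn n) x₀ x)) :
    trace01 h ψ x = ∑ k, 2⁻¹ * ‖locNabla h ψ x₀ (chartAt (Cn n) x₀ x) (frameAt x₀ x k)
      + Complex.I * locNabla h ψ x₀ (chartAt (Cn n) x₀ x) (Complex.I • frameAt x₀ x k)‖ ^ 2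
      * hFrame h x₀ (chartAt (Cn n) x₀ x) := by
  rw [trace01_eq_sum]
  refine Finset.sum_congr rfl fun k _ => ?_
  rw [nab_eq h ψ hx hψ, nab_I_eq h ψ hx hψ, smul_smul, ← add_smul, hSq_smul, hFrame_chart h hx,
    mul_assoc]

theorem hSq_eq_loc (ψ : Π x, L x) (hx : x ∈ bset n L x₀) :
    hSq h ψ x = ‖loc ψ x₀ (chartAt (Cn n) x₀ x)‖ ^ 2 * hFrame h x₀ (chartAt (Cn n) x₀ x) := by
  rw [hSq_eq h ψ hx.2, loc_chart _ hx.1, hFrame_chart h hx]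
  rfl

/-- The curvature in terms of the Hessian of the weight. -/
theorem curvature_eq (x : M) (v w : Cn n) :
    curvature h x v w = -(Complex.I / 2) *
      ((hess (logH h x) (chartAt (Cn n) x x) v (Complex.I • w)
        - hess (logH h x) (chartAt (Cn n) x x) w (Complex.I • v) : ℝ) : ℂ) := by
  have hφ := contDiffAt_logH h (chart_mem_bdom (mem_bset_self (L := L) (n := n) x))
  have key : ∀ v w : Cn n, fderiv ℝ (fun y => connForm h x y w) (chartAt (Cn n) x x) v
      = (((hess (logH h x) (chartAt (Cn n) x x) v w : ℝ) : ℂ)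
        - Complex.I * ((hess (logH h x) (chartAt (Cn n) x x) v (Complex.I • w) : ℝ) : ℂ)) / 2 := by
    intro v w
    have h1 : ∀ u : Cn n, HasFDerivAt (fun y => ((fderiv ℝ (logH h x) y u : ℝ) : ℂ))
        (Complex.ofRealCLM.comp (fderiv ℝ (fun y => fderiv ℝ (logH h x) y u) (chartAt (Cn n) x x)))
        (chartAt (Cn n) x x) := fun u =>
      Complex.ofRealCLM.hasFDerivAt.comp _ (hφ.differentiableAt_fderiv.clm_apply
        (differentiableAt_const u)).hasFDerivAt
    have h2 := ((h1 w).sub ((h1 (Complex.I • w)).const_mul Complex.I)).mul_const (2 : ℂ)⁻¹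
    have h3 : HasFDerivAt (fun y => connForm h x y w) _ (chartAt (Cn n) x x) := h2
    rw [h3.fderiv, ← fderiv_fderiv_apply hφ, ← fderiv_fderiv_apply hφ]
    simp
    ring
  have h4 : curvature h x v w = fderiv ℝ (fun y => connForm h x y w) (chartAt (Cn n) x x) v
    - fderiv ℝ (fun y => connForm h x y v) (chartAt (Cn n) x x) w := rfl
  rw [h4, key, key, hess_comm hφ w v]
  push_cast
  ring

/-- `ρ` is half the trace of the Levi forms of the weight in the preferred frame at `x`. -/
theorem rho_eq_self (x : M) :
    rho h x = ∑ k, 2⁻¹ * lev (logH h x) (chartAt (Cn n) x x) (uFrame x k) := by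
  rw [rho, Complex.re_sum]
  refine Finset.sum_congr rfl fun k _ => ?_
  set s : ℝ := (√2)⁻¹ with hs
  have hs2 : s * s = 2⁻¹ := by
    rw [hs, ← mul_inv, Real.mul_self_sqrt (by norm_num)]
  set e : Cn n := uFrame x k with he
  have h1 : curvatureC h x (Zbar (unitaryFrame x k)) (Z (unitaryFrame x k))
      = curvature h x (s • e : Cn n) (s • e : Cn n)
        - curvature h x (s • (Complex.I • e) : Cn n) (-(s • (Complex.I • e)) : Cn n)
        + Complex.I * (curvature h x (s • e : Cn n) (-(s • (Complex.I • e)) : Cn n)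
        + curvature h x (s • (Complex.I • e) : Cn n) (s • e : Cn n)) := rfl
  have hII : ∀ v : Cn n, Complex.I • Complex.I • v = -v := fun v => by
    rw [smul_smul, Complex.I_mul_I, neg_one_smul]
  have hs3 : ∀ v w : Cn n, hess (logH h x) (chartAt (Cn n) x x) (s • v) (s • w)
      = 2⁻¹ * hess (logH h x) (chartAt (Cn n) x x) v w := fun v w => by
    simp only [hess, map_smul, smul_apply, smul_eq_mul]
    rw [← mul_assoc, hs2]
  rw [h1]
  simp only [curvature_eq, smul_neg, smul_comm Complex.I s, hII, hess_neg_left, hess_neg_right,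
    hs3, lev]
  push_cast
  simp
  ring

/-- The formula for `ρ` in any frame, which shows that `ρ` is continuous. -/
theorem rho_eq (hx : x ∈ bset n L x₀) :
    rho h x = ∑ k, 2⁻¹ * lev (logH h x₀) (chartAt (Cn n) x₀ x) (frameAt x₀ x k) := by
  rw [rho_eq_self]
  refine Finset.sum_congr rfl fun k _ => ?_
  rw [lev_logH h hx]
  rfl

/-- The one-form `Im h(ψ, ∇ψ)` in the chart and frame at `x₀`. -/
def locGamma (ψ : Π x, L x) (x₀ : M) (y v : Cn n) : ℝ :=
  hFrame h x₀ y * (locRe ψ x₀ y * fderiv ℝ (locIm ψ x₀) y v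
      - locIm ψ x₀ y * fderiv ℝ (locRe ψ x₀) y v)
    - 2⁻¹ * (hFrame h x₀ y * (locRe ψ x₀ y ^ 2 + locIm ψ x₀ y ^ 2)
      * fderiv ℝ (logH h x₀) y (Complex.I • v))

theorem fderiv_hFrame {y : Cn n} (hy : y ∈ bdom n L x₀) (v : Cn n) :
    fderiv ℝ (hFrame h x₀) y v = hFrame h x₀ y * fderiv ℝ (logH h x₀) y v := by
  have h1 : hFrame h x₀ =ᶠ[𝓝 y] fun z => Real.exp (logH h x₀ z) := by
    filter_upwards [(isOpen_bdom x₀).mem_nhds hy] with z hz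
    exact (Real.exp_log (hFrame_pos h hz)).symm
  rw [h1.fderiv_eq, fderiv_exp ((contDiffAt_logH h hy).differentiableAt (by simp))]
  have h2 : Real.exp (logH h x₀ y) = hFrame h x₀ y := Real.exp_log (hFrame_pos h hy)
  simp [h2]

theorem fderiv_locGamma {ψ : Π x, L x} {y : Cn n} (hy : y ∈ bdom n L x₀)
    (hψ : ContDiffAt ℝ 2 (loc ψ x₀) y) (v w : Cn n) :
    fderiv ℝ (fun z => locGamma h ψ x₀ z w) y v =
      hFrame h x₀ y * fderiv ℝ (logH h x₀) y v * (locRe ψ x₀ y * fderiv ℝ (locIm ψ x₀) y w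
          - locIm ψ x₀ y * fderiv ℝ (locRe ψ x₀) y w)
      + hFrame h x₀ y * (fderiv ℝ (locRe ψ x₀) y v * fderiv ℝ (locIm ψ x₀) y w
          + locRe ψ x₀ y * hess (locIm ψ x₀) y v w
          - fderiv ℝ (locIm ψ x₀) y v * fderiv ℝ (locRe ψ x₀) y w
          - locIm ψ x₀ y * hess (locRe ψ x₀) y v w)
      - 2⁻¹ * (hFrame h x₀ y * fderiv ℝ (logH h x₀) y v * (locRe ψ x₀ y ^ 2 + locIm ψ x₀ y ^ 2)
            * fderiv ℝ (logH h x₀) y (Complex.I • w)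
          + hFrame h x₀ y * (2 * locRe ψ x₀ y * fderiv ℝ (locRe ψ x₀) y v
            + 2 * locIm ψ x₀ y * fderiv ℝ (locIm ψ x₀) y v) * fderiv ℝ (logH h x₀) y (Complex.I • w)
          + hFrame h x₀ y * (locRe ψ x₀ y ^ 2 + locIm ψ x₀ y ^ 2)
            * hess (logH h x₀) y v (Complex.I • w)) := by
  have hre : ContDiffAt ℝ 2 (locRe ψ x₀) y := Complex.reCLM.contDiff.contDiffAt.comp y hψ
  have him : ContDiffAt ℝ 2 (locIm ψ x₀) y := Complex.imCLM.contDiff.contDiffAt.comp y hψ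
  have hφ := contDiffAt_logH h hy
  have hH : HasFDerivAt (hFrame h x₀) (fderiv ℝ (hFrame h x₀) y) y :=
    (((contDiffOn_hFrame h x₀).contDiffAt ((isOpen_bdom x₀).mem_nhds hy)).differentiableAt
      (by simp)).hasFDerivAt
  have ha := (hre.differentiableAt (by simp)).hasFDerivAt
  have hb := (him.differentiableAt (by simp)).hasFDerivAt
  have hc : ∀ {φ : Cn n → ℝ}, ContDiffAt ℝ 2 φ y → ∀ u : Cn n, HasFDerivAt (fun z => fderiv ℝ φ z u)
      (fderiv ℝ (fun z => fderiv ℝ φ z u) y) y := fun hφ u =>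
    (hφ.differentiableAt_fderiv.clm_apply (differentiableAt_const u)).hasFDerivAt
  have h1 := (hH.mul ((ha.mul (hc him w)).sub (hb.mul (hc hre w)))).sub
    (((hH.mul ((ha.pow 2).add (hb.pow 2))).mul (hc hφ (Complex.I • w))).const_mul (2⁻¹ : ℝ))
  have h2 : HasFDerivAt (fun z => locGamma h ψ x₀ z w) _ y := h1
  rw [h2.fderiv]
  simp only [sub_apply, add_apply, FunLike.coe_smul, Pi.smul_apply, smul_eq_mul,
    fderiv_fderiv_apply him, fderiv_fderiv_apply hre, fderiv_fderiv_apply hφ, fderiv_hFrame h hy,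
    Pi.add_apply, Pi.sub_apply, Pi.mul_apply]
  simp
  ring

theorem locNabla_eq {ψ : Π x, L x} {y : Cn n} (hψ : DifferentiableAt ℝ (loc ψ x₀) y) (v : Cn n) :
    locNabla h ψ x₀ y v = ⟨fderiv ℝ (locRe ψ x₀) y v
        + 2⁻¹ * (fderiv ℝ (logH h x₀) y v * locRe ψ x₀ y
          + fderiv ℝ (logH h x₀) y (Complex.I • v) * locIm ψ x₀ y),
      fderiv ℝ (locIm ψ x₀) y v
        + 2⁻¹ * (fderiv ℝ (logH h x₀) y v * locIm ψ x₀ y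
          - fderiv ℝ (logH h x₀) y (Complex.I • v) * locRe ψ x₀ y)⟩ := by
  have hre : fderiv ℝ (locRe ψ x₀) y = Complex.reCLM.comp (fderiv ℝ (loc ψ x₀) y) :=
    (Complex.reCLM.hasFDerivAt.comp y hψ.hasFDerivAt).fderiv
  have him : fderiv ℝ (locIm ψ x₀) y = Complex.imCLM.comp (fderiv ℝ (loc ψ x₀) y) :=
    (Complex.imCLM.hasFDerivAt.comp y hψ.hasFDerivAt).fderiv
  rw [locNabla, connForm, hre, him]
  apply Complex.ext
  · simp [locRe, locIm]
    ring
  · simp [locRe, locIm]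
    ring

/-- The pointwise Weitzenböck identity in one complex direction: `|∇_v ψ + i ∇_{iv} ψ|²` differs
from `|∇_v ψ|² + |∇_{iv} ψ|²` and the curvature term by `dγ(v, iv)`, where `γ = Im h(ψ, ∇ψ)`. -/
theorem weitzenbock_direction {ψ : Π x, L x} {y : Cn n} (hy : y ∈ bdom n L x₀)
    (hψ : ContDiffAt ℝ 2 (loc ψ x₀) y) (v : Cn n) :
    ‖locNabla h ψ x₀ y v + Complex.I * locNabla h ψ x₀ y (Complex.I • v)‖ ^ 2 * hFrame h x₀ y
      - (‖locNabla h ψ x₀ y v‖ ^ 2 + ‖locNabla h ψ x₀ y (Complex.I • v)‖ ^ 2) * hFrame h x₀ y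
      - 2⁻¹ * lev (logH h x₀) y v * (‖loc ψ x₀ y‖ ^ 2 * hFrame h x₀ y)
    = -(fderiv ℝ (fun z => locGamma h ψ x₀ z (Complex.I • v)) y v
      - fderiv ℝ (fun z => locGamma h ψ x₀ z v) y (Complex.I • v)) := by
  have hre : ContDiffAt ℝ 2 (locRe ψ x₀) y := Complex.reCLM.contDiff.contDiffAt.comp y hψ
  have him : ContDiffAt ℝ 2 (locIm ψ x₀) y := Complex.imCLM.contDiff.contDiffAt.comp y hψ
  have hII : Complex.I • Complex.I • v = -v := by
    rw [smul_smul, Complex.I_mul_I, neg_one_smul]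
  have hd := hψ.differentiableAt (by simp)
  rw [fderiv_locGamma h hy hψ, fderiv_locGamma h hy hψ, locNabla_eq h hd, locNabla_eq h hd, hII,
    lev, hess_comm hre (Complex.I • v) v, hess_comm him (Complex.I • v) v]
  simp only [map_neg, hess_neg_right, Complex.sq_norm, Complex.normSq_apply]
  have e1 : (loc ψ x₀ y).re = locRe ψ x₀ y := rfl
  have e2 : (loc ψ x₀ y).im = locIm ψ x₀ y := rfl
  simp only [e1, e2, Complex.add_re, Complex.add_im, Complex.mul_re, Complex.mul_im, Complex.I_re,
    Complex.I_im]
  ring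

/-- The density whose integral vanishes by the Weitzenböck formula. -/
def weitz (ψ : Π x, L x) (x : M) : ℝ :=
  2 * trace01 h ψ x - traceTM h ψ x - rho h x * hSq h ψ x

theorem weitz_eq_sum {ψ : Π x, L x} (hx : x ∈ bset n L x₀)
    (hψ : ContDiffAt ℝ 2 (loc ψ x₀) (chartAt (Cn n) x₀ x)) :
    weitz h ψ x = -∑ k, (fderiv ℝ (fun z => locGamma h ψ x₀ z (Complex.I • frameAt x₀ x k))
        (chartAt (Cn n) x₀ x) (frameAt x₀ x k)
      - fderiv ℝ (fun z => locGamma h ψ x₀ z (frameAt x₀ x k))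
        (chartAt (Cn n) x₀ x) (Complex.I • frameAt x₀ x k)) := by
  have hd := hψ.differentiableAt (by simp)
  rw [weitz, trace01_eq h ψ hx hd, traceTM_eq h ψ hx hd, rho_eq h hx, hSq_eq_loc h ψ hx,
    Finset.mul_sum, Finset.sum_mul, ← Finset.sum_sub_distrib, ← Finset.sum_sub_distrib,
    ← Finset.sum_neg_distrib]
  refine Finset.sum_congr rfl fun k _ => ?_
  rw [← weitzenbock_direction h (chart_mem_bdom hx) hψ]
  ring

end Pointwise

/-! ### The Leibniz rule -/

section Algebra

variable {n : ℕ} {M : Type*} [TopologicalSpace M] [ChartedSpace (Cn n) M]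
  {L : M → Type*} [∀ x, AddCommGroup (L x)] [∀ x, Module ℂ (L x)] [∀ x, TopologicalSpace (L x)]
  [TopologicalSpace (TotalSpace ℂ L)] [FiberBundle ℂ L] [VectorBundle ℂ ℂ L]
  [IsManifold 𝓘(ℂ, Cn n) ω M] [ContMDiffVectorBundle ω ℂ L 𝓘(ℂ, Cn n)]
  (h : HermitianMetric n L) {ψ φ : Π x, L x} {x₀ x : M}

/-- The product of a real function and a section. -/
def rsmul (χ : M → ℝ) (ψ : Π x, L x) : Π x, L x := fun q => (χ q : ℂ) • ψ q

theorem loc_add {y : Cn n} (hy : y ∈ bdom n L x₀) :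
    loc (ψ + φ) x₀ y = loc ψ x₀ y + loc φ x₀ y := coord_add ψ φ hy.2

theorem loc_sub {y : Cn n} (hy : y ∈ bdom n L x₀) :
    loc (ψ - φ) x₀ y = loc ψ x₀ y - loc φ x₀ y := coord_sub ψ φ hy.2

theorem loc_rsmul (χ : M → ℝ) {y : Cn n} (hy : y ∈ bdom n L x₀) :
    loc (rsmul χ ψ) x₀ y = (χ ((chartAt (Cn n) x₀).symm y) : ℂ) * loc ψ x₀ y :=
  coord_smul (fun q => (χ q : ℂ)) ψ hy.2

theorem loc_eventuallyEq_of_bdom {F : Cn n → ℂ} {y : Cn n} (hy : y ∈ bdom n L x₀)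
    (hF : ∀ z ∈ bdom n L x₀, loc ψ x₀ z = F z) : loc ψ x₀ =ᶠ[𝓝 y] F := by
  filter_upwards [(isOpen_bdom x₀).mem_nhds hy] with z hz using hF z hz

/-- The coordinate expression of a smooth function is smooth. -/
theorem contDiffAt_comp_symm {χ : M → ℝ} (hχ : ContMDiff 𝓘(ℝ, Cn n) 𝓘(ℝ, ℝ) ∞ χ) {y : Cn n}
    (hy : y ∈ (chartAt (Cn n) x₀).target) :
    ContDiffAt ℝ ∞ (fun z => χ ((chartAt (Cn n) x₀).symm z)) y := by
  have h2 : ContMDiffAt 𝓘(ℝ, Cn n) 𝓘(ℝ, Cn n) ∞ (chartAt (Cn n) x₀).symm y :=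
    ((contMDiffOn_chart_symm (I := 𝓘(ℝ, Cn n)) (n := ω) (x := x₀)).contMDiffAt
      ((chartAt (Cn n) x₀).open_target.mem_nhds hy)).of_le le_top
  exact ((hχ _).comp y h2).contDiffAt

theorem IsSmoothSection.add (hψ : IsSmoothSection n ψ) (hφ : IsSmoothSection n φ) :
    IsSmoothSection n (ψ + φ) := isSmoothSection_of_loc fun x => by
  have hx := chart_mem_bdom (mem_bset_self (L := L) (n := n) x)
  exact ((hψ.contDiffAt_loc hx).add (hφ.contDiffAt_loc hx)).congr_of_eventuallyEq
    (loc_eventuallyEq_of_bdom hx fun z hz => loc_add hz)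

theorem IsSmoothSection.rsmul {χ : M → ℝ} (hχ : ContMDiff 𝓘(ℝ, Cn n) 𝓘(ℝ, ℝ) ∞ χ)
    (hψ : IsSmoothSection n ψ) : IsSmoothSection n (rsmul χ ψ) := isSmoothSection_of_loc fun x => by
  have hx := chart_mem_bdom (mem_bset_self (L := L) (n := n) x)
  exact ((Complex.ofRealCLM.contDiff.contDiffAt.comp _ (contDiffAt_comp_symm hχ hx.1)).mul
    (hψ.contDiffAt_loc hx)).congr_of_eventuallyEq
    (loc_eventuallyEq_of_bdom hx fun z hz => loc_rsmul χ hz)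

theorem nab_add (hψ : IsSmoothSection n ψ) (hφ : IsSmoothSection n φ) (x : M) (v : Cn n) :
    nab h (ψ + φ) x v = nab h ψ x v + nab h φ x v := by
  have hx := chart_mem_bdom (mem_bset_self (L := L) (n := n) x)
  have h1 : ∀ (ψ : Π x, L x) (w : Cn n), nab h ψ x w = (fderiv ℝ (loc ψ x) (chartAt (Cn n) x x) w
      + connForm h x (chartAt (Cn n) x x) w * coord ψ x x) • frame L x x := fun ψ w => rfl
  rw [h1, h1, h1, (loc_eventuallyEq_of_bdom (ψ := ψ + φ) hx fun z hz => loc_add hz).fderiv_eq,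
    fderiv_fun_add ((hψ.contDiffAt_loc hx).differentiableAt (by simp))
      ((hφ.contDiffAt_loc hx).differentiableAt (by simp)),
    coord_add ψ φ (mem_baseSet_trivializationAt _ _ _), ← add_smul, add_apply]
  congr 1
  ring

/-- The differential of a function at `x`, in the preferred chart. -/
def dfun (χ : M → ℝ) (x : M) : Cn n →L[ℝ] ℝ :=
  fderiv ℝ (fun y => χ ((chartAt (Cn n) x).symm y)) (chartAt (Cn n) x x)

/-- The Leibniz rule for the connection. -/
theorem nab_rsmul {χ : M → ℝ} (hχ : ContMDiff 𝓘(ℝ, Cn n) 𝓘(ℝ, ℝ) ∞ χ)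
    (hψ : IsSmoothSection n ψ) (x : M) (v : Cn n) :
    nab h (rsmul χ ψ) x v = (χ x : ℂ) • nab h ψ x v + (dfun χ x v : ℂ) • ψ x := by
  have hx := chart_mem_bdom (mem_bset_self (L := L) (n := n) x)
  have h1 : ∀ (ψ : Π x, L x) (w : Cn n), nab h ψ x w = (fderiv ℝ (loc ψ x) (chartAt (Cn n) x x) w
      + connForm h x (chartAt (Cn n) x x) w * coord ψ x x) • frame L x x := fun ψ w => rfl
  have h2 : coord (BerezinToeplitz.rsmul χ ψ) x x = (χ x : ℂ) * coord ψ x x :=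
    coord_smul (fun q => (χ q : ℂ)) ψ (mem_baseSet_trivializationAt _ _ _)
  have h3 : ψ x = coord ψ x x • frame L x x :=
    (coord_smul_frame ψ (mem_baseSet_trivializationAt _ _ _)).symm
  have h4 := Complex.ofRealCLM.hasFDerivAt.comp _
    ((contDiffAt_comp_symm hχ hx.1).differentiableAt (by simp)).hasFDerivAt
  have h5 := h4.mul ((hψ.contDiffAt_loc hx).differentiableAt (by simp)).hasFDerivAt
  have h6 : HasFDerivAt (fun z => (χ ((chartAt (Cn n) x).symm z) : ℂ) * loc ψ x z) _
    (chartAt (Cn n) x x) := h5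
  rw [h1, h1, (loc_eventuallyEq_of_bdom (ψ := BerezinToeplitz.rsmul χ ψ) hx
    fun z hz => loc_rsmul χ hz).fderiv_eq, h6.fderiv, h2]
  conv_rhs => rw [h3]
  rw [smul_smul, smul_smul, ← add_smul]
  congr 1
  have h7 : loc ψ x (chartAt (Cn n) x x) = coord ψ x x := loc_chart ψ (mem_chart_source _ _)
  have h8 : (chartAt (Cn n) x).symm (chartAt (Cn n) x x) = x :=
    (chartAt (Cn n) x).left_inv (mem_chart_source _ _)
  simp [h7, h8, dfun]
  ring

end Algebra

/-! ### Continuity of the energy densities -/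

section Continuity

variable {n : ℕ} {M : Type*} [TopologicalSpace M] [ChartedSpace (Cn n) M]
  {L : M → Type*} [∀ x, AddCommGroup (L x)] [∀ x, Module ℂ (L x)] [∀ x, TopologicalSpace (L x)]
  [TopologicalSpace (TotalSpace ℂ L)] [FiberBundle ℂ L] [VectorBundle ℂ ℂ L]
  [IsManifold 𝓘(ℂ, Cn n) ω M] [ContMDiffVectorBundle ω ℂ L 𝓘(ℂ, Cn n)]
  [RiemannianBundle (fun x : M => TangentSpace 𝓘(ℝ, Cn n) x)]
  (h : HermitianMetric n L) {ψ φ : Π x, L x} {x₀ x : M}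

theorem sum_frameAt_eq_trG (hK : IsKahler n M) (hx : x ∈ (chartAt (Cn n) x₀).source)
    (B : LinearMap.BilinForm ℝ (Cn n)) :
    ∑ k, (B (frameAt x₀ x k) (frameAt x₀ x k)
      + B (Complex.I • frameAt x₀ x k) (Complex.I • frameAt x₀ x k))
    = trG (gC x₀ (chartAt (Cn n) x₀ x)) fun v w => B v w :=
  (unitaryFor_gC hx (unitaryFor_uFrame hK x)).sum_eq_trG
    (isHermitianForm_gC hK ((chartAt (Cn n) x₀).map_source hx)) B

/-- The real inner product of the values of a real linear map into `ℂ`, as a bilinear form. -/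
def reForm (N : Cn n →ₗ[ℝ] ℂ) : LinearMap.BilinForm ℝ (Cn n) :=
  LinearMap.mk₂ ℝ (fun v w => (N v).re * (N w).re + (N v).im * (N w).im)
    (fun v v' w => by simp; ring) (fun c v w => by simp; ring)
    (fun v w w' => by simp; ring) (fun c v w => by simp; ring)

theorem reForm_self (N : Cn n →ₗ[ℝ] ℂ) (v : Cn n) : reForm N v v = ‖N v‖ ^ 2 := by
  simp [reForm, Complex.sq_norm, Complex.normSq_apply]

/-- The local covariant derivative as a linear map. -/
def locNablaL (ψ : Π x, L x) (x₀ : M) (y : Cn n) : Cn n →ₗ[ℝ] ℂ where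
  toFun := locNabla h ψ x₀ y
  map_add' := locNabla_add h ψ x₀ y
  map_smul' c v := by rw [locNabla_smul]; simp

/-- The local expression of `v ↦ ∇_{v + i J v} ψ` as a linear map. -/
def locDbarL (ψ : Π x, L x) (x₀ : M) (y : Cn n) : Cn n →ₗ[ℝ] ℂ where
  toFun v := locNabla h ψ x₀ y v + Complex.I * locNabla h ψ x₀ y (Complex.I • v)
  map_add' v w := by simp only [smul_add, locNabla_add]; ring
  map_smul' c v := by simp only [smul_comm Complex.I c, locNabla_smul]; simp; ring

/-- `∇_{v + iJv}` is antilinear in `v`. -/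
theorem norm_locDbarL_I (ψ : Π x, L x) (x₀ : M) (y v : Cn n) :
    ‖locDbarL h ψ x₀ y (Complex.I • v)‖ = ‖locDbarL h ψ x₀ y v‖ := by
  have h1 : locDbarL h ψ x₀ y (Complex.I • v) = -Complex.I * locDbarL h ψ x₀ y v := by
    have h2 : locNabla h ψ x₀ y (Complex.I • Complex.I • v) = -locNabla h ψ x₀ y v := by
      rw [smul_smul, Complex.I_mul_I, neg_one_smul]
      exact map_neg (locNablaL h ψ x₀ y) v
    simp only [locDbarL, LinearMap.coe_mk, AddHom.coe_mk, h2]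
    linear_combination (locNabla h ψ x₀ y (Complex.I • v)) * Complex.I_mul_I
  rw [h1]
  simp

theorem traceTM_eq_trG (hK : IsKahler n M) (hx : x ∈ bset n L x₀)
    (hψ : DifferentiableAt ℝ (loc ψ x₀) (chartAt (Cn n) x₀ x)) :
    traceTM h ψ x = trG (gC x₀ (chartAt (Cn n) x₀ x))
      (fun v w => reForm (locNablaL h ψ x₀ (chartAt (Cn n) x₀ x)) v w)
      * hFrame h x₀ (chartAt (Cn n) x₀ x) := by
  rw [traceTM_eq h ψ hx hψ, ← sum_frameAt_eq_trG hK hx.1, Finset.sum_mul]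
  simp only [reForm_self]
  rfl

theorem trace01_eq_trG (hK : IsKahler n M) (hx : x ∈ bset n L x₀)
    (hψ : DifferentiableAt ℝ (loc ψ x₀) (chartAt (Cn n) x₀ x)) :
    trace01 h ψ x = 4⁻¹ * trG (gC x₀ (chartAt (Cn n) x₀ x))
      (fun v w => reForm (locDbarL h ψ x₀ (chartAt (Cn n) x₀ x)) v w)
      * hFrame h x₀ (chartAt (Cn n) x₀ x) := by
  rw [trace01_eq h ψ hx hψ, ← sum_frameAt_eq_trG hK hx.1, Finset.mul_sum, Finset.sum_mul]
  refine Finset.sum_congr rfl fun k _ => ?_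
  rw [reForm_self, reForm_self, norm_locDbarL_I]
  have h1 : locNabla h ψ x₀ (chartAt (Cn n) x₀ x) (frameAt x₀ x k)
      + Complex.I * locNabla h ψ x₀ (chartAt (Cn n) x₀ x) (Complex.I • frameAt x₀ x k)
      = locDbarL h ψ x₀ (chartAt (Cn n) x₀ x) (frameAt x₀ x k) := rfl
  rw [h1]
  ring

theorem rho_eq_trG (hK : IsKahler n M) (hx : x ∈ bset n L x₀) :
    rho h x = 2⁻¹ * trG (gC x₀ (chartAt (Cn n) x₀ x))
      (fun v w => hess (logH h x₀) (chartAt (Cn n) x₀ x) v w) := by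
  have h1 := sum_frameAt_eq_trG hK hx.1 (LinearMap.mk₂ ℝ
    (hess (logH h x₀) (chartAt (Cn n) x₀ x)) (by simp [hess]) (by simp [hess]) (by simp [hess])
    (by simp [hess]))
  rw [rho_eq h hx, ← Finset.mul_sum]
  exact congrArg (2⁻¹ * ·) h1

theorem continuousOn_trG [IsContMDiffRiemannianBundle 𝓘(ℝ, Cn n) ∞ (Cn n)
      (fun x : M => TangentSpace 𝓘(ℝ, Cn n) x)] (hK : IsKahler n M) {Ω : Set (Cn n)}
    (hΩ : Ω ⊆ (chartAt (Cn n) x₀).target) {B : Cn n → Cn n → Cn n → ℝ}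
    (hB : ∀ v w, ContinuousOn (fun y => B y v w) Ω) :
    ContinuousOn (fun y => trG (gC x₀ y) (B y)) Ω :=
  continuousOn_finsetSum _ fun i _ => continuousOn_finsetSum _ fun j _ =>
    (((isKahlerOn_gC hK x₀).contDiffOn_inv i j).continuousOn.mono hΩ).mul (hB _ _)

theorem continuousOn_locNabla (hψ : IsSmoothSection n ψ) (v : Cn n) :
    ContinuousOn (fun y => locNabla h ψ x₀ y v) (bdom n L x₀) := by
  have hc : ∀ {F : Type _} [NormedAddCommGroup F] [NormedSpace ℝ F] {u : Cn n → F} (w : Cn n),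
      ContDiffOn ℝ ∞ u (bdom n L x₀) →
      ContinuousOn (fun y => fderiv ℝ u y w) (bdom n L x₀) := fun w hu =>
    (hu.continuousOn_fderiv_of_isOpen (isOpen_bdom x₀) (by simp)).clm_apply continuousOn_const
  refine (hc v (hψ.contDiffOn_loc x₀)).add (ContinuousOn.mul ?_ (hψ.contDiffOn_loc x₀).continuousOn)
  unfold connForm
  exact ((Complex.continuous_ofReal.comp_continuousOn (hc v (contDiffOn_logH h x₀))).sub
    (continuousOn_const.mul (Complex.continuous_ofReal.comp_continuousOn
      (hc _ (contDiffOn_logH h x₀))))).div_const _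

/-- A function on the manifold whose coordinate expressions are continuous is continuous. -/
theorem continuous_of_chart {F : M → ℝ} (G : M → Cn n → ℝ)
    (hG : ∀ x₀, ContinuousOn (G x₀) (bdom n L x₀))
    (hF : ∀ x₀, ∀ x ∈ bset n L x₀, F x = G x₀ (chartAt (Cn n) x₀ x)) : Continuous F := by
  refine continuous_iff_continuousAt.2 fun x => ?_
  have hx := mem_bset_self (L := L) (n := n) x
  have h1 : F =ᶠ[𝓝 x] G x ∘ chartAt (Cn n) x := by
    filter_upwards [(isOpen_bset x).mem_nhds hx] with p hp using hF x p hp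
  refine ContinuousAt.congr ?_ h1.symm
  exact ((hG x).continuousAt ((isOpen_bdom x).mem_nhds (chart_mem_bdom hx))).comp
    ((chartAt (Cn n) x).continuousAt hx.1)

theorem continuous_hSq_of_loc (hψ : ∀ x₀, ContinuousOn (loc ψ x₀) (bdom n L x₀)) :
    Continuous (hSq h ψ) :=
  continuous_of_chart (L := L) (fun x₀ y => ‖loc ψ x₀ y‖ ^ 2 * hFrame h x₀ y)
    (fun x₀ => ((hψ x₀).norm.pow 2).mul (contDiffOn_hFrame h x₀).continuousOn)
    (fun _ _ hx => hSq_eq_loc h ψ hx)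

theorem IsSmoothSection.continuous_hSq (hψ : IsSmoothSection n ψ) : Continuous (hSq h ψ) :=
  continuous_hSq_of_loc h fun x₀ => (hψ.contDiffOn_loc x₀).continuousOn

variable [IsContMDiffRiemannianBundle 𝓘(ℝ, Cn n) ∞ (Cn n)
      (fun x : M => TangentSpace 𝓘(ℝ, Cn n) x)]

theorem continuous_rho (hK : IsKahler n M) : Continuous (rho h) := by
  refine continuous_of_chart (L := L)
    (fun x₀ y => 2⁻¹ * trG (gC x₀ y) (fun v w => hess (logH h x₀) y v w)) (fun x₀ => ?_)
    (fun _ _ hx => rho_eq_trG h hK hx)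
  refine continuousOn_const.mul (continuousOn_trG hK inter_subset_left fun v w => ?_)
  have h1 : ContDiffOn ℝ ∞ (fderiv ℝ (logH h x₀)) (bdom n L x₀) :=
    (contDiffOn_logH h x₀).fderiv_of_isOpen (isOpen_bdom x₀) (by simp)
  exact ((h1.continuousOn_fderiv_of_isOpen (isOpen_bdom x₀) (by simp)).clm_apply
    continuousOn_const).clm_apply continuousOn_const

theorem IsSmoothSection.continuous_traceTM (hK : IsKahler n M) (hψ : IsSmoothSection n ψ) :
    Continuous (traceTM h ψ) := by
  refine continuous_of_chart (L := L)
    (fun x₀ y => trG (gC x₀ y) (fun v w => reForm (locNablaL h ψ x₀ y) v w) * hFrame h x₀ y)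
    (fun x₀ => ?_) (fun x₀ x hx => traceTM_eq_trG h hK hx
      ((hψ.contDiffAt_loc (chart_mem_bdom hx)).differentiableAt (by simp)))
  refine (continuousOn_trG hK inter_subset_left fun v w => ?_).mul
    (contDiffOn_hFrame h x₀).continuousOn
  have h1 := continuousOn_locNabla h (x₀ := x₀) hψ
  exact ((Complex.continuous_re.comp_continuousOn (h1 v)).mul
    (Complex.continuous_re.comp_continuousOn (h1 w))).add
    ((Complex.continuous_im.comp_continuousOn (h1 v)).mul
    (Complex.continuous_im.comp_continuousOn (h1 w)))

theorem IsSmoothSection.continuous_trace01 (hK : IsKahler n M) (hψ : IsSmoothSection n ψ) :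
    Continuous (trace01 h ψ) := by
  refine continuous_of_chart (L := L)
    (fun x₀ y => 4⁻¹ * trG (gC x₀ y) (fun v w => reForm (locDbarL h ψ x₀ y) v w) * hFrame h x₀ y)
    (fun x₀ => ?_) (fun x₀ x hx => trace01_eq_trG h hK hx
      ((hψ.contDiffAt_loc (chart_mem_bdom hx)).differentiableAt (by simp)))
  refine (continuousOn_const.mul (continuousOn_trG hK inter_subset_left fun v w => ?_)).mul
    (contDiffOn_hFrame h x₀).continuousOn
  have h1 : ∀ v, ContinuousOn (fun y => locDbarL h ψ x₀ y v) (bdom n L x₀) := fun v =>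
    (continuousOn_locNabla h hψ v).add (continuousOn_const.mul (continuousOn_locNabla h hψ _))
  exact ((Complex.continuous_re.comp_continuousOn (h1 v)).mul
    (Complex.continuous_re.comp_continuousOn (h1 w))).add
    ((Complex.continuous_im.comp_continuousOn (h1 v)).mul
    (Complex.continuous_im.comp_continuousOn (h1 w)))

end Continuity

/-! ### The Riemannian volume measure -/

section VolumeMeasure

variable {n : ℕ}

/-- The transformation law of the Gram determinant. -/
theorem det_gram_comp (G G' : LinearMap.BilinForm ℝ (Cn n)) (A : Cn n →ₗ[ℝ] Cn n)
    (h : ∀ v w, G v w = G' (A v) (A w)) :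
    (gram G).det = LinearMap.det A ^ 2 * (gram G').det := by
  have hg : ∀ G : LinearMap.BilinForm ℝ (Cn n),
      gram G = LinearMap.BilinForm.toMatrix (realBasisB n) G := by
    intro G
    ext i j
    rw [gram_apply, LinearMap.BilinForm.toMatrix_apply, coe_realBasisB]
  have h1 : G = G'.comp A A := by
    ext v w
    exact h v w
  rw [hg, hg, h1, LinearMap.BilinForm.toMatrix_comp (realBasisB n) (realBasisB n), Matrix.det_mul,
    Matrix.det_mul, Matrix.det_transpose, LinearMap.det_toMatrix]
  ring

variable {M : Type*} [TopologicalSpace M] [ChartedSpace (Cn n) M]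
  [RiemannianBundle (fun x : M => TangentSpace 𝓘(ℝ, Cn n) x)]
  [IsManifold 𝓘(ℂ, Cn n) ω M]
  [IsContMDiffRiemannianBundle 𝓘(ℝ, Cn n) ∞ (Cn n)
      (fun x : M => TangentSpace 𝓘(ℝ, Cn n) x)] {x₀ x : M}

theorem volDensity_nonneg (x₀ : M) (y : Cn n) : 0 ≤ volDensity x₀ y := Real.sqrt_nonneg _

theorem volDensity_trans {y : Cn n} (hy : y ∈ transDomain x₀ x) :
    volDensity x₀ y = |(fderiv ℝ (trans x₀ x) y).det| * volDensity x (trans x₀ x y) := by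
  rw [volDensity_eq, volDensity_eq, det_gram_comp _ (gC x (trans x₀ x y))
    (fderiv ℝ (trans x₀ x) y : Cn n →ₗ[ℝ] Cn n) fun v w => gC_trans hy v w,
    Real.sqrt_mul (sq_nonneg _), Real.sqrt_sq_eq_abs]

theorem continuousOn_volDensity (hK : IsKahler n M) (x₀ : M) :
    ContinuousOn (volDensity x₀) (chartAt (Cn n) x₀).target :=
  (isKahlerOn_gC hK x₀).contDiffOn_sqrt_det.continuousOn

theorem volDensity_pos (hK : IsKahler n M) {y : Cn n} (hy : y ∈ (chartAt (Cn n) x₀).target) :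
    0 < volDensity x₀ y := by
  rw [volDensity_eq]
  exact Real.sqrt_pos.2 (isHermitianForm_gC hK hy).det_pos

variable [MeasurableSpace M] [BorelSpace M]

theorem aemeasurable_chart_symm (x₀ : M) :
    AEMeasurable (chartAt (Cn n) x₀).symm
      ((volume : Measure (Cn n)).restrict (chartAt (Cn n) x₀).target) :=
  (chartAt (Cn n) x₀).continuousOn_symm.aemeasurable (chartAt (Cn n) x₀).open_target.measurableSet

theorem aemeasurable_volDensity (hK : IsKahler n M) (x₀ : M) :
    AEMeasurable (volDensity x₀)
      ((volume : Measure (Cn n)).restrict (chartAt (Cn n) x₀).target) :=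
  (continuousOn_volDensity hK x₀).aemeasurable (chartAt (Cn n) x₀).open_target.measurableSet

theorem measurableSet_chart_symm_preimage (x₀ : M) {A : Set M} (hA : MeasurableSet A) :
    MeasurableSet ((chartAt (Cn n) x₀).target ∩ (chartAt (Cn n) x₀).symm ⁻¹' A) := by
  classical
  have h1 := (chartAt (Cn n) x₀).continuousOn_symm.measurable_piecewise
    (g := fun _ => x₀) continuousOn_const (chartAt (Cn n) x₀).open_target.measurableSet
  convert (chartAt (Cn n) x₀).open_target.measurableSet.inter (h1 hA) using 1
  ext y
  by_cases hy : y ∈ (chartAt (Cn n) x₀).target <;> simp [hy]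

theorem chartMeasure_apply {A : Set M} (hA : MeasurableSet A) :
    chartMeasure (n := n) x₀ A = ∫⁻ y in (chartAt (Cn n) x₀).target ∩
      (chartAt (Cn n) x₀).symm ⁻¹' A, ENNReal.ofReal (volDensity x₀ y) := by
  rw [chartMeasure, Measure.map_apply_of_aemeasurable
    ((aemeasurable_chart_symm x₀).mono_ac (withDensity_absolutelyContinuous _ _)) hA,
    withDensity_apply' _ _, Measure.restrict_restrict'
    (chartAt (Cn n) x₀).open_target.measurableSet, inter_comm]

theorem chartMeasure_compl_source (x₀ : M) {A : Set M} (hA : MeasurableSet A) :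
    chartMeasure (n := n) x₀ A = chartMeasure (n := n) x₀ (A ∩ (chartAt (Cn n) x₀).source) := by
  rw [chartMeasure_apply hA,
    chartMeasure_apply (hA.inter (chartAt (Cn n) x₀).open_source.measurableSet)]
  congr 2
  ext y
  exact ⟨fun hy => ⟨hy.1, hy.2, (chartAt (Cn n) x₀).map_target hy.1⟩, fun hy => ⟨hy.1, hy.2.1⟩⟩

/-- The change of variables formula: the measures of two charts agree on the overlap. -/
theorem chartMeasure_eq_of_subset {A : Set M} (hA : MeasurableSet A)
    (h0 : A ⊆ (chartAt (Cn n) x₀).source) (h1 : A ⊆ (chartAt (Cn n) x).source) :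
    chartMeasure (n := n) x A = chartMeasure (n := n) x₀ A := by
  rw [chartMeasure_apply hA, chartMeasure_apply hA]
  set S := (chartAt (Cn n) x₀).target ∩ (chartAt (Cn n) x₀).symm ⁻¹' A with hS
  have hSm : MeasurableSet S := measurableSet_chart_symm_preimage x₀ hA
  have hST : S ⊆ transDomain x₀ x := fun y hy => ⟨hy.1, h1 hy.2⟩
  have himg : (chartAt (Cn n) x).target ∩ (chartAt (Cn n) x).symm ⁻¹' A = trans x₀ x '' S := by
    ext z
    constructor
    · intro hz
      have hz' : z ∈ transDomain x x₀ := ⟨hz.1, h0 hz.2⟩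
      refine ⟨trans x x₀ z, ⟨(trans_mem hz').1, ?_⟩, trans_trans_apply hz'⟩
      rw [mem_preimage, symm_trans hz']
      exact hz.2
    · rintro ⟨y, hy, rfl⟩
      refine ⟨(trans_mem (hST hy)).1, ?_⟩
      rw [mem_preimage, symm_trans (hST hy)]
      exact hy.2
  have hinj : InjOn (trans x₀ x) S := fun y hy z hz hyz => by
    rw [← trans_trans_apply (hST hy), hyz, trans_trans_apply (hST hz)]
  rw [himg, lintegral_image_eq_lintegral_abs_det_fderiv_mul volume hSm
    (fun y hy => (differentiableAt_trans (hST hy)).hasFDerivAt.hasFDerivWithinAt) hinj]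
  refine setLIntegral_congr_fun hSm fun y hy => ?_
  rw [volDensity_trans (hST hy), ENNReal.ofReal_mul (abs_nonneg _)]

theorem chartMeasure_restrict_le (x₀ x : M) :
    (chartMeasure (n := n) x).restrict (chartAt (Cn n) x₀).source ≤ chartMeasure (n := n) x₀ := by
  refine Measure.le_iff.2 fun A hA => ?_
  have hU := (chartAt (Cn n) x₀).open_source.measurableSet
  rw [Measure.restrict_apply hA, chartMeasure_compl_source x (hA.inter hU),
    chartMeasure_eq_of_subset ((hA.inter hU).inter (chartAt (Cn n) x).open_source.measurableSet)
      (fun p hp => hp.1.2) (fun p hp => hp.2)]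
  exact measure_mono fun p hp => hp.1.1

/-- On the domain of a chart, the volume measure is the one given by the chart. -/
theorem volMeasure_restrict (x₀ : M) :
    (volMeasure n M).restrict (chartAt (Cn n) x₀).source = chartMeasure (n := n) x₀ := by
  have hU := (chartAt (Cn n) x₀).open_source.measurableSet
  refine Measure.ext fun A hA => le_antisymm ?_ ?_
  · rw [Measure.restrict_apply hA]
    have h1 : volMeasure n M ≤ chartMeasure (n := n) x₀
        + (volMeasure n M).restrict (chartAt (Cn n) x₀).sourceᶜ := by
      refine iSup_le fun x => ?_
      rw [← Measure.restrict_add_restrict_compl hU (μ := chartMeasure (n := n) x)]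
      exact add_le_add (chartMeasure_restrict_le x₀ x)
        (Measure.restrict_mono le_rfl (le_iSup (fun x : M => chartMeasure (n := n) x) x))
    refine (h1 _).trans ?_
    rw [Measure.add_apply, Measure.restrict_apply (hA.inter hU), inter_assoc, inter_compl_self,
      inter_empty, measure_empty, add_zero]
    exact measure_mono inter_subset_left
  · rw [chartMeasure_compl_source x₀ hA, Measure.restrict_apply hA]
    exact le_iSup (fun x : M => chartMeasure (n := n) x) x₀ _

theorem setLIntegral_chart (hK : IsKahler n M) (x₀ : M) {F : M → ENNReal}
    (hF : AEMeasurable F ((volMeasure n M).restrict (chartAt (Cn n) x₀).source)) :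
    ∫⁻ p in (chartAt (Cn n) x₀).source, F p ∂volMeasure n M
      = ∫⁻ y in (chartAt (Cn n) x₀).target,
        ENNReal.ofReal (volDensity x₀ y) * F ((chartAt (Cn n) x₀).symm y) := by
  rw [volMeasure_restrict] at hF ⊢
  have h1 := (aemeasurable_chart_symm (n := n) x₀).mono_ac (withDensity_absolutelyContinuous
    ((volume : Measure (Cn n)).restrict (chartAt (Cn n) x₀).target)
      fun y => ENNReal.ofReal (volDensity x₀ y))
  rw [chartMeasure] at hF ⊢
  rw [lintegral_map' hF h1]
  exact lintegral_withDensity_eq_lintegral_mul₀'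
    (aemeasurable_volDensity hK x₀).ennreal_ofReal (hF.comp_aemeasurable h1)

theorem setIntegral_chart (hK : IsKahler n M) (x₀ : M) {F : M → ℝ}
    (hF : AEStronglyMeasurable F ((volMeasure n M).restrict (chartAt (Cn n) x₀).source)) :
    ∫ p in (chartAt (Cn n) x₀).source, F p ∂volMeasure n M
      = ∫ y in (chartAt (Cn n) x₀).target,
        F ((chartAt (Cn n) x₀).symm y) * volDensity x₀ y := by
  rw [volMeasure_restrict] at hF ⊢
  have h1 := (aemeasurable_chart_symm (n := n) x₀).mono_ac (withDensity_absolutelyContinuous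
    ((volume : Measure (Cn n)).restrict (chartAt (Cn n) x₀).target)
      fun y => ENNReal.ofReal (volDensity x₀ y))
  rw [chartMeasure] at hF ⊢
  rw [integral_map h1 hF, integral_withDensity_eq_integral_toReal_smul₀
    (aemeasurable_volDensity hK x₀).ennreal_ofReal (by simp)]
  refine integral_congr_ae (ae_of_all _ fun y => ?_)
  simp only [smul_eq_mul]
  rw [ENNReal.toReal_ofReal (volDensity_nonneg x₀ y), mul_comm]

/-- The volume density is bounded on compact subsets of a chart. -/
theorem isLocallyFiniteMeasure_volMeasure (hK : IsKahler n M) :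
    IsLocallyFiniteMeasure (volMeasure n M) := by
  refine ⟨fun x => ?_⟩
  have hx := mem_chart_target (Cn n) x
  obtain ⟨K, hKc, hKx, hKt⟩ :=
    exists_compact_between (isCompact_singleton (x := chartAt (Cn n) x x))
    (chartAt (Cn n) x).open_target (singleton_subset_iff.2 hx)
  rw [singleton_subset_iff] at hKx
  set A := (chartAt (Cn n) x).source ∩ chartAt (Cn n) x ⁻¹' interior K with hA
  have hAo : IsOpen A := (chartAt (Cn n) x).isOpen_inter_preimage isOpen_interior
  refine ⟨A, hAo.mem_nhds ⟨mem_chart_source _ _, hKx⟩, ?_⟩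
  have h1 : volMeasure n M A = chartMeasure (n := n) x A := by
    rw [← volMeasure_restrict, Measure.restrict_apply hAo.measurableSet,
      inter_eq_left.2 inter_subset_left]
  obtain ⟨C, hC⟩ := hKc.exists_bound_of_continuousOn ((continuousOn_volDensity hK x).mono hKt)
  rw [h1, chartMeasure_apply hAo.measurableSet]
  calc _ ≤ ∫⁻ y in K, ENNReal.ofReal (volDensity x y) := by
        refine lintegral_mono_set fun y hy => interior_subset ?_
        have := hy.2.2
        rwa [mem_preimage, (chartAt (Cn n) x).right_inv hy.1] at this
    _ ≤ ∫⁻ y in K, ENNReal.ofReal C := by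
        refine setLIntegral_mono' hKc.measurableSet fun y hy => ENNReal.ofReal_le_ofReal ?_
        exact (le_abs_self _).trans (hC y hy)
    _ < ⊤ := by
        rw [setLIntegral_const]
        exact ENNReal.mul_lt_top ENNReal.ofReal_lt_top hKc.measure_lt_top

end VolumeMeasure

/-! ### Partitions of unity -/

section Partition

variable {n : ℕ} {M : Type*} [TopologicalSpace M] [ChartedSpace (Cn n) M]
  [IsManifold 𝓘(ℂ, Cn n) ω M] [T2Space M] [SigmaCompactSpace M]

/-- A partition of unity for a compact set `K`, subordinate to the neighbourhoods `U x`; one more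
function, which vanishes near `K`, makes it finite. -/
theorem exists_partition {K : Set M} (hK : IsCompact K) (U : M → Set M) (hU : ∀ x, IsOpen (U x))
    (hxU : ∀ x, x ∈ U x) :
    ∃ (t : Finset M) (φ : Option t → M → ℝ), (∀ i, ContMDiff 𝓘(ℝ, Cn n) 𝓘(ℝ, ℝ) ∞ (φ i)) ∧
      (∀ i x, 0 ≤ φ i x) ∧ (∀ x, ∑ i, φ i x = 1) ∧ (∀ i : t, tsupport (φ (some i)) ⊆ U i) ∧
      tsupport (φ none) ⊆ Kᶜ := by
  obtain ⟨t, -, ht⟩ := hK.elim_nhds_subcover U fun x _ => (hU x).mem_nhds (hxU x)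
  have : IsManifold 𝓘(ℝ, Cn n) ∞ M := IsManifold.of_le (n := ω) le_top
  let V : Option t → Set M := fun i => i.elim Kᶜ fun x => U x
  obtain ⟨φ, hφ⟩ := SmoothPartitionOfUnity.exists_isSubordinate 𝓘(ℝ, Cn n)
    (isClosed_univ (X := M)) V
    (fun i => by
      cases i with
      | none => exact hK.isClosed.isOpen_compl
      | some x => exact hU _)
    (fun p _ => by
      by_cases hp : p ∈ K
      · obtain ⟨x, hx, hpx⟩ := mem_iUnion₂.1 (ht hp)
        exact mem_iUnion.2 ⟨some ⟨x, hx⟩, hpx⟩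
      · exact mem_iUnion.2 ⟨none, hp⟩)
  refine ⟨t, fun i => φ i, fun i => (φ i).contMDiff, fun i x => φ.nonneg i x, fun x => ?_,
    fun i => hφ (some i), hφ none⟩
  rw [← finsum_eq_sum_of_fintype]
  exact φ.sum_eq_one (mem_univ x)

/-- A partition of unity whose squares sum up to one. -/
theorem exists_partition_sq {K : Set M} (hK : IsCompact K) (U : M → Set M) (hU : ∀ x, IsOpen (U x))
    (hxU : ∀ x, x ∈ U x) :
    ∃ (t : Finset M) (φ : Option t → M → ℝ), (∀ i, ContMDiff 𝓘(ℝ, Cn n) 𝓘(ℝ, ℝ) ∞ (φ i)) ∧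
      (∀ x, ∑ i, φ i x ^ 2 = 1) ∧ (∀ i : t, tsupport (φ (some i)) ⊆ U i) ∧
      tsupport (φ none) ⊆ Kᶜ := by
  obtain ⟨t, φ, h1, h2, h3, h4, h5⟩ := exists_partition (n := n) hK U hU hxU
  set s : M → ℝ := fun x => ∑ i, φ i x ^ 2 with hs
  have hpos : ∀ x, 0 < s x := by
    intro x
    refine lt_of_le_of_ne (Finset.sum_nonneg fun i _ => sq_nonneg _) fun h => ?_
    have h6 := (Finset.sum_eq_zero_iff_of_nonneg fun i _ => sq_nonneg (φ i x)).1 h.symm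
    have h7 := h3 x
    rw [Finset.sum_eq_zero fun i hi => by simpa using h6 i hi] at h7
    exact zero_ne_one h7
  have hsm : ContMDiff 𝓘(ℝ, Cn n) 𝓘(ℝ, ℝ) ∞ s := contMDiff_finsetSum fun i _ => (h1 i).pow 2
  have hr : ContMDiff 𝓘(ℝ, Cn n) 𝓘(ℝ, ℝ) ∞ fun x => (√(s x))⁻¹ := fun x => by
    have h6 : ContDiffAt ℝ ∞ (fun u : ℝ => (√u)⁻¹) (s x) :=
      (contDiffAt_id.sqrt (hpos x).ne').inv (Real.sqrt_pos.2 (hpos x)).ne'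
    exact ContDiffAt.comp_contMDiffAt (f := s) h6 (hsm x)
  have hsupp : ∀ i, tsupport (fun x => φ i x * (√(s x))⁻¹) ⊆ tsupport (φ i) := fun i =>
    tsupport_mul_subset_left
  refine ⟨t, fun i x => φ i x * (√(s x))⁻¹, fun i => (h1 i).mul hr, fun x => ?_,
    fun i => (hsupp _).trans (h4 i), (hsupp _).trans h5⟩
  simp only [mul_pow, inv_pow, Real.sq_sqrt (hpos x).le]
  rw [← Finset.sum_mul]
  exact mul_inv_cancel₀ (hpos x).ne'

/-- The derivative of `∑ φᵢ² = 1`. -/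
theorem sum_mul_dfun_eq_zero {ι : Type*} [Fintype ι] {φ : ι → M → ℝ}
    (h1 : ∀ i, ContMDiff 𝓘(ℝ, Cn n) 𝓘(ℝ, ℝ) ∞ (φ i)) (h2 : ∀ x, ∑ i, φ i x ^ 2 = 1) (x : M)
    (v : Cn n) : ∑ i, φ i x * dfun (φ i) x v = 0 := by
  have h3 : ∀ i, HasFDerivAt (fun y => φ i ((chartAt (Cn n) x).symm y)) (dfun (φ i) x)
      (chartAt (Cn n) x x) := fun i =>
    ((contDiffAt_comp_symm (h1 i) (mem_chart_target _ x)).differentiableAt (by simp)).hasFDerivAt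
  have h4 := HasFDerivAt.fun_sum (u := Finset.univ) fun i _ => (h3 i).pow 2
  have h5 : HasFDerivAt (fun y => ∑ i, φ i ((chartAt (Cn n) x).symm y) ^ 2)
    (0 : Cn n →L[ℝ] ℝ) (chartAt (Cn n) x x) := by
    simp only [h2]
    exact hasFDerivAt_const _ _
  have h6 := congrArg (fun l : Cn n →L[ℝ] ℝ => l v) (h4.unique h5)
  simp only [sum_apply, FunLike.coe_smul, Pi.smul_apply, smul_eq_mul, zero_apply,
    (chartAt (Cn n) x).left_inv (mem_chart_source _ x)] at h6
  have h7 : (2 : ℝ) * ∑ i, φ i x * dfun (φ i) x v = 0 := by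
    rw [← h6, Finset.mul_sum]
    refine Finset.sum_congr rfl fun i _ => ?_
    simp
    ring
  linarith

end Partition

/-! ### The integral of the Weitzenböck density -/

section WeitzenbockIntegral

variable {n : ℕ} {M : Type*} [TopologicalSpace M] [ChartedSpace (Cn n) M]
  {L : M → Type*} [∀ x, AddCommGroup (L x)] [∀ x, Module ℂ (L x)] [∀ x, TopologicalSpace (L x)]
  [TopologicalSpace (TotalSpace ℂ L)] [FiberBundle ℂ L] [VectorBundle ℂ ℂ L]
  [IsManifold 𝓘(ℂ, Cn n) ω M] [ContMDiffVectorBundle ω ℂ L 𝓘(ℂ, Cn n)]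
  [RiemannianBundle (fun x : M => TangentSpace 𝓘(ℝ, Cn n) x)]
  (h : HermitianMetric n L) {ψ φ : Π x, L x} {x₀ x : M}

theorem re_add_self {p : M} (u v : L p) :
    (h.toFun p (u + v) (u + v)).re
      = (h.toFun p u u).re + (h.toFun p v v).re + 2 * (h.toFun p u v).re := by
  have h1 : (h.toFun p v u).re = (h.toFun p u v).re := by
    rw [← h.conj_symm p u v, Complex.conj_re]
  simp only [map_add, LinearMap.add_apply, Complex.add_re, h1]
  ring

/-- Only the cross terms of `|∇_v ψ + i ∇_{iv} ψ|²` remain in the Weitzenböck density. -/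
theorem weitz_eq_cross (ψ : Π x, L x) (x : M) :
    weitz h ψ x = ∑ k, 2 * (h.toFun x (nab h ψ x (uFrame x k))
      (Complex.I • nab h ψ x (Complex.I • uFrame x k))).re - rho h x * hSq h ψ x := by
  rw [weitz, trace01_eq_sum, traceTM_eq_sum, Finset.mul_sum, ← Finset.sum_sub_distrib]
  congr 1
  refine Finset.sum_congr rfl fun k _ => ?_
  rw [re_add_self, hSq_smul, Complex.norm_I]
  ring

theorem re_ofReal_smul_left {p : M} (c : ℝ) (u v : L p) :
    (h.toFun p ((c : ℂ) • u) v).re = c * (h.toFun p u v).re := by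
  rw [map_smulₛₗ, LinearMap.smul_apply, smul_eq_mul, Complex.conj_ofReal, Complex.re_ofReal_mul]

theorem re_ofReal_smul_right {p : M} (c : ℝ) (u v : L p) :
    (h.toFun p u ((c : ℂ) • v)).re = c * (h.toFun p u v).re := by
  rw [map_smul, smul_eq_mul, Complex.re_ofReal_mul]

theorem re_self_I_smul {p : M} (u : L p) : (h.toFun p u (Complex.I • u)).re = 0 := by
  have h1 : (h.toFun p u u).im = 0 := Complex.conj_eq_iff_im.1 (h.conj_symm p u u)
  rw [map_smul, smul_eq_mul, Complex.I_mul_re, h1, neg_zero]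

theorem hSq_rsmul (χ : M → ℝ) (ψ : Π x, L x) (x : M) :
    hSq h (rsmul χ ψ) x = χ x ^ 2 * hSq h ψ x := by
  rw [hSq, rsmul, hSq_smul, Complex.norm_real, Real.norm_eq_abs, sq_abs]
  rfl

/-- If `∑ φᵢ² = 1`, then the Weitzenböck densities of the sections `φᵢ ψ` add up to that of `ψ`: in
the cross terms the derivatives enter only through `∑ φᵢ dφᵢ = 0`, since `Re h(ψ, i ψ) = 0`. -/
theorem sum_weitz_rsmul {ι : Type*} [Fintype ι] {φ : ι → M → ℝ}
    (h1 : ∀ i, ContMDiff 𝓘(ℝ, Cn n) 𝓘(ℝ, ℝ) ∞ (φ i)) (h2 : ∀ x, ∑ i, φ i x ^ 2 = 1)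
    [T2Space M] [SigmaCompactSpace M]
    (hψ : IsSmoothSection n ψ) (x : M) : ∑ i, weitz h (rsmul (φ i) ψ) x = weitz h ψ x := by
  simp only [weitz_eq_cross, Finset.sum_sub_distrib, hSq_rsmul]
  rw [Finset.sum_comm]
  congr 1
  · refine Finset.sum_congr rfl fun k _ => ?_
    set A := nab h ψ x (uFrame x k)
    set B := nab h ψ x (Complex.I • uFrame x k)
    have h3 : ∀ i, 2 * (h.toFun x (nab h (rsmul (φ i) ψ) x (uFrame x k))
        (Complex.I • nab h (rsmul (φ i) ψ) x (Complex.I • uFrame x k))).re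
        = φ i x ^ 2 * (2 * (h.toFun x A (Complex.I • B)).re)
          + (φ i x * dfun (φ i) x (Complex.I • uFrame x k))
            * (2 * (h.toFun x A (Complex.I • ψ x)).re)
          + (φ i x * dfun (φ i) x (uFrame x k)) * (2 * (h.toFun x (ψ x) (Complex.I • B)).re) := by
      intro i
      rw [nab_rsmul h (h1 i) hψ, nab_rsmul h (h1 i) hψ, smul_add, smul_comm Complex.I,
        smul_comm Complex.I]
      simp only [map_add, LinearMap.add_apply, Complex.add_re, re_ofReal_smul_left,
        re_ofReal_smul_right, re_self_I_smul]
      ring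
    simp only [h3, Finset.sum_add_distrib]
    rw [← Finset.sum_mul, ← Finset.sum_mul, ← Finset.sum_mul, h2,
      sum_mul_dfun_eq_zero h1 h2, sum_mul_dfun_eq_zero h1 h2]
    ring
  · rw [← Finset.mul_sum, ← Finset.sum_mul, h2, one_mul]

theorem nab_eq_zero (hx : ∀ᶠ p in 𝓝 x, ψ p = 0) (v : Cn n) : nab h ψ x v = 0 := by
  have h1 : nab h ψ x v = (fderiv ℝ (loc ψ x) (chartAt (Cn n) x x) v
      + connForm h x (chartAt (Cn n) x x) v * coord ψ x x) • frame L x x := rfl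
  have h0 : ∀ p ∈ bset n L x, ψ p = 0 → coord ψ x p = 0 := fun p hp h => by
    rw [coord_eq_linear _ hp.2, h, map_zero]
  have h2 : loc ψ x =ᶠ[𝓝 (chartAt (Cn n) x x)] fun _ => 0 := by
    have h3 := (chartAt (Cn n) x).symm.continuousAt (mem_chart_target (Cn n) x)
    rw [ContinuousAt] at h3
    have h4 : (chartAt (Cn n) x).symm (chartAt (Cn n) x x) = x :=
      (chartAt (Cn n) x).left_inv (mem_chart_source _ x)
    rw [h4] at h3
    filter_upwards [h3.eventually hx,
      (isOpen_bdom x).mem_nhds (chart_mem_bdom (mem_bset_self (L := L) (n := n) x))] with y hy hy'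
    exact h0 _ (chart_symm_mem_bset hy') hy
  rw [h1, h2.fderiv_eq, h0 x (mem_bset_self x) hx.self_of_nhds]
  simp

theorem eventually_eq_zero_of_notMem (hx : x ∉ closure {p | ψ p ≠ 0}) : ∀ᶠ p in 𝓝 x, ψ p = 0 := by
  filter_upwards [isClosed_closure.isOpen_compl.mem_nhds hx] with p hp
  by_contra h
  exact hp (subset_closure h)

theorem hSq_eq_zero (hx : ψ x = 0) : hSq h ψ x = 0 := by
  rw [hSq, hx, map_zero, Complex.zero_re]

theorem traceTM_eq_zero (hx : x ∉ closure {p | ψ p ≠ 0}) : traceTM h ψ x = 0 := by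
  rw [traceTM_eq_sum]
  simp [nab_eq_zero h (eventually_eq_zero_of_notMem hx)]

theorem trace01_eq_zero (hx : x ∉ closure {p | ψ p ≠ 0}) : trace01 h ψ x = 0 := by
  rw [trace01_eq_sum]
  simp [nab_eq_zero h (eventually_eq_zero_of_notMem hx)]

theorem weitz_eq_zero (hx : x ∉ closure {p | ψ p ≠ 0}) : weitz h ψ x = 0 := by
  rw [weitz, traceTM_eq_zero h hx, trace01_eq_zero h hx,
    hSq_eq_zero h (eventually_eq_zero_of_notMem hx).self_of_nhds]
  ring

/-- The one-form `Im h(ψ, ∇ψ)` in the chart at `x₀`, as a family of linear maps,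
extended by zero. -/
def gammaL (ψ : Π x, L x) (x₀ : M) (y : Cn n) : Cn n →ₗ[ℝ] ℝ :=
  open Classical in if y ∈ bdom n L x₀ then
    { toFun := locGamma h ψ x₀ y
      map_add' := fun v w => by simp only [locGamma, smul_add, map_add]; ring
      map_smul' := fun c v => by
        simp only [locGamma, smul_comm Complex.I c, map_smul, smul_eq_mul, RingHom.id_apply]; ring }
  else 0

theorem gammaL_apply {y : Cn n} (hy : y ∈ bdom n L x₀) (v : Cn n) :
    gammaL h ψ x₀ y v = locGamma h ψ x₀ y v := by
  rw [gammaL, if_pos hy]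
  rfl

theorem gammaL_eventuallyEq {y : Cn n} (hy : y ∈ bdom n L x₀) (v : Cn n) :
    (fun z => gammaL h ψ x₀ z v) =ᶠ[𝓝 y] fun z => locGamma h ψ x₀ z v := by
  filter_upwards [(isOpen_bdom x₀).mem_nhds hy] with z hz using gammaL_apply h hz v

theorem gammaL_eq_zero {y : Cn n} (hy : y ∈ bdom n L x₀ → ψ ((chartAt (Cn n) x₀).symm y) = 0) :
    gammaL h ψ x₀ y = 0 := by
  by_cases h1 : y ∈ bdom n L x₀
  · ext v
    have h2 : loc ψ x₀ y = 0 := by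
      rw [loc, coord_eq_linear _ h1.2, hy h1, map_zero]
    rw [gammaL_apply h h1]
    simp [locGamma, locRe, locIm, h2]
  · rw [gammaL, if_neg h1]

theorem contDiffAt_locGamma (hψ : IsSmoothSection n ψ) {y : Cn n} (hy : y ∈ bdom n L x₀)
    (v : Cn n) :
    ContDiffAt ℝ 1 (fun z => locGamma h ψ x₀ z v) y := by
  have hn := (isOpen_bdom x₀).mem_nhds hy
  have hl := hψ.contDiffAt_loc hy
  have hre : ContDiffAt ℝ ∞ (locRe ψ x₀) y := Complex.reCLM.contDiff.contDiffAt.comp y hl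
  have him : ContDiffAt ℝ ∞ (locIm ψ x₀) y := Complex.imCLM.contDiff.contDiffAt.comp y hl
  have hφ : ContDiffAt ℝ ∞ (logH h x₀) y := (contDiffOn_logH h x₀).contDiffAt hn
  have hH : ContDiffAt ℝ ∞ (hFrame h x₀) y := (contDiffOn_hFrame h x₀).contDiffAt hn
  have hd : ∀ {u : Cn n → ℝ}, ContDiffAt ℝ ∞ u y → ∀ w, ContDiffAt ℝ 1
      (fun z => fderiv ℝ u z w) y :=
    fun hu w => (hu.fderiv_right (m := 1)
      (by rw [one_add_one_eq_two]; exact ENat.LEInfty.out)).clm_apply contDiffAt_const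
  have l : (1 : WithTop ℕ∞) ≤ ∞ := by exact ENat.LEInfty.out
  exact ((hH.of_le l).mul (((hre.of_le l).mul (hd him v)).sub ((him.of_le l).mul (hd hre v)))).sub
    (contDiffAt_const.mul (((hH.of_le l).mul (((hre.of_le l).pow 2).add ((him.of_le l).pow 2))).mul
      (hd hφ _)))

/-- The Weitzenböck density is a multiple of the contraction of `dγ` with the fundamental two-form,
where `γ = Im h(ψ, ∇ψ)`. -/
theorem weitz_eq_trG (hK : IsKahler n M) (hψ : IsSmoothSection n ψ) (hx : x ∈ bset n L x₀) :
    weitz h ψ x = -2⁻¹ * trG (gC x₀ (chartAt (Cn n) x₀ x)) (fun v w =>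
      fderiv ℝ (fun z => gammaL h ψ x₀ z (Complex.I • w)) (chartAt (Cn n) x₀ x) v
      - fderiv ℝ (fun z => gammaL h ψ x₀ z v) (chartAt (Cn n) x₀ x) (Complex.I • w)) := by
  set y := chartAt (Cn n) x₀ x with hy
  have hyb : y ∈ bdom n L x₀ := chart_mem_bdom hx
  have hγ : ∀ v, DifferentiableAt ℝ (fun z => gammaL h ψ x₀ z v) y := fun v =>
    ((contDiffAt_locGamma h hψ hyb v).congr_of_eventuallyEq
      (gammaL_eventuallyEq h hyb v)).differentiableAt (by simp)
  obtain ⟨dg, hdg⟩ : ∃ dg : Cn n → Cn n →L[ℝ] ℝ,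
      ∀ w, fderiv ℝ (fun z => gammaL h ψ x₀ z w) y = dg w := ⟨_, fun _ => rfl⟩
  have hadd : ∀ v w, dg (v + w) = dg v + dg w := by
    intro v w
    rw [← hdg, ← hdg, ← hdg]
    simp only [map_add]
    exact fderiv_fun_add (hγ v) (hγ w)
  have hsmul : ∀ (c : ℝ) v, dg (c • v) = c • dg v := by
    intro c v
    rw [← hdg, ← hdg]
    simp only [map_smul]
    exact fderiv_fun_const_smul (hγ v) c
  have hneg : ∀ v, dg (-v) = -dg v := fun v => by
    have h0 := hsmul (-1) v
    rw [neg_one_smul] at h0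
    rw [h0]
    ext w
    rw [FunLike.coe_smul, Pi.smul_apply, neg_apply, smul_eq_mul, neg_one_mul]
  have hII : ∀ v : Cn n, Complex.I • Complex.I • v = -v := fun v => by
    rw [smul_smul, Complex.I_mul_I, neg_one_smul]
  have h1 := sum_frameAt_eq_trG hK hx.1 (LinearMap.mk₂ ℝ (fun v w =>
      dg (Complex.I • w) v - dg v (Complex.I • w))
    (fun v v' w => by simp only [map_add, hadd, add_apply]; ring)
    (fun c v w => by
      simp only [map_smul, hsmul, FunLike.coe_smul, Pi.smul_apply, smul_eq_mul]; ring)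
    (fun v w w' => by simp only [smul_add, map_add, hadd, add_apply]; ring)
    (fun c v w => by
      simp only [smul_comm Complex.I c, map_smul, hsmul, FunLike.coe_smul, Pi.smul_apply,
        smul_eq_mul]; ring))
  rw [← hy] at h1
  simp only [LinearMap.mk₂_apply] at h1
  simp only [hdg]
  rw [← h1, weitz_eq_sum h hx ((hψ.contDiffAt_loc hyb).of_le (by exact ENat.LEInfty.out)),
    Finset.mul_sum, ← Finset.sum_neg_distrib]
  refine Finset.sum_congr rfl fun k _ => ?_
  rw [hII, hneg, map_neg, neg_apply, ← hy, ← (gammaL_eventuallyEq h hyb _).fderiv_eq,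
    ← (gammaL_eventuallyEq h hyb _).fderiv_eq, hdg, hdg]
  ring

variable [IsContMDiffRiemannianBundle 𝓘(ℝ, Cn n) ∞ (Cn n)
      (fun x : M => TangentSpace 𝓘(ℝ, Cn n) x)] [MeasurableSpace M] [BorelSpace M]

theorem IsSmoothSection.continuous_weitz (hK : IsKahler n M) (hψ : IsSmoothSection n ψ) :
    Continuous (weitz h ψ) :=
  ((continuous_const.mul (hψ.continuous_trace01 h hK)).sub (hψ.continuous_traceTM h hK)).sub
    ((continuous_rho h hK).mul (hψ.continuous_hSq h))

/-- The Weitzenböck density of a section that is supported in a chart is a divergence. -/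
theorem integral_weitz_eq_zero_of_subset [T2Space M] (hK : IsKahler n M) (hψ : IsTestSection n ψ)
    (hsub : closure {p | ψ p ≠ 0} ⊆ bset n L x₀) : ∫ x, weitz h ψ x ∂volMeasure n M = 0 := by
  have hs : IsSmoothSection n ψ := hψ.1
  have h1 : ∫ x, weitz h ψ x ∂volMeasure n M
      = ∫ x in (chartAt (Cn n) x₀).source, weitz h ψ x ∂volMeasure n M := by
    refine (setIntegral_eq_integral_of_forall_compl_eq_zero fun x hx => ?_).symm
    exact weitz_eq_zero h fun h' => hx (hsub h').1
  set K := chartAt (Cn n) x₀ '' closure {p | ψ p ≠ 0} with hKdef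
  have hKc : IsCompact K := hψ.2.image_of_continuousOn
    ((chartAt (Cn n) x₀).continuousOn.mono fun p hp => (hsub hp).1)
  have hKb : K ⊆ bdom n L x₀ := by
    rintro _ ⟨p, hp, rfl⟩
    exact chart_mem_bdom (hsub hp)
  have hγ0 : ∀ y ∉ K, gammaL h ψ x₀ y = 0 := by
    refine fun y hy => gammaL_eq_zero h fun hyb => ?_
    by_contra h2
    exact hy ⟨_, subset_closure h2, (chartAt (Cn n) x₀).right_inv hyb.1⟩
  have hγ : ∀ v, ContDiff ℝ 1 fun y => gammaL h ψ x₀ y v := by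
    refine fun v => contDiff_iff_contDiffAt.2 fun y => ?_
    by_cases hy : y ∈ K
    · exact (contDiffAt_locGamma h hs (hKb hy) v).congr_of_eventuallyEq
        (gammaL_eventuallyEq h (hKb hy) v)
    · refine contDiffAt_const (c := 0) |>.congr_of_eventuallyEq ?_
      filter_upwards [hKc.isClosed.isOpen_compl.mem_nhds hy] with z hz
      rw [hγ0 z hz, LinearMap.zero_apply]
  have h2 := (isKahlerOn_gC hK x₀).integral_trG_eq_zero hKc (hKb.trans inter_subset_left) hγ hγ0
  have hd0 : ∀ v, ∀ y ∉ K, fderiv ℝ (fun z => gammaL h ψ x₀ z v) y = 0 := by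
    intro v y hy
    have : (fun z => gammaL h ψ x₀ z v) =ᶠ[𝓝 y] fun _ => 0 := by
      filter_upwards [hKc.isClosed.isOpen_compl.mem_nhds hy] with z hz
      rw [hγ0 z hz, LinearMap.zero_apply]
    rw [this.fderiv_eq]
    simp
  rw [h1, setIntegral_chart hK x₀ (hs.continuous_weitz h hK).aestronglyMeasurable]
  have h3 : ∀ y ∈ (chartAt (Cn n) x₀).target, weitz h ψ ((chartAt (Cn n) x₀).symm y)
      * volDensity x₀ y
      = -2⁻¹ * (trG (gC x₀ y) (fun v w => fderiv ℝ (fun z => gammaL h ψ x₀ z (Complex.I • w)) y v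
      - fderiv ℝ (fun z => gammaL h ψ x₀ z v) y (Complex.I • w)) * √(gram (gC x₀ y)).det) := by
    intro y hy
    by_cases hyb : y ∈ bdom n L x₀
    · rw [weitz_eq_trG h hK hs (chart_symm_mem_bset hyb), (chartAt (Cn n) x₀).right_inv hy,
        volDensity_eq]
      ring
    · have hyK : y ∉ K := fun h' => hyb (hKb h')
      rw [weitz_eq_zero h fun h' => hyK ⟨_, h', (chartAt (Cn n) x₀).right_inv hy⟩]
      simp [hd0 _ y hyK, trG]
  rw [setIntegral_congr_fun (chartAt (Cn n) x₀).open_target.measurableSet h3,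
    setIntegral_eq_integral_of_forall_compl_eq_zero, integral_const_mul, h2, mul_zero]
  intro y hy
  have hyK : y ∉ K := fun h' => hy (hKb h').1
  simp [hd0 _ y hyK, trG]

theorem closure_rsmul_subset (χ : M → ℝ) (ψ : Π x, L x) :
    closure {p | rsmul χ ψ p ≠ 0} ⊆ tsupport χ ∩ closure {p | ψ p ≠ 0} := by
  refine subset_inter (closure_mono fun p hp => ?_) (closure_mono fun p hp => ?_)
  · exact fun h0 => hp (by simp [rsmul, h0])
  · exact fun h0 => hp (by simp [rsmul, h0])

theorem IsTestSection.rsmul {χ : M → ℝ} (hχ : ContMDiff 𝓘(ℝ, Cn n) 𝓘(ℝ, ℝ) ∞ χ)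
    (hψ : IsTestSection n ψ) : IsTestSection n (rsmul χ ψ) :=
  ⟨IsSmoothSection.rsmul hχ hψ.1, hψ.2.of_isClosed_subset isClosed_closure
    ((closure_rsmul_subset χ ψ).trans inter_subset_right)⟩

theorem integrable_of_continuous_of_closure (hK : IsKahler n M) [T2Space M]
    {F : M → ℝ} (hF : Continuous F)
    (hψ : IsCompact (closure {p | ψ p ≠ 0})) (hF0 : ∀ x ∉ closure {p | ψ p ≠ 0}, F x = 0) :
    Integrable F (volMeasure n M) := by
  have := isLocallyFiniteMeasure_volMeasure hK
  exact hF.integrable_of_hasCompactSupport (HasCompactSupport.intro hψ hF0)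

/-- The integral of the Weitzenböck density vanishes: `integral_weitz_eq_zero_of_subset` applies to
the pieces `φᵢ ψ` for a partition of unity with `∑ φᵢ² = 1`. -/
theorem IsTestSection.integral_weitz_eq_zero [T2Space M] [SigmaCompactSpace M] (hK : IsKahler n M)
    (hψ : IsTestSection n ψ) : ∫ x, weitz h ψ x ∂volMeasure n M = 0 := by
  obtain ⟨t, φ, h1, h2, h3, h4⟩ := exists_partition_sq (n := n) hψ.2 (bset n L) isOpen_bset
    mem_bset_self
  have ht : ∀ i, IsTestSection n (BerezinToeplitz.rsmul (φ i) ψ) := fun i => hψ.rsmul (h1 i)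
  simp_rw [← sum_weitz_rsmul h h1 h2 hψ.1]
  rw [integral_finsetSum _ fun i _ => integrable_of_continuous_of_closure hK
    (IsSmoothSection.continuous_weitz h hK (ht i).1) (ht i).2 fun x hx => weitz_eq_zero h hx]
  refine Finset.sum_eq_zero fun i _ => ?_
  cases i with
  | none =>
    have h5 : closure {p | BerezinToeplitz.rsmul (φ none) ψ p ≠ 0} = ∅ := by
      refine subset_empty_iff.1 fun x hx => ?_
      have := closure_rsmul_subset _ _ hx
      exact h4 this.1 this.2
    simp [weitz_eq_zero h, h5]
  | some i =>
    exact integral_weitz_eq_zero_of_subset h hK (ht _)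
      ((closure_rsmul_subset _ _).trans (inter_subset_left.trans (h3 i)))

end WeitzenbockIntegral

/-! ### The Hopf–Rinow theorem -/

section HopfRinow

variable {X : Type*} [MetricSpace X]

/-- A complete locally compact metric space in which intermediate points exist approximately is
proper (the theorem of Hopf–Rinow and Cohn-Vossen). -/
theorem isCompact_closedBall_of_length_space [CompleteSpace X] [LocallyCompactSpace X]
    (hX : ∀ (x y : X) (a b : ℝ), 0 < a → 0 < b → dist x y < a + b →
      ∃ z, dist x z < a ∧ dist z y < b)
    (x : X) (r : ℝ) : IsCompact (Metric.closedBall x r) := by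
  -- the set of radii of compact balls is open ...
  have hopen : ∀ s : ℝ, 0 ≤ s → IsCompact (Metric.closedBall x s) →
      ∃ ε > 0, IsCompact (Metric.closedBall x (s + ε)) := by
    intro s hs hc
    obtain ⟨K, hK, hsK⟩ := exists_compact_superset hc
    obtain ⟨δ, hδ, hδK⟩ := hc.exists_thickening_subset_open isOpen_interior hsK
    refine ⟨δ / 4, by positivity, hK.of_isClosed_subset Metric.isClosed_closedBall fun y hy => ?_⟩
    refine interior_subset (hδK ?_)
    rw [Metric.mem_closedBall'] at hy
    obtain ⟨z, hz1, hz2⟩ := hX x y (s + δ / 4) (δ / 4) (by positivity) (by positivity) (by linarith)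
    rcases hs.eq_or_lt with h0 | h0
    · refine Metric.mem_thickening_iff.2 ⟨x, Metric.mem_closedBall_self hs, ?_⟩
      rw [dist_comm]
      linarith
    · obtain ⟨w, hw1, hw2⟩ := hX x y s (δ / 2) h0 (by positivity) (by linarith)
      refine Metric.mem_thickening_iff.2 ⟨w, Metric.mem_closedBall'.2 hw1.le, ?_⟩
      rw [dist_comm]
      linarith
  -- ... and closed
  have hclosed : ∀ s : ℝ, 0 < s → (∀ t < s, IsCompact (Metric.closedBall x t)) →
      IsCompact (Metric.closedBall x s) := by
    intro s hs hc
    refine isCompact_iff_totallyBounded_isComplete.2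
      ⟨?_, Metric.isClosed_closedBall.isComplete⟩
    refine Metric.totallyBounded_iff.2 fun ε hε => ?_
    set δ := min (ε / 4) (s / 2) with hδ
    have hδ0 : 0 < δ := lt_min (by positivity) (by positivity)
    have hδs : δ ≤ s / 2 := min_le_right _ _
    have hδε : δ ≤ ε / 4 := min_le_left _ _
    obtain ⟨t, ht, htc⟩ := Metric.totallyBounded_iff.1 (hc (s - δ) (by linarith)).totallyBounded
      (ε / 4) (by positivity)
    refine ⟨t, ht, fun y hy => ?_⟩
    rw [Metric.mem_closedBall'] at hy
    obtain ⟨z, hz1, hz2⟩ := hX x y (s - δ) (2 * δ) (by linarith) (by linarith) (by linarith)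
    obtain ⟨p, hp, hzp⟩ := mem_iUnion₂.1 (htc (Metric.mem_closedBall'.2 hz1.le))
    refine mem_iUnion₂.2 ⟨p, hp, ?_⟩
    rw [Metric.mem_ball] at hzp ⊢
    have := dist_triangle y z p
    rw [dist_comm y z] at this
    linarith
  by_contra hr
  have hr0 : 0 ≤ r := by
    by_contra h
    exact hr (by rw [Metric.closedBall_eq_empty.2 (not_le.1 h)]; exact isCompact_empty)
  set S := {s : ℝ | 0 ≤ s ∧ IsCompact (Metric.closedBall x s)} with hS
  have h0 : (0 : ℝ) ∈ S := ⟨le_rfl, by simp⟩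
  have hmono : ∀ s t : ℝ, s ≤ t → IsCompact (Metric.closedBall x t) →
      IsCompact (Metric.closedBall x s) := fun s t hst ht =>
    ht.of_isClosed_subset Metric.isClosed_closedBall (Metric.closedBall_subset_closedBall hst)
  have hbdd : BddAbove S := ⟨r, fun s hs => by
    by_contra h
    exact hr (hmono r s (not_le.1 h).le hs.2)⟩
  have hR0 : 0 ≤ sSup S := le_csSup hbdd h0
  have hRS : IsCompact (Metric.closedBall x (sSup S)) := by
    rcases hR0.eq_or_lt with h1 | h1
    · rw [← h1]
      exact h0.2
    · refine hclosed _ h1 fun t ht => ?_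
      obtain ⟨s, hs, hts⟩ := exists_lt_of_lt_csSup ⟨0, h0⟩ ht
      exact hmono t s hts.le hs.2
  obtain ⟨ε, hε, hc⟩ := hopen _ hR0 hRS
  have := le_csSup hbdd (show sSup S + ε ∈ S from ⟨by linarith, hc⟩)
  linarith

end HopfRinow

/-! ### The Riemannian distance -/

section RiemannianDistance

variable {n : ℕ} {M : Type*} [MetricSpace M] [ChartedSpace (Cn n) M]
  [IsManifold 𝓘(ℂ, Cn n) ω M]
  [RiemannianBundle (fun x : M => TangentSpace 𝓘(ℝ, Cn n) x)]
  [IsRiemannianManifold 𝓘(ℝ, Cn n) M]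

/-- Approximate intermediate points lie on almost length-minimizing curves. -/
theorem exists_dist_lt_dist_lt (n : ℕ) {M : Type*} [MetricSpace M] [ChartedSpace (Cn n) M]
    [RiemannianBundle (fun x : M => TangentSpace 𝓘(ℝ, Cn n) x)]
    [IsRiemannianManifold 𝓘(ℝ, Cn n) M]
    (x y : M) (a b : ℝ) (ha : 0 < a) (hb : 0 < b)
    (hxy : dist x y < a + b) : ∃ z, dist x z < a ∧ dist z y < b := by
  rcases lt_or_ge (dist x y) a with h1 | h1
  · exact ⟨y, h1, by simpa using hb⟩
  have h2 : Manifold.riemannianEDist 𝓘(ℝ, Cn n) x y < ENNReal.ofReal (a + b) := by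
    rw [← IsRiemannianManifold.out (I := 𝓘(ℝ, Cn n)), edist_dist]
    exact (ENNReal.ofReal_lt_ofReal_iff (by linarith)).2 hxy
  obtain ⟨γ, h3, h4, h5, h6⟩ := Manifold.exists_lt_of_riemannianEDist_lt h2
  set ℓ := (Manifold.pathELength 𝓘(ℝ, Cn n) γ 0 1).toReal with hℓ
  have hℓt : Manifold.pathELength 𝓘(ℝ, Cn n) γ 0 1 ≠ ⊤ := h6.ne_top
  have hℓ2 : ℓ < a + b := by
    rw [hℓ]
    exact (ENNReal.lt_ofReal_iff_toReal_lt hℓt).1 h6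
  obtain ⟨a', ha1, ha2⟩ := exists_between (show max 0 (ℓ - b) < a from max_lt ha (by linarith))
  have hcont : ContinuousOn (fun t => dist x (γ t)) (Icc 0 1) :=
    (continuous_const.dist continuous_id).comp_continuousOn h5.continuousOn
  obtain ⟨t, ht, hta⟩ := intermediate_value_Icc zero_le_one hcont
    (show a' ∈ Icc (dist x (γ 0)) (dist x (γ 1)) from
      ⟨by rw [h3, dist_self]; exact (le_max_left _ _).trans ha1.le, by rw [h4]; linarith⟩)
  have h7 : edist x (γ t) ≤ Manifold.pathELength 𝓘(ℝ, Cn n) γ 0 t := by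
    rw [IsRiemannianManifold.out (I := 𝓘(ℝ, Cn n))]
    exact Manifold.riemannianEDist_le_pathELength (h5.mono (Icc_subset_Icc_right ht.2)) h3 rfl ht.1
  have h8 : edist (γ t) y ≤ Manifold.pathELength 𝓘(ℝ, Cn n) γ t 1 := by
    rw [IsRiemannianManifold.out (I := 𝓘(ℝ, Cn n))]
    exact Manifold.riemannianEDist_le_pathELength (h5.mono (Icc_subset_Icc_left ht.1)) rfl h4 ht.2
  have h9 : edist x (γ t) + edist (γ t) y ≤ Manifold.pathELength 𝓘(ℝ, Cn n) γ 0 1 :=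
    (add_le_add h7 h8).trans (Manifold.pathELength_add ht.1 ht.2).le
  have h10 : dist x (γ t) + dist (γ t) y ≤ ℓ := by
    rw [dist_edist, dist_edist, ← ENNReal.toReal_add (edist_ne_top _ _) (edist_ne_top _ _)]
    exact ENNReal.toReal_mono hℓt h9
  refine ⟨γ t, by linarith [show dist x (γ t) = a' from hta], ?_⟩
  have : dist x (γ t) = a' := hta
  have := (le_max_right 0 (ℓ - b)).trans_lt ha1
  linarith

theorem isCompact_closedBall_of_complete (n : ℕ) {M : Type*} [MetricSpace M] [ChartedSpace (Cn n) M]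
    [RiemannianBundle (fun x : M => TangentSpace 𝓘(ℝ, Cn n) x)]
    [IsRiemannianManifold 𝓘(ℝ, Cn n) M]
    [CompleteSpace M] (x : M) (r : ℝ) :
    IsCompact (Metric.closedBall x r) := by
  have : LocallyCompactSpace M := ChartedSpace.locallyCompactSpace (Cn n) M
  exact isCompact_closedBall_of_length_space (exists_dist_lt_dist_lt n) x r

theorem enorm_coordVec (x₀ : M) (y v : Cn n) :
    ‖coordVec x₀ y v‖ₑ = ENNReal.ofReal √(gC x₀ y v v) := by
  rw [← ofReal_norm, norm_eq_sqrt_real_inner]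
  rfl

/-- The length of a coordinate segment bounds the distance of its end points. -/
theorem dist_chart_symm_le {x₀ : M} {y w : Cn n} {c : ℝ} (hc : 0 ≤ c)
    (hy : ∀ t ∈ Icc (0 : ℝ) 1, y + t • w ∈ (chartAt (Cn n) x₀).target ∧
      √(gC x₀ (y + t • w) w w) ≤ c) :
    dist ((chartAt (Cn n) x₀).symm y) ((chartAt (Cn n) x₀).symm (y + w)) ≤ c := by
  set γ : ℝ → M := fun t => (chartAt (Cn n) x₀).symm (y + t • w) with hγ
  have hl : ContMDiff 𝓘(ℝ, ℝ) 𝓘(ℝ, Cn n) 1 fun t : ℝ => y + t • w :=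
    (contDiff_const.add (contDiff_id.smul contDiff_const)).contMDiff
  have h1 : ContMDiffOn 𝓘(ℝ, ℝ) 𝓘(ℝ, Cn n) 1 γ (Icc 0 1) :=
    ((contMDiffOn_chart_symm (I := 𝓘(ℝ, Cn n)) (n := ω) (x := x₀)).of_le le_top).comp
      hl.contMDiffOn fun t ht => (hy t ht).1
  have h2 : edist ((chartAt (Cn n) x₀).symm y) ((chartAt (Cn n) x₀).symm (y + w))
      ≤ Manifold.pathELength 𝓘(ℝ, Cn n) γ 0 1 := by
    rw [IsRiemannianManifold.out (I := 𝓘(ℝ, Cn n))]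
    exact Manifold.riemannianEDist_le_pathELength h1 (by simp [hγ]) (by simp [hγ]) zero_le_one
  have h3 : Manifold.pathELength 𝓘(ℝ, Cn n) γ 0 1 ≤ ENNReal.ofReal c := by
    rw [Manifold.pathELength_eq_lintegral_mfderiv_Icc]
    calc _ ≤ ∫⁻ t in Icc (0 : ℝ) 1, ENNReal.ofReal c := by
          refine setLIntegral_mono' measurableSet_Icc fun t ht => ?_
          have h4 : HasMFDerivAt 𝓘(ℝ, ℝ) 𝓘(ℝ, Cn n) (fun t : ℝ => y + t • w) t
              (ContinuousLinearMap.smulRight (1 : ℝ →L[ℝ] ℝ) w) := by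
            refine HasFDerivAt.hasMFDerivAt ?_
            exact (ContinuousLinearMap.smulRight (1 : ℝ →L[ℝ] ℝ) w).hasFDerivAt.const_add y
          have h5 := (mdifferentiableAt_chart_symm (hy t ht).1).hasMFDerivAt
          have h6 := h5.comp t h4
          have h7 : mfderiv 𝓘(ℝ, ℝ) 𝓘(ℝ, Cn n) γ t 1 = coordVec x₀ (y + t • w) w := by
            have h8 := h6.mfderiv
            have h9 : mfderiv 𝓘(ℝ, ℝ) 𝓘(ℝ, Cn n) γ t = _ := h8
            rw [h9]
            change mfderiv 𝓘(ℝ, Cn n) 𝓘(ℝ, Cn n) (chartAt (Cn n) x₀).symm (y + t • w)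
              (ContinuousLinearMap.smulRight (1 : ℝ →L[ℝ] ℝ) w (1 : ℝ)) = _
            rw [ContinuousLinearMap.smulRight_apply, one_apply_eq_self, one_smul]
            rfl
          rw [h7]
          exact (enorm_coordVec x₀ _ w).trans_le (ENNReal.ofReal_le_ofReal (hy t ht).2)
      _ = ENNReal.ofReal c := by simp
  have h4 := h2.trans h3
  rw [edist_dist] at h4
  exact (ENNReal.ofReal_le_ofReal_iff hc).1 h4

end RiemannianDistance

/-! ### Mollification with gradient bounds -/

section Mollification

variable {n : ℕ} {M : Type*} [MetricSpace M] [ChartedSpace (Cn n) M]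
  [IsManifold 𝓘(ℂ, Cn n) ω M]
  [RiemannianBundle (fun x : M => TangentSpace 𝓘(ℝ, Cn n) x)]
  [IsContMDiffRiemannianBundle 𝓘(ℝ, Cn n) ∞ (Cn n)
      (fun x : M => TangentSpace 𝓘(ℝ, Cn n) x)] {x₀ : M} {Q : Set (Cn n)}

theorem continuousOn_gC_prod (x₀ : M) :
    ContinuousOn (fun p : Cn n × Cn n => gC x₀ p.1 p.2 p.2)
      ((chartAt (Cn n) x₀).target ×ˢ univ) := by
  have h1 : ∀ v : Cn n, ∀ i, (realBasisB n).repr v i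
      = LinearMap.toContinuousLinearMap ((realBasisB n).coord i) v := fun v i => rfl
  have h2 : (fun p : Cn n × Cn n => gC x₀ p.1 p.2 p.2) = fun p => ∑ i, ∑ j,
      (realBasisB n).repr p.2 i * (realBasisB n).repr p.2 j *
        gC x₀ p.1 (realBasis n i) (realBasis n j) := funext fun p => bilin_eq_sum _ _ _
  rw [h2]
  simp only [h1]
  refine continuousOn_finsetSum _ fun i _ => continuousOn_finsetSum _ fun j _ => ?_
  refine ContinuousOn.mul ?_ ((contDiffOn_gC x₀ _ _).continuousOn.comp continuousOn_fst
    fun p hp => hp.1)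
  exact Continuous.continuousOn (by fun_prop)

/-- On a compact set the Riemannian metric dominates a multiple of the Euclidean metric. -/
theorem exists_pos_mul_norm_sq_le (hK : IsKahler n M) (hQ : IsCompact Q)
    (hQt : Q ⊆ (chartAt (Cn n) x₀).target) :
    ∃ m > 0, ∀ y ∈ Q, ∀ v, m * ‖v‖ ^ 2 ≤ gC x₀ y v v := by
  have hpos : ∀ p ∈ Q ×ˢ Metric.sphere (0 : Cn n) 1, 0 < gC x₀ p.1 p.2 p.2 := by
    intro p hp
    refine (isHermitianForm_gC hK (hQt hp.1)).pos _ fun h0 => ?_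
    have := mem_sphere_zero_iff_norm.1 hp.2
    rw [h0, norm_zero] at this
    exact zero_ne_one this
  obtain ⟨C, hC⟩ := (hQ.prod (isCompact_sphere (0 : Cn n) 1)).exists_bound_of_continuousOn
    (((continuousOn_gC_prod x₀).mono (prod_mono hQt (subset_univ _))).inv₀
      fun p hp => (hpos p hp).ne')
  refine ⟨(max C 1)⁻¹, by positivity, fun y hy v => ?_⟩
  rcases eq_or_ne v 0 with rfl | hv
  · simp
  have hv0 : 0 < ‖v‖ := norm_pos_iff.2 hv
  have hs : (y, ‖v‖⁻¹ • v) ∈ Q ×ˢ Metric.sphere (0 : Cn n) 1 := by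
    refine ⟨hy, ?_⟩
    rw [mem_sphere_zero_iff_norm, norm_smul, norm_inv, norm_norm, inv_mul_cancel₀ hv0.ne']
  have h1 := hC _ hs
  have h2 := hpos _ hs
  rw [Pi.inv_apply, norm_inv, Real.norm_eq_abs, abs_of_pos h2] at h1
  have h3 : (max C 1)⁻¹ ≤ gC x₀ y (‖v‖⁻¹ • v) (‖v‖⁻¹ • v) :=
    inv_le_of_inv_le₀ h2 (h1.trans (le_max_left _ _))
  simp only [map_smul, LinearMap.smul_apply, smul_eq_mul] at h3
  calc (max C 1)⁻¹ * ‖v‖ ^ 2 ≤ (‖v‖⁻¹ * (‖v‖⁻¹ * gC x₀ y v v)) * ‖v‖ ^ 2 :=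
        mul_le_mul_of_nonneg_right h3 (sq_nonneg _)
    _ = gC x₀ y v v := by field_simp

/-- Near a compact set the metric varies by a factor of at most four on a uniform scale. -/
theorem exists_uniform_metric (hK : IsKahler n M) (hQ : IsCompact Q)
    (hQt : Q ⊆ (chartAt (Cn n) x₀).target) :
    ∃ r > 0, Metric.cthickening r Q ⊆ (chartAt (Cn n) x₀).target ∧
      ∀ y ∈ Q, ∀ z, dist z y ≤ r → ∀ v, gC x₀ z v v ≤ 4 * gC x₀ y v v := by
  obtain ⟨δ, hδ, hδt⟩ := hQ.exists_cthickening_subset_open (chartAt (Cn n) x₀).open_target hQt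
  have hc : IsCompact (Metric.cthickening δ Q) := hQ.cthickening
  obtain ⟨m, hm, hmv⟩ := exists_pos_mul_norm_sq_le hK hQ hQt
  have hu := (hc.prod (isCompact_sphere (0 : Cn n) 1)).uniformContinuousOn_of_continuous
    ((continuousOn_gC_prod x₀).mono (prod_mono hδt (subset_univ _)))
  obtain ⟨ε, hε, hεu⟩ := Metric.uniformContinuousOn_iff.1 hu (3 * m) (by positivity)
  refine ⟨min δ (ε / 2), by positivity,
    (Metric.cthickening_mono (min_le_left _ _) _).trans hδt, fun y hy z hz v => ?_⟩
  have hy' : y ∈ Metric.cthickening δ Q := Metric.self_subset_cthickening Q hy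
  have hz' : z ∈ Metric.cthickening δ Q :=
    Metric.mem_cthickening_of_dist_le z y δ Q hy (hz.trans (min_le_left _ _))
  rcases eq_or_ne v 0 with rfl | hv
  · simp
  have hv0 : 0 < ‖v‖ := norm_pos_iff.2 hv
  have hs : ‖v‖⁻¹ • v ∈ Metric.sphere (0 : Cn n) 1 := by
    rw [mem_sphere_zero_iff_norm, norm_smul, norm_inv, norm_norm, inv_mul_cancel₀ hv0.ne']
  have h1 := hεu (z, ‖v‖⁻¹ • v) ⟨hz', hs⟩ (y, ‖v‖⁻¹ • v) ⟨hy', hs⟩ (by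
    rw [Prod.dist_eq, dist_self, max_eq_left dist_nonneg]
    have := hz.trans (min_le_right δ (ε / 2))
    linarith)
  rw [Real.dist_eq] at h1
  have h2 := (le_abs_self _).trans h1.le
  simp only [map_smul, LinearMap.smul_apply, smul_eq_mul] at h2
  have h3 : gC x₀ z v v - gC x₀ y v v ≤ 3 * m * ‖v‖ ^ 2 := by
    calc gC x₀ z v v - gC x₀ y v v
        = (‖v‖⁻¹ * (‖v‖⁻¹ * gC x₀ z v v) - ‖v‖⁻¹ * (‖v‖⁻¹ * gC x₀ y v v)) * ‖v‖ ^ 2 := by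
          field_simp
      _ ≤ 3 * m * ‖v‖ ^ 2 := mul_le_mul_of_nonneg_right h2 (sq_nonneg _)
  have h4 := hmv y hy v
  nlinarith

/-- A function whose increments near `y` in the direction `v` are at most `c |t|` has a derivative
of size at most `c` in this direction. -/
theorem abs_fderiv_le_of_lip {E : Type*} [NormedAddCommGroup E] [NormedSpace ℝ E] {w : E → ℝ}
    {y v : E} {c : ℝ} (hc : 0 ≤ c) (hw : DifferentiableAt ℝ w y)
    (h : ∀ᶠ t : ℝ in 𝓝 0, |w (y + t • v) - w y| ≤ c * |t|) : |fderiv ℝ w y v| ≤ c := by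
  have h0 : y + (0 : ℝ) • v = y := by simp
  have h1 : HasFDerivAt (fun t : ℝ => y + t • v)
      (ContinuousLinearMap.smulRight (1 : ℝ →L[ℝ] ℝ) v) 0 :=
    (ContinuousLinearMap.smulRight (1 : ℝ →L[ℝ] ℝ) v).hasFDerivAt.const_add y
  have h2 : HasFDerivAt w (fderiv ℝ w y) (y + (0 : ℝ) • v) := by
    rw [h0]
    exact hw.hasFDerivAt
  have h3 := (h2.comp (0 : ℝ) h1).le_of_lip' hc (by
    filter_upwards [h] with t ht
    simpa using ht)
  have h4 := ContinuousLinearMap.le_opNorm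
    ((fderiv ℝ w y).comp (ContinuousLinearMap.smulRight (1 : ℝ →L[ℝ] ℝ) v)) 1
  simp only [ContinuousLinearMap.comp_apply, ContinuousLinearMap.smulRight_apply,
    one_apply_eq_self, one_smul, norm_one, mul_one, Real.norm_eq_abs] at h4
  exact h4.trans h3

variable [IsRiemannianManifold 𝓘(ℝ, Cn n) M]

/-- Mollification of a Lipschitz function in a chart: the gradient is controlled with respect to
the Riemannian metric. The factor `2` is the square root of the factor `4` by which the metric may
vary within the support of the mollifier. -/
theorem exists_mollification (hK : IsKahler n M) (hQ : IsCompact Q)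
    (hQt : Q ⊆ (chartAt (Cn n) x₀).target) {η : M → ℝ} {Λ : ℝ} (hΛ : 0 ≤ Λ)
    (hη : ∀ p q, |η p - η q| ≤ Λ * dist p q) {δ : ℝ} (hδ : 0 < δ) :
    ∃ w : Cn n → ℝ, ContDiff ℝ ∞ w ∧ ∀ y ∈ Q, |w y - η ((chartAt (Cn n) x₀).symm y)| ≤ δ ∧
      ∀ v, |fderiv ℝ w y v| ≤ 2 * Λ * √(gC x₀ y v v) := by
  obtain ⟨r, hr, hrt, hrv⟩ := exists_uniform_metric hK hQ hQt
  set Q' := Metric.cthickening r Q with hQ'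
  have hQ'c : IsCompact Q' := hQ.cthickening
  have hηc : Continuous η := by
    refine (LipschitzWith.of_dist_le_mul (K := Λ.toNNReal) fun p q => ?_).continuous
    rw [Real.dist_eq, Real.coe_toNNReal _ hΛ]
    exact hη p q
  have hcont : ContinuousOn (fun y => η ((chartAt (Cn n) x₀).symm y)) Q' :=
    hηc.comp_continuousOn ((chartAt (Cn n) x₀).continuousOn_symm.mono hrt)
  set u : Cn n → ℝ := Q'.indicator fun y => η ((chartAt (Cn n) x₀).symm y) with hu
  have hui : Integrable u volume :=
    (integrable_indicator_iff hQ'c.measurableSet).2 (hcont.integrableOn_compact hQ'c)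
  have huQ : ∀ y ∈ Q', u y = η ((chartAt (Cn n) x₀).symm y) := fun y hy => indicator_of_mem hy _
  obtain ⟨ε, hε, hεu⟩ := Metric.uniformContinuousOn_iff.1
    (hQ'c.uniformContinuousOn_of_continuous hcont) δ hδ
  set ρ := min (r / 2) ε with hρ
  have hρ0 : 0 < ρ := lt_min (by positivity) hε
  have hρr : ρ ≤ r / 2 := min_le_left _ _
  let φ : ContDiffBump (0 : Cn n) := ⟨ρ / 2, ρ, by positivity, by linarith⟩
  have hφO : φ.rOut = ρ := rfl
  set w : Cn n → ℝ := convolution (φ.normed volume) u (ContinuousLinearMap.lsmul ℝ ℝ) volume with hw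
  have hws : ContDiff ℝ ∞ w := φ.hasCompactSupport_normed.contDiff_convolution_left _
    φ.contDiff_normed hui.locallyIntegrable
  have hex : ∀ y, Integrable (fun z => φ.normed volume z * u (y - z)) volume := fun y =>
    φ.hasCompactSupport_normed.convolutionExists_left (ContinuousLinearMap.lsmul ℝ ℝ)
      φ.continuous_normed hui.locallyIntegrable y
  have hweq : ∀ y, w y = ∫ z, φ.normed volume z * u (y - z) := fun y => rfl
  have hmem : ∀ y ∈ Q, ∀ z, dist z y ≤ r → z ∈ Q' := fun y hy z hz =>
    Metric.mem_cthickening_of_dist_le z y r Q hy hz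
  refine ⟨w, hws, fun y hy => ⟨?_, fun v => ?_⟩⟩
  · rw [← huQ y (hmem y hy y (by simp [hr.le])), ← Real.dist_eq]
    refine φ.dist_normed_convolution_le hui.aestronglyMeasurable fun z hz => ?_
    rw [Metric.mem_ball, hφO] at hz
    have hz' := hmem y hy z (hz.le.trans (by linarith))
    have hy' := hmem y hy y (by simp [hr.le])
    rw [huQ z hz', huQ y hy']
    exact (hεu z hz' y hy' (hz.trans_le (min_le_right _ _))).le
  · refine abs_fderiv_le_of_lip (by positivity) (hws.differentiable (by simp) y) ?_
    have hsmall : ∀ᶠ t : ℝ in 𝓝 0, ‖t • v‖ < r / 2 := by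
      have h1 : Tendsto (fun t : ℝ => ‖t • v‖) (𝓝 0) (𝓝 ‖(0 : ℝ) • v‖) :=
        ((continuous_id.smul continuous_const).norm).tendsto 0
      rw [zero_smul, norm_zero] at h1
      exact h1.eventually_lt_const (by positivity)
    filter_upwards [hsmall] with t ht
    have hb : ∀ z, ‖φ.normed volume z * u (y + t • v - z) - φ.normed volume z * u (y - z)‖
        ≤ φ.normed volume z * (2 * Λ * √(gC x₀ y v v) * |t|) := by
      intro z
      have hφ0 : 0 ≤ φ.normed volume z := φ.nonneg_normed z
      rw [← mul_sub, norm_mul, Real.norm_eq_abs, abs_of_nonneg hφ0]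
      by_cases hz : z ∈ Metric.ball (0 : Cn n) ρ
      · rw [mem_ball_zero_iff] at hz
        refine mul_le_mul_of_nonneg_left ?_ hφ0
        have hd : ∀ s ∈ Icc (0 : ℝ) 1, dist (y - z + s • (t • v)) y ≤ r := by
          intro s hs
          rw [dist_eq_norm]
          have h1 : ‖s • (t • v)‖ ≤ ‖t • v‖ := by
            rw [norm_smul, Real.norm_eq_abs, abs_of_nonneg hs.1]
            exact mul_le_of_le_one_left (norm_nonneg _) hs.2
          calc ‖y - z + s • (t • v) - y‖ = ‖s • (t • v) - z‖ := by congr 1; abel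
            _ ≤ ‖s • (t • v)‖ + ‖z‖ := norm_sub_le _ _
            _ ≤ r := by linarith
        have hg0 : 0 ≤ gC x₀ y v v := by
          rcases eq_or_ne v 0 with rfl | hv
          · simp
          · exact ((isHermitianForm_gC hK (hQt hy)).pos v hv).le
        -- the translated segment stays in the region where the metric is at most four times that
        -- at `y`
        have h1 := dist_chart_symm_le (x₀ := x₀) (y := y - z) (w := t • v)
          (c := 2 * √(gC x₀ y v v) * |t|) (by positivity) fun s hs => by
            refine ⟨hrt (hmem y hy _ (hd s hs)), ?_⟩
            refine Real.sqrt_le_iff.2 ⟨by positivity, (hrv y hy _ (hd s hs) _).trans_eq ?_⟩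
            simp only [map_smul, LinearMap.smul_apply, smul_eq_mul]
            rw [mul_pow, mul_pow, Real.sq_sqrt hg0, sq_abs]
            ring
        have h2 : y + t • v - z = y - z + t • v := by abel
        have m1 : y - z + t • v ∈ Q' := by
          simpa using hmem y hy _ (hd 1 (by simp))
        have m0 : y - z ∈ Q' := by
          simpa using hmem y hy _ (hd 0 (by simp))
        rw [h2, huQ _ m1, huQ _ m0, Real.norm_eq_abs, abs_sub_comm]
        calc _ ≤ Λ * _ := hη _ _
          _ ≤ Λ * (2 * √(gC x₀ y v v) * |t|) := mul_le_mul_of_nonneg_left h1 hΛ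
          _ = 2 * Λ * √(gC x₀ y v v) * |t| := by ring
      · have h0 : φ.normed volume z = 0 := by
          have := φ.support_normed_eq (μ := volume)
          by_contra h
          exact hz (hφO ▸ this ▸ Function.mem_support.2 h)
        simp [h0]
    rw [hweq, hweq, ← integral_sub (hex _) (hex _), ← Real.norm_eq_abs]
    refine (norm_integral_le_of_norm_le (φ.integrable_normed.mul_const _)
      (ae_of_all _ hb)).trans_eq ?_
    rw [integral_mul_const, φ.integral_normed, one_mul]

end Mollification

/-! ### Differentials of functions -/

section Differential

variable {n : ℕ} {M : Type*} [TopologicalSpace M] [ChartedSpace (Cn n) M]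
  {x₀ x : M}

theorem tendsto_chart_symm (x : M) :
    Tendsto (chartAt (Cn n) x).symm (𝓝 (chartAt (Cn n) x x)) (𝓝 x) := by
  have h3 := (chartAt (Cn n) x).symm.continuousAt (mem_chart_target (Cn n) x)
  have h4 : (chartAt (Cn n) x).symm (chartAt (Cn n) x x) = x :=
    (chartAt (Cn n) x).left_inv (mem_chart_source _ x)
  rwa [ContinuousAt, h4] at h3

theorem dfun_eq_zero {f : M → ℝ} (hf : f =ᶠ[𝓝 x] fun _ => 0) : dfun (n := n) f x = 0 := by
  have h1 : (fun y => f ((chartAt (Cn n) x).symm y)) =ᶠ[𝓝 (chartAt (Cn n) x x)] fun _ => 0 :=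
    (tendsto_chart_symm x).eventually hf
  rw [dfun, h1.fderiv_eq]
  simp

variable [IsManifold 𝓘(ℂ, Cn n) ω M]

/-- The differential in another chart. -/
theorem hasFDerivAt_comp_chart_symm {f : M → ℝ} {g : Cn n → ℝ}
    (hx : x ∈ (chartAt (Cn n) x₀).source) (hfg : f =ᶠ[𝓝 x] fun p => g (chartAt (Cn n) x₀ p))
    (hg : DifferentiableAt ℝ g (chartAt (Cn n) x₀ x)) :
    HasFDerivAt (fun y => f ((chartAt (Cn n) x).symm y))
      ((fderiv ℝ g (chartAt (Cn n) x₀ x)).comp (fderiv ℝ (trans x x₀) (chartAt (Cn n) x x)))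
      (chartAt (Cn n) x x) := by
  have h1 := chart_mem_transDomain (mem_chart_source (Cn n) x) hx
  have h2 : HasFDerivAt g (fderiv ℝ g (chartAt (Cn n) x₀ x)) (trans x x₀ (chartAt (Cn n) x x)) := by
    rw [trans_chart (mem_chart_source (Cn n) x)]
    exact hg.hasFDerivAt
  exact (h2.comp _ (differentiableAt_trans h1).hasFDerivAt).congr_of_eventuallyEq
    ((tendsto_chart_symm x).eventually hfg)

end Differential

/-! ### Cutoff functions -/

section Cutoff

variable {n : ℕ} {M : Type*} [MetricSpace M] [ChartedSpace (Cn n) M]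
  [IsManifold 𝓘(ℂ, Cn n) ω M]
  [RiemannianBundle (fun x : M => TangentSpace 𝓘(ℝ, Cn n) x)]
  [IsContMDiffRiemannianBundle 𝓘(ℝ, Cn n) ∞ (Cn n)
      (fun x : M => TangentSpace 𝓘(ℝ, Cn n) x)]

/-- The gradient of a smooth function is bounded on a compact subset of a chart domain. -/
theorem exists_abs_dfun_le (hK : IsKahler n M) {φ : M → ℝ}
    (hφ : ContMDiff 𝓘(ℝ, Cn n) 𝓘(ℝ, ℝ) ∞ φ) {x₀ : M} {S : Set M} (hS : IsCompact S)
    (hSx : S ⊆ (chartAt (Cn n) x₀).source) :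
    ∃ C, 0 ≤ C ∧ ∀ x ∈ S, ∀ v : Cn n, |dfun φ x v| ≤ C * √(gForm x v v) := by
  set Q := chartAt (Cn n) x₀ '' S with hQdef
  have hQ : IsCompact Q := hS.image_of_continuousOn ((chartAt (Cn n) x₀).continuousOn.mono hSx)
  have hQt : Q ⊆ (chartAt (Cn n) x₀).target := by
    rintro _ ⟨p, hp, rfl⟩
    exact (chartAt (Cn n) x₀).map_source (hSx hp)
  obtain ⟨m, hm, hmv⟩ := exists_pos_mul_norm_sq_le hK hQ hQt
  have hc : ContDiffOn ℝ ∞ (fun y => φ ((chartAt (Cn n) x₀).symm y)) (chartAt (Cn n) x₀).target :=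
    fun y hy => (contDiffAt_comp_symm hφ hy).contDiffWithinAt
  obtain ⟨B, hB⟩ := hQ.exists_bound_of_continuousOn
    ((hc.continuousOn_fderiv_of_isOpen (chartAt (Cn n) x₀).open_target (by simp)).mono hQt)
  refine ⟨max B 0 / √m, by positivity, fun x hx v => ?_⟩
  have hxs := hSx hx
  have h1 := hasFDerivAt_comp_chart_symm (f := φ) (x := x)
    (g := fun y => φ ((chartAt (Cn n) x₀).symm y)) hxs (by
      filter_upwards [(chartAt (Cn n) x₀).open_source.mem_nhds hxs] with p hp
      rw [(chartAt (Cn n) x₀).left_inv hp])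
    ((contDiffAt_comp_symm hφ ((chartAt (Cn n) x₀).map_source hxs)).differentiableAt (by simp))
  have hxQ : chartAt (Cn n) x₀ x ∈ Q := ⟨x, hx, rfl⟩
  rw [dfun, h1.fderiv, ContinuousLinearMap.comp_apply, gForm_eq hxs]
  set v' := fderiv ℝ (trans x x₀) (chartAt (Cn n) x x) v
  have h2 : √m * ‖v'‖ ≤ √(gC x₀ (chartAt (Cn n) x₀ x) v' v') := by
    refine Real.le_sqrt_of_sq_le ?_
    rw [mul_pow, Real.sq_sqrt hm.le]
    exact hmv _ hxQ v'
  have hm' : 0 < √m := Real.sqrt_pos.2 hm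
  calc _ ≤ ‖fderiv ℝ (fun y => φ ((chartAt (Cn n) x₀).symm y)) (chartAt (Cn n) x₀ x)‖ * ‖v'‖ :=
        ContinuousLinearMap.le_opNorm _ _
    _ ≤ max B 0 * ‖v'‖ :=
        mul_le_mul_of_nonneg_right ((hB _ hxQ).trans (le_max_left _ _)) (norm_nonneg _)
    _ = max B 0 / √m * (√m * ‖v'‖) := by field_simp
    _ ≤ _ := mul_le_mul_of_nonneg_left h2 (by positivity)

theorem abs_clamp_sub_le (a b : ℝ) : |max 0 (min 1 a) - max 0 (min 1 b)| ≤ |a - b| := by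
  have h1 := abs_max_sub_max_le_max 0 (min 1 a) 0 (min 1 b)
  have h2 := abs_min_sub_min_le_max 1 a 1 b
  simp only [sub_self, abs_zero, abs_nonneg, max_eq_right] at h1 h2
  exact h1.trans h2

variable [IsRiemannianManifold 𝓘(ℝ, Cn n) M]

/-- On a complete manifold there are smooth compactly supported functions that are close to one on
large balls and have a small gradient. The function `η = min(1, 2 - d(o, ·)/l)⁺` has these
properties except for smoothness, so it is mollified in charts and glued with a partition of
unity. -/
theorem exists_cutoff [CompleteSpace M] [SigmaCompactSpace M] (hK : IsKahler n M) (o : M) {l : ℝ}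
    (hl : 1 ≤ l) :
    ∃ χ : M → ℝ, ContMDiff 𝓘(ℝ, Cn n) 𝓘(ℝ, ℝ) ∞ χ ∧ HasCompactSupport χ ∧ (∀ x, |χ x| ≤ 2) ∧
      (∀ x, dist o x ≤ l → |χ x - 1| ≤ 1 / l) ∧
      ∀ x, ∀ v : Cn n, |dfun χ x v| ≤ 3 / l * √(gForm x v v) := by
  have hl0 : 0 < l := by linarith
  have : LocallyCompactSpace M := ChartedSpace.locallyCompactSpace (Cn n) M
  set η : M → ℝ := fun p => max 0 (min 1 (2 - dist o p / l)) with hη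
  have hη0 : ∀ p, 0 ≤ η p := fun p => le_max_left _ _
  have hη1 : ∀ p, η p ≤ 1 := fun p => max_le zero_le_one (min_le_left _ _)
  have hηlip : ∀ p q, |η p - η q| ≤ 1 / l * dist p q := by
    intro p q
    refine (abs_clamp_sub_le _ _).trans ?_
    have h1 : 2 - dist o p / l - (2 - dist o q / l) = (dist o q - dist o p) / l := by ring
    rw [h1, abs_div, abs_of_pos hl0, div_eq_inv_mul, one_div]
    refine mul_le_mul_of_nonneg_left ?_ (by positivity)
    rw [abs_le]
    constructor
    · linarith [dist_triangle o q p, dist_comm p q]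
    · linarith [dist_triangle o p q]
  have hηK : ∀ p, η p ≠ 0 → p ∈ Metric.closedBall o (2 * l) := by
    intro p hp
    by_contra h
    rw [Metric.mem_closedBall', not_le] at h
    refine hp (max_eq_left ((min_le_right _ _).trans ?_))
    have : 2 ≤ dist o p / l := (le_div_iff₀ hl0).2 h.le
    linarith
  have hKc := isCompact_closedBall_of_complete n o (2 * l)
  have hU : ∀ x : M, ∃ S : Set M, IsCompact S ∧ x ∈ interior S ∧ S ⊆ (chartAt (Cn n) x).source := by
    intro x
    obtain ⟨S, h1, h2, h3⟩ := exists_compact_between (isCompact_singleton (x := x))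
      (chartAt (Cn n) x).open_source (singleton_subset_iff.2 (mem_chart_source _ _))
    exact ⟨S, h1, singleton_subset_iff.1 h2, h3⟩
  choose S hSc hxS hSs using hU
  obtain ⟨t, φ, h1, h2, h3, h4, h5⟩ := exists_partition (n := n) hKc (fun x => interior (S x))
    (fun _ => isOpen_interior) hxS
  have hts : ∀ i : t, tsupport (φ (some i)) ⊆ (chartAt (Cn n) (i : M)).source := fun i =>
    (h4 i).trans (interior_subset.trans (hSs i))
  have htc : ∀ i : t, IsCompact (tsupport (φ (some i))) := fun i =>
    (hSc i).of_isClosed_subset (isClosed_tsupport _) ((h4 i).trans interior_subset)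
  choose C hC0 hC using fun i : t => exists_abs_dfun_le hK (h1 (some i)) (htc i) (hts i)
  -- `δ` is the accuracy of the mollifications `w i`: the derivatives of the partition functions,
  -- which are bounded by `C i`, then contribute at most `1 / l` to the gradient
  set δ := 1 / l / (1 + ∑ i, C i) with hδ
  have hsum0 : 0 ≤ ∑ i, C i := Finset.sum_nonneg fun i _ => hC0 i
  have hδ0 : 0 < δ := by positivity
  have hδl : δ ≤ 1 / l := div_le_self (by positivity) (by linarith)
  have hδC : δ * ∑ i, C i ≤ 1 / l := by
    rw [hδ, div_mul_eq_mul_div, div_le_iff₀ (by positivity)]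
    exact mul_le_mul_of_nonneg_left (by linarith) (by positivity)
  choose w hws hw using fun i : t => exists_mollification (x₀ := (i : M)) hK
    ((htc i).image_of_continuousOn ((chartAt (Cn n) (i : M)).continuousOn.mono (hts i)))
    (by
      rintro _ ⟨p, hp, rfl⟩
      exact (chartAt (Cn n) (i : M)).map_source (hts i hp))
    (show 0 ≤ 1 / l by positivity) hηlip hδ0
  have hφ0 : ∀ (i : t) x, x ∉ tsupport (φ (some i)) → φ (some i) =ᶠ[𝓝 x] fun _ => 0 := fun i x hx =>
    notMem_tsupport_iff_eventuallyEq.1 hx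
  set T : t → M → ℝ := fun i x => φ (some i) x * w i (chartAt (Cn n) (i : M) x) with hT
  have hTs : ∀ i, ContMDiff 𝓘(ℝ, Cn n) 𝓘(ℝ, ℝ) ∞ (T i) := by
    refine fun i => contMDiff_of_tsupport fun x hx => (h1 _ x).mul ?_
    have hx' : x ∈ tsupport (φ (some i)) := tsupport_mul_subset_left hx
    exact (hws i).contMDiff.contMDiffAt.comp x (((contMDiffOn_chart (I := 𝓘(ℝ, Cn n)) (n := ω)
      (x := (i : M))).contMDiffAt ((chartAt (Cn n) (i : M)).open_source.mem_nhds
        (hts i hx'))).of_le le_top)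
  -- the partition function of the complement does not matter where `η` does not vanish
  have hnone : ∀ x, η x ≠ 0 → φ none =ᶠ[𝓝 x] fun _ => 0 := fun x hx =>
    notMem_tsupport_iff_eventuallyEq.1 fun h => h5 h (hηK x hx)
  have hval : ∀ i x, x ∈ tsupport (φ (some i)) →
      |w i (chartAt (Cn n) (i : M) x) - η x| ≤ δ := by
    intro i x hx
    have h6 := (hw i _ ⟨x, hx, rfl⟩).1
    rwa [(chartAt (Cn n) (i : M)).left_inv (hts i hx)] at h6
  have hsumφ : ∀ x, ∑ i : t, φ (some i) x = 1 - φ none x := fun x => by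
    rw [← h3 x, Fintype.sum_option]
    ring
  have hsumle : ∀ x, ∑ i : t, φ (some i) x ≤ 1 := fun x => by
    rw [hsumφ]
    linarith [h2 none x]
  have hχη : ∀ x, |∑ i, T i x - η x| ≤ δ := by
    intro x
    have h6 : ∑ i, T i x - η x = ∑ i : t, φ (some i) x *
        (w i (chartAt (Cn n) (i : M) x) - η x) := by
      simp only [mul_sub, Finset.sum_sub_distrib]
      rw [← Finset.sum_mul, hsumφ]
      rcases eq_or_ne (η x) 0 with h0 | h0
      · simp [h0, hT]
      · rw [(hnone x h0).self_of_nhds]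
        simp [hT]
    rw [h6]
    refine (Finset.abs_sum_le_sum_abs _ _).trans ?_
    calc _ ≤ ∑ i : t, φ (some i) x * δ := by
          refine Finset.sum_le_sum fun i _ => ?_
          rw [abs_mul, abs_of_nonneg (h2 _ x)]
          by_cases hx : x ∈ tsupport (φ (some i))
          · exact mul_le_mul_of_nonneg_left (hval i x hx) (h2 _ x)
          · rw [(hφ0 i x hx).self_of_nhds]
            simp
      _ ≤ δ := by
          rw [← Finset.sum_mul]
          exact mul_le_of_le_one_left hδ0.le (hsumle x)
  have hδ1 : δ ≤ 1 := hδl.trans ((div_le_one hl0).2 hl)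
  refine ⟨fun x => ∑ i, T i x, contMDiff_finsetSum fun i _ => hTs i, ?_, fun x => ?_,
    fun x hx => ?_,
    fun x v => ?_⟩
  · refine HasCompactSupport.intro (isCompact_iUnion htc) fun x hx => ?_
    refine Finset.sum_eq_zero fun i _ => ?_
    have hx' : x ∉ tsupport (φ (some i)) := fun h => hx (mem_iUnion.2 ⟨i, h⟩)
    simp only [hT]
    rw [(hφ0 i x hx').self_of_nhds, zero_mul]
  · have h6 := abs_le.1 (hχη x)
    rw [abs_le]
    constructor <;> linarith [hη0 x, hη1 x, h6.1, h6.2]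
  · have h6 : η x = 1 := by
      have h7 : dist o x / l ≤ 1 := (div_le_one hl0).2 hx
      simp only [hη]
      rw [min_eq_left (by linarith), max_eq_right zero_le_one]
    have h7 := (hχη x).trans hδl
    rwa [h6] at h7
  · set g := √(gForm x v v) with hg
    have hg0 : 0 ≤ g := Real.sqrt_nonneg _
    have hder : ∀ i, HasFDerivAt (fun y => T i ((chartAt (Cn n) x).symm y)) (dfun (T i) x)
        (chartAt (Cn n) x x) := fun i =>
      ((contDiffAt_comp_symm (hTs i) (mem_chart_target _ x)).differentiableAt (by simp)).hasFDerivAt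
    have hderφ : ∀ i, HasFDerivAt (fun y => φ i ((chartAt (Cn n) x).symm y)) (dfun (φ i) x)
        (chartAt (Cn n) x x) := fun i =>
      ((contDiffAt_comp_symm (h1 i) (mem_chart_target _ x)).differentiableAt (by simp)).hasFDerivAt
    have hd : dfun (fun x => ∑ i, T i x) x v = ∑ i, dfun (T i) x v := by
      rw [dfun, (HasFDerivAt.fun_sum (u := Finset.univ) fun i _ => hder i).fderiv, sum_apply]
    have hd0 : dfun (φ none) x v + ∑ i : t, dfun (φ (some i)) x v = 0 := by
      have h6 := HasFDerivAt.fun_sum (u := Finset.univ) fun i _ => hderφ i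
      simp only [h3] at h6
      have h7 := congrArg (fun A : Cn n →L[ℝ] ℝ => A v) (h6.unique (hasFDerivAt_const _ _))
      simp only [Fintype.sum_option, add_apply, sum_apply, zero_apply] at h7
      exact h7
    -- `∑ dφᵢ = 0` where `η` does not vanish, so `η x` may be subtracted
    -- from the values of all `w i`
    have hη' : η x * ∑ i : t, dfun (φ (some i)) x v = 0 := by
      rcases eq_or_ne (η x) 0 with h0 | h0
      · rw [h0, zero_mul]
      · rw [dfun_eq_zero (hnone x h0), zero_apply, zero_add] at hd0
        rw [hd0, mul_zero]
    have hterm : ∀ i, |dfun (T i) x v - η x * dfun (φ (some i)) x v|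
        ≤ φ (some i) x * (2 / l * g) + δ * C i * g := by
      intro i
      by_cases hx : x ∈ tsupport (φ (some i))
      · have hxs := hts i hx
        have h6 := hasFDerivAt_comp_chart_symm (f := fun p => w i (chartAt (Cn n) (i : M) p)) hxs
          (EventuallyEq.refl _ _) ((hws i).differentiable (by simp) _)
        have h7 := (hderφ (some i)).mul h6
        have h8 : HasFDerivAt (fun y => T i ((chartAt (Cn n) x).symm y)) _ (chartAt (Cn n) x x) :=
          h7
        have h9 : dfun (T i) x v = φ (some i) x * fderiv ℝ (w i) (chartAt (Cn n) (i : M) x)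
            (fderiv ℝ (trans x i) (chartAt (Cn n) x x) v)
            + w i (chartAt (Cn n) (i : M) x) * dfun (φ (some i)) x v := by
          rw [dfun, h8.fderiv, (chartAt (Cn n) x).left_inv (mem_chart_source _ x)]
          rfl
        have h10 := (hw i _ ⟨x, hx, rfl⟩).2 (fderiv ℝ (trans x i) (chartAt (Cn n) x x) v)
        rw [← gForm_eq hxs, ← hg] at h10
        have h11 : dfun (T i) x v - η x * dfun (φ (some i)) x v
            = φ (some i) x * fderiv ℝ (w i) (chartAt (Cn n) (i : M) x)
              (fderiv ℝ (trans x i) (chartAt (Cn n) x x) v)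
              + (w i (chartAt (Cn n) (i : M) x) - η x) * dfun (φ (some i)) x v := by
          rw [h9]
          ring
        rw [h11]
        refine (abs_add_le _ _).trans (add_le_add ?_ ?_)
        · rw [abs_mul, abs_of_nonneg (h2 _ x)]
          refine mul_le_mul_of_nonneg_left (h10.trans_eq (by ring)) (h2 _ x)
        · rw [abs_mul, mul_assoc]
          exact mul_le_mul (hval i x hx) (hC i x hx v) (abs_nonneg _) hδ0.le
      · have h6 : T i =ᶠ[𝓝 x] fun _ => 0 := by
          filter_upwards [hφ0 i x hx] with p hp
          simp only [hT]
          rw [hp, zero_mul]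
        rw [dfun_eq_zero h6, dfun_eq_zero (hφ0 i x hx), (hφ0 i x hx).self_of_nhds]
        simp only [zero_apply, mul_zero, sub_self, abs_zero, zero_mul, zero_add]
        exact mul_nonneg (mul_nonneg hδ0.le (hC0 i)) hg0
    have h6 : dfun (fun x => ∑ i, T i x) x v
        = ∑ i, (dfun (T i) x v - η x * dfun (φ (some i)) x v) := by
      rw [Finset.sum_sub_distrib, ← Finset.mul_sum, hη', sub_zero, hd]
    rw [h6]
    calc _ ≤ ∑ i, (φ (some i) x * (2 / l * g) + δ * C i * g) :=
          (Finset.abs_sum_le_sum_abs _ _).trans (Finset.sum_le_sum fun i _ => hterm i)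
      _ = (∑ i : t, φ (some i) x) * (2 / l * g) + (δ * ∑ i, C i) * g := by
          rw [Finset.sum_add_distrib, Finset.sum_mul, Finset.mul_sum, Finset.sum_mul]
      _ ≤ 1 * (2 / l * g) + 1 / l * g :=
          add_le_add (mul_le_mul_of_nonneg_right (hsumle x) (by positivity))
            (mul_le_mul_of_nonneg_right hδC hg0)
      _ = 3 / l * g := by ring

end Cutoff

/-! ### Quadratic forms -/

section Quadratic

variable {V : Type*} [AddCommGroup V] [Module ℂ V] {S : Set V} {q N : V → ℝ}

/-- `S` is a real linear subspace (possibly empty). -/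
def IsLinSet (S : Set V) : Prop := ∀ u ∈ S, ∀ v ∈ S, ∀ t : ℝ, u + (t : ℂ) • v ∈ S

/-- `q` is a real quadratic form on `S`. Scalars are written in `ℂ`, since sections form a complex
vector space. -/
def IsQuadOn (S : Set V) (q : V → ℝ) : Prop := ∀ u ∈ S, ∀ v ∈ S, ∀ t : ℝ,
  q (u + (t : ℂ) • v) = q u + t * (q (u + v) - q u - q v) + t ^ 2 * q v

theorem IsLinSet.sub_mem (hS : IsLinSet S) {u v : V} (hu : u ∈ S) (hv : v ∈ S) : u - v ∈ S := by
  simpa [sub_eq_add_neg] using hS u hu v hv (-1)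

theorem IsQuadOn.mono {S' : Set V} (hq : IsQuadOn S q) (h : S' ⊆ S) : IsQuadOn S' q :=
  fun u hu v hv t => hq u (h hu) v (h hv) t

theorem IsQuadOn.add (hq : IsQuadOn S q) (hN : IsQuadOn S N) : IsQuadOn S fun u => q u + N u := by
  intro u hu v hv t
  simp only
  rw [hq u hu v hv t, hN u hu v hv t]
  ring

theorem IsQuadOn.const_mul (hq : IsQuadOn S q) (c : ℝ) : IsQuadOn S fun u => c * q u := by
  intro u hu v hv t
  simp only
  rw [hq u hu v hv t]
  ring

theorem IsQuadOn.sum {ι : Type*} (s : Finset ι) {q : ι → V → ℝ} (hq : ∀ i, IsQuadOn S (q i)) :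
    IsQuadOn S fun u => ∑ i ∈ s, q i u := by
  intro u hu v hv t
  simp only [fun i => hq i u hu v hv t, Finset.sum_add_distrib, Finset.sum_sub_distrib,
    ← Finset.mul_sum]

theorem IsQuadOn.integral {X : Type*} [MeasurableSpace X] {μ : Measure X} (hS : IsLinSet S)
    {F : V → X → ℝ} (hF : ∀ x, IsQuadOn S fun u => F u x) (hi : ∀ u ∈ S, Integrable (F u) μ) :
    IsQuadOn S fun u => ∫ x, F u x ∂μ := by
  intro u hu v hv t
  have huv : u + v ∈ S := by simpa using hS u hu v hv 1
  simp only [fun x => hF x u hu v hv t]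
  have e0 : Integrable (fun x => F (u + v) x - F u x) μ := (hi _ huv).sub (hi u hu)
  have e1 : Integrable (fun x => F (u + v) x - F u x - F v x) μ := e0.sub (hi v hv)
  have e2 : Integrable (fun x => F u x + t * (F (u + v) x - F u x - F v x)) μ :=
    (hi u hu).add (e1.const_mul t)
  rw [integral_add e2 ((hi v hv).const_mul _), integral_add (hi u hu) (e1.const_mul t),
    integral_const_mul, integral_const_mul, integral_sub e0 (hi v hv),
    integral_sub (hi _ huv) (hi u hu)]

/-- The parallelogram law. -/
theorem IsQuadOn.add_add_sub (hN : IsQuadOn S N) {u w : V} (hu : u ∈ S) (hw : w ∈ S) :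
    N (u + w) + N (u - w) = 2 * N u + 2 * N w := by
  have h1 := hN u hu w hw (-1)
  have h2 : u + ((-1 : ℝ) : ℂ) • w = u - w := by simp [sub_eq_add_neg]
  rw [h2] at h1
  rw [h1]
  ring

theorem IsQuadOn.sub_le (hS : IsLinSet S) (hN : IsQuadOn S N) (hN0 : ∀ u ∈ S, 0 ≤ N u) {u w : V}
    (hu : u ∈ S) (hw : w ∈ S) : N (u - w) ≤ 2 * N u + 2 * N w := by
  have h1 := hN.add_add_sub hu hw
  have h2 := hN0 (u + w) (by simpa using hS u hu w hw 1)
  linarith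

/-- The Cauchy–Schwarz inequality for a bounded quadratic form, with a parameter `t`. -/
theorem IsQuadOn.abs_add_sub_le (hS : IsLinSet S) (hq : IsQuadOn S q) (hN : IsQuadOn S N) {C : ℝ}
    (hqN : ∀ u ∈ S, |q u| ≤ C * N u) {u w : V} (hu : u ∈ S) (hw : w ∈ S) {t : ℝ} (ht : 0 < t) :
    |q (u + w) - q u| ≤ C * (N u / t + (t + 1) * N w) := by
  set β := q (u + w) - q u - q w with hβ
  have h1 := hq u hu w hw t
  have h2 := hq u hu w hw (-t)
  have h3 := hN u hu w hw t
  have h4 := hN u hu w hw (-t)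
  have h5 := hqN _ (hS u hu w hw t)
  have h6 := hqN _ (hS u hu w hw (-t))
  have h7 := hqN w hw
  have h8 : |2 * t * β| ≤ 2 * C * (N u + t ^ 2 * N w) := by
    have h9 : 2 * t * β = q (u + (t : ℂ) • w) - q (u + ((-t : ℝ) : ℂ) • w) := by
      rw [h1, h2]
      ring
    rw [h9]
    refine (abs_sub _ _).trans ((add_le_add h5 h6).trans_eq ?_)
    rw [h3, h4]
    ring
  have h9 : |β| ≤ C * (N u / t + t * N w) := by
    rw [abs_mul, abs_of_pos (by positivity : 0 < 2 * t)] at h8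
    have h10 : 2 * t * |β| ≤ 2 * t * (C * (N u / t + t * N w)) := by
      refine h8.trans_eq ?_
      field_simp
    exact le_of_mul_le_mul_left h10 (by positivity)
  have h10 : q (u + w) - q u = β + q w := by
    rw [hβ]
    ring
  rw [h10]
  refine (abs_add_le _ _).trans ((add_le_add h9 h7).trans_eq ?_)
  ring

/-- A quadratic form that is bounded with respect to `N` is continuous with respect to `N`. -/
theorem IsQuadOn.tendsto (hS : IsLinSet S) (hq : IsQuadOn S q) (hN : IsQuadOn S N) {C : ℝ}
    (hqN : ∀ u ∈ S, |q u| ≤ C * N u) (hC : 0 ≤ C) (hN0 : ∀ u ∈ S, 0 ≤ N u) {u : ℕ → V} {v : V}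
    (hu : ∀ l, u l ∈ S) (hv : v ∈ S) (h : Tendsto (fun l => N (u l - v)) atTop (𝓝 0)) :
    Tendsto (fun l => q (u l)) atTop (𝓝 (q v)) := by
  refine Metric.tendsto_atTop.2 fun ε hε => ?_
  -- the parameter `t` makes the first term of `abs_add_sub_le` small, `l₀` the second
  set t := 2 * C * N v / ε + 1 with ht
  have ht0 : 0 < t := by
    have := hN0 v hv
    positivity
  have ht1 : C * (N v / t) ≤ ε / 2 := by
    rw [mul_div_assoc', div_le_iff₀ ht0, ht]
    field_simp
    linarith
  have h2 : ∀ᶠ l in atTop, C * (t + 1) * N (u l - v) < ε / 2 := by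
    have := h.const_mul (C * (t + 1))
    rw [mul_zero] at this
    exact this.eventually_lt_const (by positivity)
  obtain ⟨l₀, hl₀⟩ := eventually_atTop.1 h2
  refine ⟨l₀, fun l hl => ?_⟩
  have h3 := hq.abs_add_sub_le hS hN hqN hv (hS.sub_mem (hu l) hv) ht0
  rw [add_sub_cancel] at h3
  rw [Real.dist_eq]
  have := hl₀ l hl
  calc _ ≤ _ := h3
    _ = C * (N v / t) + C * (t + 1) * N (u l - v) := by ring
    _ < ε := by linarith

/-- A quadratic form that is bounded with respect to `N` converges along `N`-Cauchy sequences. -/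
theorem IsQuadOn.exists_tendsto (hS : IsLinSet S) (hq : IsQuadOn S q) (hN : IsQuadOn S N) {C : ℝ}
    (hqN : ∀ u ∈ S, |q u| ≤ C * N u) (hC : 0 ≤ C) (hN0 : ∀ u ∈ S, 0 ≤ N u) {u : ℕ → V}
    (hu : ∀ l, u l ∈ S)
    (h : ∀ ε > 0, ∃ l₀, ∀ k ≥ l₀, ∀ l ≥ l₀, N (u k - u l) < ε) :
    ∃ s, Tendsto (fun l => q (u l)) atTop (𝓝 s) := by
  refine cauchySeq_tendsto_of_complete (Metric.cauchySeq_iff.2 fun ε hε => ?_)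
  obtain ⟨l₁, hl₁⟩ := h 1 one_pos
  -- an upper bound of `N` along the sequence
  set B := 2 * N (u l₁) + 2 with hB
  have hNB : ∀ l ≥ l₁, N (u l) ≤ B := by
    intro l hl
    have h1 := hN.add_add_sub (hu l₁) (hS.sub_mem (hu l) (hu l₁))
    have h2 := hN0 _ (hS.sub_mem (hu l₁) (hS.sub_mem (hu l) (hu l₁)))
    have h3 := hl₁ l hl l₁ le_rfl
    rw [add_sub_cancel] at h1
    linarith
  have hB0 : 0 < B := by
    have := hN0 _ (hu l₁)
    positivity
  set t := 2 * C * B / ε + 1 with ht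
  have ht0 : 0 < t := by positivity
  have ht1 : C * (B / t) ≤ ε / 2 := by
    rw [mul_div_assoc', div_le_iff₀ ht0, ht]
    field_simp
    linarith
  obtain ⟨l₂, hl₂⟩ := h (ε / 2 / (C * (t + 1) + 1)) (by positivity)
  refine ⟨max l₁ l₂, fun k hk l hl => ?_⟩
  have h3 := hq.abs_add_sub_le hS hN hqN (hu l) (hS.sub_mem (hu k) (hu l)) ht0
  rw [add_sub_cancel] at h3
  rw [Real.dist_eq]
  have h4 := hl₂ k ((le_max_right _ _).trans hk) l ((le_max_right _ _).trans hl)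
  have h5 := hNB l ((le_max_left _ _).trans hl)
  have h6 : C * (t + 1) * N (u k - u l) < ε / 2 := by
    rw [lt_div_iff₀ (by positivity)] at h4
    have := hN0 _ (hS.sub_mem (hu k) (hu l))
    nlinarith
  calc _ ≤ _ := h3
    _ = C * (N (u l) / t) + C * (t + 1) * N (u k - u l) := by ring
    _ ≤ C * (B / t) + C * (t + 1) * N (u k - u l) := by gcongr
    _ < ε := by linarith

end Quadratic

/-! ### Square-integrable sections -/

section Sections

variable {n : ℕ} {M : Type*} [TopologicalSpace M] [ChartedSpace (Cn n) M]
  {L : M → Type*} [∀ x, AddCommGroup (L x)] [∀ x, Module ℂ (L x)] [∀ x, TopologicalSpace (L x)]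
  [TopologicalSpace (TotalSpace ℂ L)] [FiberBundle ℂ L] [VectorBundle ℂ ℂ L]
  [IsManifold 𝓘(ℂ, Cn n) ω M] [ContMDiffVectorBundle ω ℂ L 𝓘(ℂ, Cn n)]
  [RiemannianBundle (fun x : M => TangentSpace 𝓘(ℝ, Cn n) x)]
  (h : HermitianMetric n L) {ψ φ : Π x, L x} {x₀ x : M}

theorem hSq_nonneg (ψ : Π x, L x) (x : M) : 0 ≤ hSq h ψ x := by
  rcases eq_or_ne (ψ x) 0 with h0 | h0
  · rw [hSq_eq_zero h h0]
  · exact (h.pos x _ h0).le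

theorem re_self_nonneg (u : L x) : 0 ≤ (h.toFun x u u).re := by
  rcases eq_or_ne u 0 with rfl | h0
  · simp
  · exact (h.pos x _ h0).le

theorem traceTM_nonneg (ψ : Π x, L x) (x : M) : 0 ≤ traceTM h ψ x :=
  Finset.sum_nonneg fun _ _ => add_nonneg (re_self_nonneg h _) (re_self_nonneg h _)

theorem trace01_nonneg (ψ : Π x, L x) (x : M) : 0 ≤ trace01 h ψ x :=
  Finset.sum_nonneg fun _ _ => re_self_nonneg h _

/-- The norm square of a real linear expression is a quadratic form. -/
theorem isQuadOn_re_self {S : Set (Π x, L x)} {A : (Π x, L x) → L x}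
    (hA : ∀ u ∈ S, ∀ v ∈ S, ∀ t : ℝ, A (u + (t : ℂ) • v) = A u + (t : ℂ) • A v) :
    IsQuadOn S fun u => (h.toFun x (A u) (A u)).re := by
  intro u hu v hv t
  have h1 := hA u hu v hv 1
  rw [Complex.ofReal_one, one_smul, one_smul] at h1
  simp only
  rw [hA u hu v hv t, h1, re_add_self, re_add_self, re_ofReal_smul_left, re_ofReal_smul_right,
    re_ofReal_smul_right]
  ring

theorem isQuadOn_hSq (S : Set (Π x, L x)) (x : M) : IsQuadOn S fun u => hSq h u x :=
  isQuadOn_re_self h (A := fun u => u x) fun _ _ _ _ _ => rfl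

theorem isLinSet_smooth : IsLinSet {ψ : Π x, L x | IsSmoothSection n ψ} := fun _ hu _ hv t =>
  hu.add (IsSmoothSection.rsmul (χ := fun _ => t) contMDiff_const hv)

theorem nab_add_smul {u v : Π x, L x} (hu : IsSmoothSection n u) (hv : IsSmoothSection n v) (t : ℝ)
    (w : Cn n) : nab h (u + (t : ℂ) • v) x w = nab h u x w + (t : ℂ) • nab h v x w := by
  have hc : ContMDiff 𝓘(ℝ, Cn n) 𝓘(ℝ, ℝ) ∞ fun _ : M => t := contMDiff_const
  have h1 : (t : ℂ) • v = rsmul (fun _ => t) v := rfl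
  have h2 : dfun (n := n) (fun _ : M => t) x = 0 := by
    simp [dfun]
  rw [h1, nab_add h hu (IsSmoothSection.rsmul hc hv), nab_rsmul h hc hv, h2]
  simp

theorem isQuadOn_traceTM (x : M) :
    IsQuadOn {ψ : Π x, L x | IsSmoothSection n ψ} fun u => traceTM h u x := by
  simp only [traceTM_eq_sum]
  exact IsQuadOn.sum _ fun k => (isQuadOn_re_self h fun u hu v hv t => nab_add_smul h hu hv t _).add
    (isQuadOn_re_self h fun u hu v hv t => nab_add_smul h hu hv t _)

theorem isQuadOn_trace01 (x : M) :
    IsQuadOn {ψ : Π x, L x | IsSmoothSection n ψ} fun u => trace01 h u x := by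
  simp only [trace01_eq_sum]
  refine IsQuadOn.sum _ fun k => (isQuadOn_re_self h (A := fun u => nab h u x (uFrame x k)
    + Complex.I • nab h u x (Complex.I • uFrame x k)) fun u hu v hv t => ?_).const_mul _
  rw [nab_add_smul h hu hv, nab_add_smul h hu hv, smul_add, smul_add, smul_comm Complex.I]
  abel

/-- The parallelogram inequality, pointwise. -/
theorem hSq_add_smul_le (u v : Π x, L x) (t : ℝ) (x : M) :
    hSq h (u + (t : ℂ) • v) x ≤ 2 * hSq h u x + 2 * t ^ 2 * hSq h v x := by
  have h1 := (isQuadOn_hSq h univ x).add_add_sub (u := u) (w := (t : ℂ) • v) trivial trivial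
  have h2 := hSq_nonneg h (u - (t : ℂ) • v) x
  have h3 : hSq h ((t : ℂ) • v) x = t ^ 2 * hSq h v x := hSq_rsmul h (fun _ => t) v x
  rw [h3] at h1
  linarith

/-- The coordinates of a smooth section are continuous. -/
theorem IsSmoothSection.continuousOn_coord (hψ : IsSmoothSection n ψ) (x₀ : M) :
    ContinuousOn (coord ψ x₀) (trivializationAt ℂ L x₀).baseSet := by
  refine continuous_snd.comp_continuousOn
    ((trivializationAt ℂ L x₀).continuousOn.comp hψ.continuous.continuousOn fun x hx => ?_)
  exact (trivializationAt ℂ L x₀).mem_source.2 hx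

variable [MeasurableSpace M] [BorelSpace M]

theorem IsSmoothSection.aemeasurable_coord (hψ : IsSmoothSection n ψ) (x₀ : M) :
    AEMeasurable (coord ψ x₀) ((volMeasure n M).restrict (trivializationAt ℂ L x₀).baseSet) :=
  (hψ.continuousOn_coord x₀).aemeasurable (trivializationAt ℂ L x₀).open_baseSet.measurableSet

theorem MemL2.aemeasurable_hSq [SecondCountableTopology M] (hψ : MemL2 h ψ) :
    AEMeasurable (hSq h ψ) (volMeasure n M) := by
  obtain ⟨s, hs, hsU⟩ := TopologicalSpace.countable_cover_nhds fun x : M =>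
    (trivializationAt ℂ L x).open_baseSet.mem_nhds (mem_baseSet_trivializationAt ℂ L x)
  have : Countable s := hs.to_subtype
  rw [← Measure.restrict_univ (μ := volMeasure n M), ← hsU, biUnion_eq_iUnion]
  refine AEMeasurable.iUnion fun x => ?_
  have hB : MeasurableSet (trivializationAt ℂ L (x : M)).baseSet :=
    (trivializationAt ℂ L (x : M)).open_baseSet.measurableSet
  have h1 : AEMeasurable (fun p => (h.toFun p (frame L (x : M) p) (frame L (x : M) p)).re)
      ((volMeasure n M).restrict (trivializationAt ℂ L (x : M)).baseSet) :=
    (Complex.continuous_re.comp_continuousOn (h.smooth x).continuousOn).aemeasurable hB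
  refine (((hψ.1 x).norm.pow_const 2).mul h1).congr ?_
  filter_upwards [ae_restrict_mem hB] with p hp
  exact (hSq_eq h ψ hp).symm

theorem potentialENN_lt_top_iff {q : M → ℝ} (hq : ∀ x, 0 ≤ q x)
    (hm : AEMeasurable (fun x => q x * hSq h ψ x) (volMeasure n M)) :
    potentialENN h q ψ < ⊤ ↔ Integrable (fun x => q x * hSq h ψ x) (volMeasure n M) := by
  rw [potentialENN, lt_top_iff_ne_top]
  exact lintegral_ofReal_ne_top_iff_integrable hm.aestronglyMeasurable
    (ae_of_all _ fun x => mul_nonneg (hq x) (hSq_nonneg h ψ x))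

theorem ofReal_potential {q : M → ℝ} (hq : ∀ x, 0 ≤ q x)
    (hi : Integrable (fun x => q x * hSq h ψ x) (volMeasure n M)) :
    ENNReal.ofReal (potential h q ψ) = potentialENN h q ψ :=
  ofReal_integral_eq_lintegral_ofReal hi
    (ae_of_all _ fun x => mul_nonneg (hq x) (hSq_nonneg h ψ x))

theorem MemL2.integrable_hSq [SecondCountableTopology M] (hψ : MemL2 h ψ) :
    Integrable (hSq h ψ) (volMeasure n M) := by
  have h1 := (potentialENN_lt_top_iff h (q := fun _ => 1) (fun _ => zero_le_one)
    (by simpa using hψ.aemeasurable_hSq h)).1 hψ.2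
  simpa using h1

theorem memL2_of_integrable (hc : ∀ x₀, AEMeasurable (coord ψ x₀)
    ((volMeasure n M).restrict (trivializationAt ℂ L x₀).baseSet))
    (hi : Integrable (hSq h ψ) (volMeasure n M)) : MemL2 h ψ := by
  refine ⟨hc, (potentialENN_lt_top_iff h (q := fun _ => 1) (fun _ => zero_le_one) ?_).2 ?_⟩
  · simpa using hi.aemeasurable
  · simpa using hi

theorem isLinSet_memL2 [SecondCountableTopology M] : IsLinSet {ψ : Π x, L x | MemL2 h ψ} := by
  intro u hu v hv t
  have hc : ∀ x₀, AEMeasurable (coord (u + (t : ℂ) • v) x₀)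
      ((volMeasure n M).restrict (trivializationAt ℂ L x₀).baseSet) := by
    intro x₀
    refine ((hu.1 x₀).add ((hv.1 x₀).const_mul (t : ℂ))).congr ?_
    filter_upwards [ae_restrict_mem (trivializationAt ℂ L x₀).open_baseSet.measurableSet] with p hp
    have h1 : coord ((t : ℂ) • v) x₀ p = t * coord v x₀ p := coord_smul (fun _ => (t : ℂ)) v hp
    rw [coord_add _ _ hp, h1]
    rfl
  refine ⟨hc, ?_⟩
  calc potentialENN h (fun _ => 1) (u + (t : ℂ) • v)
      ≤ ∫⁻ x, ENNReal.ofReal (2 * hSq h u x + 2 * t ^ 2 * hSq h v x) ∂volMeasure n M := by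
        refine lintegral_mono fun x => ENNReal.ofReal_le_ofReal ?_
        rw [one_mul]
        exact hSq_add_smul_le h u v t x
    _ < ⊤ := (((hu.integrable_hSq h).const_mul 2).add
        ((hv.integrable_hSq h).const_mul (2 * t ^ 2))).lintegral_lt_top

theorem isQuadOn_normSq [SecondCountableTopology M] :
    IsQuadOn {ψ : Π x, L x | MemL2 h ψ} (normSq h) :=
  IsQuadOn.integral (isLinSet_memL2 h) (fun x => isQuadOn_hSq h _ x) fun _ hu => hu.integrable_hSq h

theorem normSq_nonneg (ψ : Π x, L x) : 0 ≤ normSq h ψ := integral_nonneg fun x => hSq_nonneg h ψ x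

end Sections

/-! ### Positive and negative parts -/

section PosPart

variable {M : Type*} {f : M → ℝ}

theorem posPart_apply_nonneg (f : M → ℝ) (x : M) : 0 ≤ f⁺ x := by
  rw [Pi.posPart_apply]
  exact posPart_nonneg _

theorem negPart_apply_nonneg (f : M → ℝ) (x : M) : 0 ≤ f⁻ x := by
  rw [Pi.negPart_apply]
  exact negPart_nonneg _

theorem posPart_apply_sub_negPart (f : M → ℝ) (x : M) : f⁺ x - f⁻ x = f x := by
  rw [Pi.posPart_apply, Pi.negPart_apply]
  exact posPart_sub_negPart _

theorem posPart_apply_add_negPart (f : M → ℝ) (x : M) : f⁺ x + f⁻ x = |f x| := by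
  rw [Pi.posPart_apply, Pi.negPart_apply]
  exact posPart_add_negPart _

variable [MeasurableSpace M]

theorem measurable_posPart (hf : Measurable f) : Measurable f⁺ := hf.sup_const 0

theorem measurable_negPart (hf : Measurable f) : Measurable f⁻ := hf.neg.sup_const 0

end PosPart

/-! ### The holomorphic Schrödinger form -/

section Core

variable {n : ℕ} {M : Type*} [MetricSpace M] [ChartedSpace (Cn n) M]
  [IsManifold 𝓘(ℂ, Cn n) ω M] [SecondCountableTopology M] [MeasurableSpace M] [BorelSpace M]
  [RiemannianBundle (fun x : M => TangentSpace 𝓘(ℝ, Cn n) x)]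
  [IsContMDiffRiemannianBundle 𝓘(ℝ, Cn n) ∞ (Cn n)
      (fun x : M => TangentSpace 𝓘(ℝ, Cn n) x)]
  {L : M → Type*} [∀ x, AddCommGroup (L x)] [∀ x, Module ℂ (L x)] [∀ x, TopologicalSpace (L x)]
  [TopologicalSpace (TotalSpace ℂ L)] [FiberBundle ℂ L] [VectorBundle ℂ ℂ L]
  [ContMDiffVectorBundle ω ℂ L 𝓘(ℂ, Cn n)]
  {h : HermitianMetric n L} {ψ φ : Π x, L x} {f : M → ℝ} {D : ℝ}

theorem IsTestSection.integrable_hSq (hK : IsKahler n M) (hψ : IsTestSection n ψ) :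
    Integrable (hSq h ψ) (volMeasure n M) :=
  integrable_of_continuous_of_closure hK (IsSmoothSection.continuous_hSq h hψ.1) hψ.2 fun _ hx =>
    hSq_eq_zero h (eventually_eq_zero_of_notMem hx).self_of_nhds

theorem IsTestSection.integrable_traceTM (hK : IsKahler n M) (hψ : IsTestSection n ψ) :
    Integrable (traceTM h ψ) (volMeasure n M) :=
  integrable_of_continuous_of_closure hK (IsSmoothSection.continuous_traceTM h hK hψ.1) hψ.2
    fun _ hx => traceTM_eq_zero h hx

theorem IsTestSection.integrable_trace01 (hK : IsKahler n M) (hψ : IsTestSection n ψ) :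
    Integrable (trace01 h ψ) (volMeasure n M) :=
  integrable_of_continuous_of_closure hK (IsSmoothSection.continuous_trace01 h hK hψ.1) hψ.2
    fun _ hx => trace01_eq_zero h hx

theorem IsTestSection.integrable_rho (hK : IsKahler n M) (hψ : IsTestSection n ψ) :
    Integrable (fun x => rho h x * hSq h ψ x) (volMeasure n M) :=
  integrable_of_continuous_of_closure hK
    ((continuous_rho h hK).mul (IsSmoothSection.continuous_hSq h hψ.1)) hψ.2 fun _ hx => by
      rw [hSq_eq_zero h (eventually_eq_zero_of_notMem hx).self_of_nhds, mul_zero]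

theorem IsTestSection.memL2 (hK : IsKahler n M) (hψ : IsTestSection n ψ) : MemL2 h ψ :=
  memL2_of_integrable h (IsSmoothSection.aemeasurable_coord hψ.1) (hψ.integrable_hSq hK)

/-- The integrated Weitzenböck formula. With the normalization `Z̄ = (e + i J e) / √2` the
holomorphic form carries the factor `2`. -/
theorem IsTestSection.two_mul_holForm (hK : IsKahler n M) (hψ : IsTestSection n ψ) :
    2 * holForm h ψ = bochnerForm h ψ + potential h (rho h) ψ := by
  have : LocallyCompactSpace M := ChartedSpace.locallyCompactSpace (Cn n) M
  have h1 := IsTestSection.integral_weitz_eq_zero h hK hψ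
  have e1 : Integrable (fun x => 2 * trace01 h ψ x) (volMeasure n M) :=
    (hψ.integrable_trace01 hK).const_mul 2
  have e2 : Integrable (fun x => 2 * trace01 h ψ x - traceTM h ψ x) (volMeasure n M) :=
    e1.sub (hψ.integrable_traceTM hK)
  simp only [weitz] at h1
  rw [integral_sub e2 (hψ.integrable_rho hK), integral_sub e1 (hψ.integrable_traceTM hK),
    integral_const_mul] at h1
  rw [holForm, bochnerForm, potential]
  linarith

theorem isLinSet_test : IsLinSet {ψ : Π x, L x | IsTestSection n ψ} := by
  intro u hu v hv t
  refine ⟨isLinSet_smooth u hu.1 v hv.1 t, (hu.2.union hv.2).of_isClosed_subset isClosed_closure ?_⟩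
  refine closure_minimal (fun x hx => ?_) (isClosed_closure.union isClosed_closure)
  by_contra hc
  rw [mem_union, not_or] at hc
  refine hx ?_
  rw [Pi.add_apply, Pi.smul_apply, (eventually_eq_zero_of_notMem hc.1).self_of_nhds,
    (eventually_eq_zero_of_notMem hc.2).self_of_nhds, smul_zero, add_zero]

theorem isQuadOn_bochnerForm (hK : IsKahler n M) :
    IsQuadOn {ψ : Π x, L x | IsTestSection n ψ} (bochnerForm h) :=
  IsQuadOn.integral isLinSet_test (fun x => (isQuadOn_traceTM h x).mono fun _ hu => hu.1)
    fun _ hu => hu.integrable_traceTM hK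

theorem isQuadOn_holForm (hK : IsKahler n M) :
    IsQuadOn {ψ : Π x, L x | IsTestSection n ψ} (holForm h) :=
  IsQuadOn.integral isLinSet_test (fun x => (isQuadOn_trace01 h x).mono fun _ hu => hu.1)
    fun _ hu => hu.integrable_trace01 hK

theorem isQuadOn_potential {S : Set (Π x, L x)} (hS : IsLinSet S) (q : M → ℝ)
    (hq : ∀ u ∈ S, Integrable (fun x => q x * hSq h u x) (volMeasure n M)) :
    IsQuadOn S (potential h q) :=
  IsQuadOn.integral hS (fun x => (isQuadOn_hSq h S x).const_mul _) hq

theorem bochnerForm_nonneg (ψ : Π x, L x) : 0 ≤ bochnerForm h ψ :=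
  integral_nonneg fun x => traceTM_nonneg h ψ x

theorem holForm_nonneg (ψ : Π x, L x) : 0 ≤ holForm h ψ :=
  integral_nonneg fun x => trace01_nonneg h ψ x

theorem potential_nonneg {q : M → ℝ} (hq : ∀ x, 0 ≤ q x) (ψ : Π x, L x) : 0 ≤ potential h q ψ :=
  integral_nonneg fun x => mul_nonneg (hq x) (hSq_nonneg h ψ x)

theorem integrable_posPart_of_mem (hf : Measurable f) (hψ : ψ ∈ formCore h f) :
    Integrable (fun x => f⁺ x * hSq h ψ x) (volMeasure n M) :=
  (potentialENN_lt_top_iff h (posPart_apply_nonneg f) (((measurable_posPart hf).mul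
    (IsSmoothSection.continuous_hSq h hψ.1.1).measurable).aemeasurable)).1 hψ.2

theorem mem_formCore_iff (hf : Measurable f) : ψ ∈ formCore h f ↔ IsTestSection n ψ ∧
    Integrable (fun x => f⁺ x * hSq h ψ x) (volMeasure n M) :=
  ⟨fun hψ => ⟨hψ.1, integrable_posPart_of_mem hf hψ⟩, fun hψ => ⟨hψ.1,
    (potentialENN_lt_top_iff h (posPart_apply_nonneg f) hψ.2.aemeasurable).2 hψ.2⟩⟩

theorem isLinSet_formCore (hf : Measurable f) : IsLinSet (formCore h f) := by
  intro u hu v hv t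
  have hs := isLinSet_test u hu.1 v hv.1 t
  refine (mem_formCore_iff hf).2 ⟨hs, ?_⟩
  refine (((integrable_posPart_of_mem hf hu).const_mul 2).add
    ((integrable_posPart_of_mem hf hv).const_mul (2 * t ^ 2))).mono'
    ((measurable_posPart hf).mul
      (IsSmoothSection.continuous_hSq h hs.1).measurable).aestronglyMeasurable
    (ae_of_all _ fun x => ?_)
  rw [Real.norm_eq_abs, abs_of_nonneg (mul_nonneg (posPart_apply_nonneg f x) (hSq_nonneg h _ x))]
  calc _ ≤ f⁺ x * (2 * hSq h u x + 2 * t ^ 2 * hSq h v x) :=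
        mul_le_mul_of_nonneg_left (hSq_add_smul_le h u v t x) (posPart_apply_nonneg f x)
    _ = _ := by
        simp only [Pi.add_apply]
        ring

theorem isQuadOn_bochnerSchrodinger (hK : IsKahler n M) (hf : Measurable f) :
    IsQuadOn (formCore h f) (bochnerSchrodinger h D f⁺) :=
  (((isQuadOn_bochnerForm hK).mono fun _ hu => hu.1).const_mul D).add
    (isQuadOn_potential (isLinSet_formCore hf) _ fun _ hu => integrable_posPart_of_mem hf hu)

theorem bochnerSchrodinger_nonneg (hD : 0 < D) (ψ : Π x, L x) : 0 ≤ bochnerSchrodinger h D f⁺ ψ :=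
  add_nonneg (mul_nonneg hD.le (bochnerForm_nonneg ψ)) (potential_nonneg (posPart_apply_nonneg f) ψ)

theorem integrable_of_eq_sub
    (h1 : Integrable (fun x => f⁺ x * hSq h ψ x) (volMeasure n M))
    (h2 : Integrable (fun x => f⁻ x * hSq h ψ x) (volMeasure n M)) :
    Integrable (fun x => f x * hSq h ψ x) (volMeasure n M) := by
  refine (h1.sub h2).congr (ae_of_all _ fun x => ?_)
  simp only [Pi.sub_apply]
  rw [← sub_mul, posPart_apply_sub_negPart]

theorem potential_eq_sub
    (h1 : Integrable (fun x => f⁺ x * hSq h ψ x) (volMeasure n M))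
    (h2 : Integrable (fun x => f⁻ x * hSq h ψ x) (volMeasure n M)) :
    potential h f ψ = potential h f⁺ ψ - potential h f⁻ ψ := by
  rw [potential, potential, potential, ← integral_sub h1 h2]
  refine integral_congr_ae (ae_of_all _ fun x => ?_)
  simp only
  rw [← sub_mul, posPart_apply_sub_negPart]

/-- By the Weitzenböck formula, the holomorphic Schrödinger form is a perturbation of
the Bochner Schrödinger form by `f⁻ - D ρ`. -/
theorem holSchrodinger_eq (hK : IsKahler n M) (hf : Measurable f) (hψ : ψ ∈ formCore h f)
    (hi : Integrable (fun x => f⁻ x * hSq h ψ x) (volMeasure n M)) :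
    holSchrodinger h (2 * D) f ψ = bochnerSchrodinger h D f⁺ ψ
      - (potential h f⁻ ψ - potential h (fun x => D * rho h x) ψ) := by
  have h1 := IsTestSection.two_mul_holForm (h := h) hK hψ.1
  have h2 : potential h (fun x => D * rho h x) ψ = D * potential h (rho h) ψ := by
    rw [potential, potential, ← integral_const_mul]
    simp only [mul_assoc]
  rw [holSchrodinger, bochnerSchrodinger, potential_eq_sub (integrable_posPart_of_mem hf hψ) hi, h2]
  linear_combination D * h1

variable {c₁ c₂ a b κ b' : ℝ}

theorem integrable_negPart_of_mem (hf : Measurable f)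
    (hneg : ∀ ψ ∈ formCore h f, potentialENN h f⁻ ψ ≤
      ENNReal.ofReal (c₁ * bochnerSchrodinger h D f⁺ ψ + c₂ * normSq h ψ)) (hψ : ψ ∈ formCore h f) :
    Integrable (fun x => f⁻ x * hSq h ψ x) (volMeasure n M) :=
  (potentialENN_lt_top_iff h (negPart_apply_nonneg f) (((measurable_negPart hf).mul
    (IsSmoothSection.continuous_hSq h hψ.1.1).measurable).aemeasurable)).1
    ((hneg ψ hψ).trans_lt ENNReal.ofReal_lt_top)

/-- The lower bound of the holomorphic Schrödinger form on the core. -/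
theorem le_holSchrodinger (hK : IsKahler n M) (hf : Measurable f)
    (hneg : ∀ ψ ∈ formCore h f, potentialENN h f⁻ ψ ≤
      ENNReal.ofReal (c₁ * bochnerSchrodinger h D f⁺ ψ + c₂ * normSq h ψ))
    (hjoint : ∀ ψ ∈ formCore h f,
      potential h f⁻ ψ - potential h (fun x => D * rho h x) ψ ≤
      κ * bochnerSchrodinger h D f⁺ ψ + b' * normSq h ψ) (hψ : ψ ∈ formCore h f) :
    (1 - κ) * bochnerSchrodinger h D f⁺ ψ - b' * normSq h ψ ≤ holSchrodinger h (2 * D) f ψ := by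
  rw [holSchrodinger_eq hK hf hψ (integrable_negPart_of_mem hf hneg hψ)]
  linarith [hjoint ψ hψ]

/-- The holomorphic Schrödinger form is bounded with respect to the form norm and bounded from below
by `-b'` on the core; both properties pass to limits. -/
theorem semibounded_holSchrodinger (hK : IsKahler n M) (hD : 0 < D) (hf : Measurable f)
    (hneg : ∀ ψ ∈ formCore h f, potentialENN h f⁻ ψ ≤
      ENNReal.ofReal (c₁ * bochnerSchrodinger h D f⁺ ψ + c₂ * normSq h ψ))
    (hrho : ∀ ψ ∈ formCore h f, |potential h (fun x => D * rho h x) ψ| ≤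
      a * bochnerSchrodinger h D f⁺ ψ + b * normSq h ψ)
    (hκ : κ < 1)
    (hjoint : ∀ ψ ∈ formCore h f,
      potential h f⁻ ψ - potential h (fun x => D * rho h x) ψ ≤
      κ * bochnerSchrodinger h D f⁺ ψ + b' * normSq h ψ) :
    ∃ c : ℝ, ∀ ψ ∈ formDomain h D f, ∀ u, FormApprox h D f ψ u →
      ∃ s : ℝ, Tendsto (fun l => holSchrodinger h (2 * D) f (u l)) atTop (𝓝 s) ∧
        c * normSq h ψ ≤ s := by
  refine ⟨-b', fun ψ _ u hu => ?_⟩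
  obtain ⟨hψ, hcore, hlim, hcauchy⟩ := hu
  have hS := isLinSet_formCore (h := h) hf
  have hml2 : ∀ l, MemL2 h (u l) := fun l => (hcore l).1.memL2 hK
  set N : (Π x, L x) → ℝ := fun v => bochnerSchrodinger h D f⁺ v + normSq h v with hN
  have hNq : IsQuadOn (formCore h f) N := (isQuadOn_bochnerSchrodinger hK hf).add
    ((isQuadOn_normSq h).mono fun _ hu => hu.1.memL2 hK)
  have hS0 : ∀ v, 0 ≤ bochnerSchrodinger h D f⁺ v := bochnerSchrodinger_nonneg hD
  have hn0 : ∀ v, 0 ≤ normSq h v := normSq_nonneg h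
  have hqq : IsQuadOn (formCore h f) (holSchrodinger h (2 * D) f) :=
    (((isQuadOn_holForm hK).mono fun _ hu => hu.1).const_mul (2 * D)).add
      (isQuadOn_potential hS _ fun _ hu => integrable_of_eq_sub (integrable_posPart_of_mem hf hu)
        (integrable_negPart_of_mem hf hneg hu))
  have hlow : ∀ v ∈ formCore h f, -b' * normSq h v ≤ holSchrodinger h (2 * D) f v := fun v hv => by
    have h1 := le_holSchrodinger hK hf hneg hjoint hv
    have := mul_nonneg (sub_nonneg.2 hκ.le) (hS0 v)
    linarith
  have hbd : ∀ v ∈ formCore h f, |holSchrodinger h (2 * D) f v| ≤ (1 + |a| + |b| + |b'|) * N v := by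
    intro v hv
    have h1 := holSchrodinger_eq (D := D) hK hf hv (integrable_negPart_of_mem hf hneg hv)
    have h2 := (le_abs_self _).trans (hrho v hv)
    have h3 := potential_nonneg (h := h) (negPart_apply_nonneg f) v
    have h4 := hlow v hv
    have h5 : a * bochnerSchrodinger h D f⁺ v ≤ |a| * bochnerSchrodinger h D f⁺ v :=
      mul_le_mul_of_nonneg_right (le_abs_self a) (hS0 v)
    have h6 : b * normSq h v ≤ |b| * normSq h v :=
      mul_le_mul_of_nonneg_right (le_abs_self b) (hn0 v)
    have h7 : b' * normSq h v ≤ |b'| * normSq h v :=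
      mul_le_mul_of_nonneg_right (le_abs_self b') (hn0 v)
    have p1 := mul_nonneg (abs_nonneg a) (hS0 v)
    have p2 := mul_nonneg (abs_nonneg b) (hS0 v)
    have p3 := mul_nonneg (abs_nonneg b') (hS0 v)
    have p4 := mul_nonneg (abs_nonneg a) (hn0 v)
    have p5 := mul_nonneg (abs_nonneg b) (hn0 v)
    have p6 := mul_nonneg (abs_nonneg b') (hn0 v)
    have p7 := hS0 v
    have p8 := hn0 v
    have h8 : (1 + |a| + |b| + |b'|) * N v = bochnerSchrodinger h D f⁺ v + normSq h v
        + |a| * bochnerSchrodinger h D f⁺ v + |a| * normSq h v + |b| * bochnerSchrodinger h D f⁺ v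
        + |b| * normSq h v + |b'| * bochnerSchrodinger h D f⁺ v + |b'| * normSq h v := by
      simp only [hN]
      ring
    rw [h8, abs_le]
    constructor <;> linarith
  -- the sequence is Cauchy in the form norm, since it converges in `L²`
  have hNcauchy : ∀ ε > 0, ∃ l₀, ∀ k ≥ l₀, ∀ l ≥ l₀, N (u k - u l) < ε := by
    intro ε hε
    obtain ⟨l₁, hl₁⟩ := hcauchy (ε / 2) (by positivity)
    obtain ⟨l₂, hl₂⟩ := eventually_atTop.1 (hlim.eventually_lt_const (show 0 < ε / 8 by positivity))
    refine ⟨max l₁ l₂, fun k hk l hl => ?_⟩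
    have h1 := hl₁ k ((le_max_left _ _).trans hk) l ((le_max_left _ _).trans hl)
    have h2 := (isQuadOn_normSq h).sub_le (isLinSet_memL2 h) (fun v _ => hn0 v)
      ((isLinSet_memL2 h).sub_mem (hml2 k) hψ) ((isLinSet_memL2 h).sub_mem (hml2 l) hψ)
    rw [sub_sub_sub_cancel_right] at h2
    have h3 := hl₂ k ((le_max_right _ _).trans hk)
    have h4 := hl₂ l ((le_max_right _ _).trans hl)
    simp only [hN]
    linarith
  obtain ⟨s, hs⟩ := hqq.exists_tendsto hS hNq hbd (by positivity)
    (fun v _ => add_nonneg (hS0 v) (hn0 v)) hcore hNcauchy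
  refine ⟨s, hs, ?_⟩
  have hnorm : Tendsto (fun l => normSq h (u l)) atTop (𝓝 (normSq h ψ)) :=
    (isQuadOn_normSq h).tendsto (isLinSet_memL2 h) (isQuadOn_normSq h) (C := 1)
      (fun v _ => by rw [one_mul, abs_of_nonneg (hn0 v)]) zero_le_one (fun v _ => hn0 v) hml2 hψ
      hlim
  exact le_of_tendsto_of_tendsto (hnorm.const_mul (-b')) hs
    (Eventually.of_forall fun l => hlow _ (hcore l))

end Core

/-! ### The Berezin–Toeplitz form -/

section Toeplitz

variable {n : ℕ} {M : Type*} [MetricSpace M] [ChartedSpace (Cn n) M]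
  [IsManifold 𝓘(ℂ, Cn n) ω M] [SecondCountableTopology M] [MeasurableSpace M] [BorelSpace M]
  [RiemannianBundle (fun x : M => TangentSpace 𝓘(ℝ, Cn n) x)]
  [IsContMDiffRiemannianBundle 𝓘(ℝ, Cn n) ∞ (Cn n)
      (fun x : M => TangentSpace 𝓘(ℝ, Cn n) x)]
  {L : M → Type*} [∀ x, AddCommGroup (L x)] [∀ x, Module ℂ (L x)] [∀ x, TopologicalSpace (L x)]
  [TopologicalSpace (TotalSpace ℂ L)] [FiberBundle ℂ L] [VectorBundle ℂ ℂ L]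
  [ContMDiffVectorBundle ω ℂ L 𝓘(ℂ, Cn n)]
  {h : HermitianMetric n L} {ψ φ : Π x, L x} {f : M → ℝ} {D : ℝ} {x₀ x : M}

/-- Holomorphic sections are annihilated by the antiholomorphic derivatives. -/
theorem IsHolomorphicSection.nab_add_I (hψ : IsHolomorphicSection n ψ) (x : M) (v : Cn n) :
    nab h ψ x v + Complex.I • nab h ψ x (Complex.I • v) = 0 := by
  have h1 : ∀ w : Cn n, nab h ψ x w = (fderiv ℝ (loc ψ x) (chartAt (Cn n) x x) w
      + connForm h x (chartAt (Cn n) x x) w * coord ψ x x) • frame L x x := fun w => rfl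
  have hx := chart_mem_bdom (mem_bset_self (L := L) (n := n) x)
  have hd : DifferentiableAt ℂ (loc ψ x) (chartAt (Cn n) x x) :=
    (hψ.differentiableOn_loc x).differentiableAt ((isOpen_bdom x).mem_nhds hx)
  have hII : Complex.I • Complex.I • v = -v := by
    rw [smul_smul, Complex.I_mul_I, neg_one_smul]
  rw [h1, h1, hd.fderiv_real_smul, smul_smul, ← add_smul]
  have h2 : fderiv ℝ (loc ψ x) (chartAt (Cn n) x x) v
      + connForm h x (chartAt (Cn n) x x) v * coord ψ x x
      + Complex.I * (Complex.I • fderiv ℝ (loc ψ x) (chartAt (Cn n) x x) v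
      + connForm h x (chartAt (Cn n) x x) (Complex.I • v) * coord ψ x x) = 0 := by
    simp only [connForm, hII, map_neg, smul_eq_mul]
    push_cast
    linear_combination (fderiv ℝ (loc ψ x) (chartAt (Cn n) x x) v
      + (fderiv ℝ (logH h x) (chartAt (Cn n) x x) v : ℂ) * coord ψ x x / 2) * Complex.I_mul_I
  rw [h2, zero_smul]

/-- For a holomorphic section `ψ` only the derivative of the cutoff function enters into
`∇_{e + i J e} (χ ψ)`. -/
theorem trace01_rsmul_le (hK : IsKahler n M) (hψ : IsHolomorphicSection n ψ) {χ : M → ℝ}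
    (hχ : ContMDiff 𝓘(ℝ, Cn n) 𝓘(ℝ, ℝ) ∞ χ) {ε : ℝ}
    (hd : ∀ v : Cn n, |dfun χ x v| ≤ ε * √(gForm x v v)) :
    trace01 h (rsmul χ ψ) x ≤ n * ε ^ 2 * hSq h ψ x := by
  have hg := isHermitianForm_gForm hK x
  have hu := unitaryFor_uFrame hK x
  have hterm : ∀ k, 2⁻¹ * (h.toFun x
      (nab h (rsmul χ ψ) x (uFrame x k) + Complex.I • nab h (rsmul χ ψ) x (Complex.I • uFrame x k))
      (nab h (rsmul χ ψ) x (uFrame x k)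
        + Complex.I • nab h (rsmul χ ψ) x (Complex.I • uFrame x k))).re ≤ ε ^ 2 * hSq h ψ x := by
    intro k
    have h1 : nab h (rsmul χ ψ) x (uFrame x k)
        + Complex.I • nab h (rsmul χ ψ) x (Complex.I • uFrame x k)
        = ((dfun χ x (uFrame x k) : ℂ)
          + Complex.I * (dfun χ x (Complex.I • uFrame x k) : ℂ)) • ψ x := by
      rw [nab_rsmul h hχ hψ.isSmoothSection, nab_rsmul h hχ hψ.isSmoothSection]
      have h2 := congrArg ((χ x : ℂ) • ·) (hψ.nab_add_I (h := h) x (uFrame x k))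
      simp only [smul_add, smul_zero] at h2
      rw [smul_comm] at h2
      rw [smul_add, add_smul, smul_smul Complex.I (dfun χ x (Complex.I • uFrame x k) : ℂ)]
      calc _ = ((χ x : ℂ) • nab h ψ x (uFrame x k)
            + Complex.I • (χ x : ℂ) • nab h ψ x (Complex.I • uFrame x k))
            + ((dfun χ x (uFrame x k) : ℂ) • ψ x
            + (Complex.I * (dfun χ x (Complex.I • uFrame x k) : ℂ)) • ψ x) := by abel
        _ = _ := by rw [h2, zero_add]
    have h3 : gForm x (uFrame x k) (uFrame x k) = 1 := by simpa using (hu k k).1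
    have h4 : gForm x (Complex.I • uFrame x k) (Complex.I • uFrame x k) = 1 := by
      rw [hg.smul_I, h3]
    have h5 := hd (uFrame x k)
    have h6 := hd (Complex.I • uFrame x k)
    rw [h3, Real.sqrt_one, mul_one] at h5
    rw [h4, Real.sqrt_one, mul_one] at h6
    rw [h1, hSq_smul, Complex.sq_norm, Complex.normSq_apply, ← mul_assoc]
    refine mul_le_mul_of_nonneg_right ?_ (hSq_nonneg h ψ x)
    have h7 := sq_le_sq' (abs_le.1 h5).1 (abs_le.1 h5).2
    have h8 := sq_le_sq' (abs_le.1 h6).1 (abs_le.1 h6).2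
    simp
    linarith
  rw [trace01_eq_sum]
  calc _ ≤ ∑ _k : Fin n, ε ^ 2 * hSq h ψ x := Finset.sum_le_sum fun k _ => hterm k
    _ = _ := by
      rw [Finset.sum_const, Finset.card_univ, Fintype.card_fin, nsmul_eq_mul]
      ring

/-- The diagonal values of the Berezin–Toeplitz form are real. -/
theorem toeplitzForm_re (f : M → ℝ) (ψ : Π x, L x) :
    (toeplitzForm h f ψ ψ).re = potential h f ψ := by
  have h1 : ∀ x, (f x : ℂ) * hProd h ψ ψ x = ((f x * hSq h ψ x : ℝ) : ℂ) := by
    intro x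
    have h2 : (h.toFun x (ψ x) (ψ x)).im = 0 := Complex.conj_eq_iff_im.1 (h.conj_symm x _ _)
    rw [Complex.ofReal_mul]
    congr 1
    exact Complex.ext rfl h2
  rw [toeplitzForm]
  simp only [h1]
  exact (congrArg Complex.re (integral_ofReal (𝕜 := ℂ) (f := fun x => f x * hSq h ψ x))).trans
    (Complex.ofReal_re _)

theorem mem_toeplitzDomain_iff (hf : Measurable f) : ψ ∈ toeplitzDomain h f ↔
    IsHolomorphicSection n ψ ∧ Integrable (hSq h ψ) (volMeasure n M) ∧
      Integrable (fun x => |f x| * hSq h ψ x) (volMeasure n M) := by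
  have hm : IsHolomorphicSection n ψ → AEMeasurable (fun x => |f x| * hSq h ψ x) (volMeasure n M) :=
    fun hψ => ((continuous_abs.measurable.comp hf).mul
      (hψ.isSmoothSection.continuous_hSq h).measurable).aemeasurable
  constructor
  · rintro ⟨h1, h2, h3⟩
    exact ⟨h1, h2.integrable_hSq h,
      (potentialENN_lt_top_iff h (fun x => abs_nonneg _) (hm h1)).1 h3⟩
  · rintro ⟨h1, h2, h3⟩
    exact ⟨h1, memL2_of_integrable h h1.isSmoothSection.aemeasurable_coord h2,
      (potentialENN_lt_top_iff h (fun x => abs_nonneg _) (hm h1)).2 h3⟩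

theorem isLinSet_holomorphic : IsLinSet {ψ : Π x, L x | IsHolomorphicSection n ψ} := by
  intro u hu v hv t
  refine isHolomorphicSection_of_loc fun x => ?_
  have hx := chart_mem_bdom (mem_bset_self (L := L) (n := n) x)
  have hd : ∀ {w : Π x, L x}, IsHolomorphicSection n w →
      DifferentiableAt ℂ (loc w x) (chartAt (Cn n) x x) := fun hw =>
    (hw.differentiableOn_loc x).differentiableAt ((isOpen_bdom x).mem_nhds hx)
  refine ((hd hu).add ((hd hv).const_mul (t : ℂ))).congr_of_eventuallyEq ?_
  refine loc_eventuallyEq_of_bdom hx fun z hz => ?_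
  have h1 : loc ((t : ℂ) • v) x z = t * loc v x z := loc_rsmul (fun _ => t) hz
  rw [loc_add hz, h1]
  rfl

theorem isLinSet_toeplitzDomain (hf : Measurable f) : IsLinSet (toeplitzDomain h f) := by
  intro u hu v hv t
  obtain ⟨hu1, hu2, hu3⟩ := (mem_toeplitzDomain_iff hf).1 hu
  obtain ⟨hv1, hv2, hv3⟩ := (mem_toeplitzDomain_iff hf).1 hv
  have hs := isLinSet_holomorphic u hu1 v hv1 t
  have hc := (hs.isSmoothSection.continuous_hSq h).measurable
  refine (mem_toeplitzDomain_iff hf).2 ⟨hs, ?_, ?_⟩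
  · refine ((hu2.const_mul 2).add (hv2.const_mul (2 * t ^ 2))).mono' hc.aestronglyMeasurable
      (ae_of_all _ fun x => ?_)
    rw [Real.norm_eq_abs, abs_of_nonneg (hSq_nonneg h _ x)]
    exact hSq_add_smul_le h u v t x
  · refine ((hu3.const_mul 2).add (hv3.const_mul (2 * t ^ 2))).mono'
      ((continuous_abs.measurable.comp hf).mul hc).aestronglyMeasurable (ae_of_all _ fun x => ?_)
    rw [Real.norm_eq_abs, abs_of_nonneg (mul_nonneg (abs_nonneg _) (hSq_nonneg h _ x))]
    calc _ ≤ |f x| * (2 * hSq h u x + 2 * t ^ 2 * hSq h v x) :=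
          mul_le_mul_of_nonneg_left (hSq_add_smul_le h u v t x) (abs_nonneg _)
      _ = _ := by
          simp only [Pi.add_apply]
          ring

theorem integrable_of_abs {q : M → ℝ} (hq : Measurable q) (hqf : ∀ x, |q x| ≤ |f x|)
    (hψ : IsSmoothSection n ψ) (hi : Integrable (fun x => |f x| * hSq h ψ x) (volMeasure n M)) :
    Integrable (fun x => q x * hSq h ψ x) (volMeasure n M) := by
  refine hi.mono' (hq.mul (hψ.continuous_hSq h).measurable).aestronglyMeasurable
    (ae_of_all _ fun x => ?_)
  rw [norm_mul, Real.norm_eq_abs, Real.norm_eq_abs, abs_of_nonneg (hSq_nonneg h ψ x)]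
  exact mul_le_mul_of_nonneg_right (hqf x) (hSq_nonneg h ψ x)

theorem abs_posPart_le (f : M → ℝ) (x : M) : |f⁺ x| ≤ |f x| := by
  rw [abs_of_nonneg (posPart_apply_nonneg f x)]
  linarith [posPart_apply_add_negPart f x, negPart_apply_nonneg f x]

/-- Dominated convergence, for the bounded cutoff functions of `exists_cutoff`. -/
theorem tendsto_integral_cutoff {χ : ℕ → M → ℝ} (hχc : ∀ k, Continuous (χ k))
    (hχ2 : ∀ k x, |χ k x| ≤ 2) (hχ1 : ∀ x, Tendsto (fun k => χ k x) atTop (𝓝 1)) {F : M → ℝ}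
    (hF : Integrable F (volMeasure n M)) :
    Tendsto (fun k => ∫ x, χ k x ^ 2 * F x ∂volMeasure n M) atTop
      (𝓝 (∫ x, F x ∂volMeasure n M)) := by
  refine tendsto_integral_of_dominated_convergence (fun x => 4 * |F x|)
    (fun k => ((hχc k).pow 2).aestronglyMeasurable.mul hF.aestronglyMeasurable)
    (hF.abs.const_mul 4) (fun k => ae_of_all _ fun x => ?_) (ae_of_all _ fun x => ?_)
  · rw [norm_mul, norm_pow, Real.norm_eq_abs, Real.norm_eq_abs]
    refine mul_le_mul_of_nonneg_right ?_ (abs_nonneg _)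
    have := pow_le_pow_left₀ (abs_nonneg (χ k x)) (hχ2 k x) 2
    linarith
  · simpa using ((hχ1 x).pow 2).mul_const (F x)

theorem potential_rsmul (q χ : M → ℝ) (ψ : Π x, L x) :
    potential h q (rsmul χ ψ) = ∫ x, χ x ^ 2 * (q x * hSq h ψ x) ∂volMeasure n M := by
  rw [potential]
  refine integral_congr_ae (ae_of_all _ fun x => ?_)
  simp only [hSq_rsmul]
  ring

theorem normSq_rsmul (χ : M → ℝ) (ψ : Π x, L x) :
    normSq h (rsmul χ ψ) = ∫ x, χ x ^ 2 * hSq h ψ x ∂volMeasure n M :=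
  integral_congr_ae (ae_of_all _ fun x => hSq_rsmul h χ ψ x)

variable [IsRiemannianManifold 𝓘(ℝ, Cn n) M] {c₁ c₂ κ b' : ℝ}

/-- The lower bound of the Berezin–Toeplitz form: the holomorphic Schrödinger form of the
truncations `χ ψ` converges to the Berezin–Toeplitz form of `ψ`. -/
theorem le_potential_of_mem [CompleteSpace M] [Nonempty M] (hK : IsKahler n M) (hD : 0 < D)
    (hf : Measurable f)
    (hneg : ∀ ψ ∈ formCore h f, potentialENN h f⁻ ψ ≤
      ENNReal.ofReal (c₁ * bochnerSchrodinger h D f⁺ ψ + c₂ * normSq h ψ))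
    (hκ : κ < 1)
    (hjoint : ∀ ψ ∈ formCore h f,
      potential h f⁻ ψ - potential h (fun x => D * rho h x) ψ ≤
      κ * bochnerSchrodinger h D f⁺ ψ + b' * normSq h ψ) (hψ : ψ ∈ toeplitzDomain h f) :
    (1 - κ) * potential h f⁺ ψ - b' * normSq h ψ ≤ potential h f ψ := by
  have : LocallyCompactSpace M := ChartedSpace.locallyCompactSpace (Cn n) M
  obtain ⟨h1, h2, h3⟩ := (mem_toeplitzDomain_iff hf).1 hψ
  have hs := h1.isSmoothSection
  obtain ⟨o⟩ := ‹Nonempty M›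
  have hl : ∀ k : ℕ, (1 : ℝ) ≤ k + 1 := fun k => by
    have := Nat.cast_nonneg (α := ℝ) k
    linarith
  choose χ hχs hχc hχ2 hχ1 hχd using fun k : ℕ => exists_cutoff hK o (hl k)
  have hχcont : ∀ k, Continuous (χ k) := fun k => (hχs k).continuous
  have hχlim : ∀ x, Tendsto (fun k => χ k x) atTop (𝓝 1) := by
    intro x
    refine tendsto_iff_dist_tendsto_zero.2 ?_
    refine squeeze_zero' (Eventually.of_forall fun k => dist_nonneg) ?_
      tendsto_one_div_add_atTop_nhds_zero_nat
    obtain ⟨k₀, hk₀⟩ := exists_nat_ge (dist o x)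
    filter_upwards [eventually_ge_atTop k₀] with k hk
    have h5 : (k₀ : ℝ) ≤ k := Nat.cast_le.2 hk
    exact hχ1 k x (by linarith)
  have ip : Integrable (fun x => f⁺ x * hSq h ψ x) (volMeasure n M) :=
    integrable_of_abs (measurable_posPart hf) (abs_posPart_le f) hs h3
  have ifi : Integrable (fun x => f x * hSq h ψ x) (volMeasure n M) :=
    integrable_of_abs hf (fun _ => le_rfl) hs h3
  have hcore : ∀ k, rsmul (χ k) ψ ∈ formCore h f := by
    intro k
    have ht : IsTestSection n (rsmul (χ k) ψ) := ⟨IsSmoothSection.rsmul (hχs k) hs,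
      (hχc k).isCompact.of_isClosed_subset isClosed_closure
        ((closure_rsmul_subset _ _).trans inter_subset_left)⟩
    refine (mem_formCore_iff hf).2 ⟨ht, (ip.const_mul 4).mono'
      ((measurable_posPart hf).mul
        (IsSmoothSection.continuous_hSq h ht.1).measurable).aestronglyMeasurable
      (ae_of_all _ fun x => ?_)⟩
    rw [Real.norm_eq_abs, abs_of_nonneg (mul_nonneg (posPart_apply_nonneg f x) (hSq_nonneg h _ x)),
      hSq_rsmul]
    have h5 : χ k x ^ 2 ≤ 4 := by
      have := sq_le_sq' (abs_le.1 (hχ2 k x)).1 (abs_le.1 (hχ2 k x)).2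
      linarith
    have h6 := mul_nonneg (posPart_apply_nonneg f x) (hSq_nonneg h ψ x)
    nlinarith
  -- since `ψ` is holomorphic, the kinetic energy of `χ ψ` is at most a multiple of `‖dχ‖² ‖ψ‖²`
  have hhol : Tendsto (fun k => holForm h (rsmul (χ k) ψ)) atTop (𝓝 0) := by
    have hb : ∀ k : ℕ, holForm h (rsmul (χ k) ψ)
        ≤ 9 * n * normSq h ψ * (1 / ((k : ℝ) + 1)) ^ 2 := by
      intro k
      calc holForm h (rsmul (χ k) ψ)
          ≤ ∫ x, n * (3 / ((k : ℝ) + 1)) ^ 2 * hSq h ψ x ∂volMeasure n M :=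
            integral_mono ((hcore k).1.integrable_trace01 hK) (h2.const_mul _) fun x =>
              trace01_rsmul_le hK h1 (hχs k) (hχd k x)
        _ = _ := by
            rw [integral_const_mul, normSq]
            ring
    refine squeeze_zero (fun k => holForm_nonneg _) hb ?_
    have := (tendsto_one_div_add_atTop_nhds_zero_nat (𝕜 := ℝ)).pow 2
    simpa using this.const_mul (9 * n * normSq h ψ)
  have l1 : Tendsto (fun k => potential h f (rsmul (χ k) ψ)) atTop (𝓝 (potential h f ψ)) := by
    simp only [potential_rsmul]
    exact tendsto_integral_cutoff hχcont hχ2 hχlim ifi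
  have l2 : Tendsto (fun k => potential h f⁺ (rsmul (χ k) ψ)) atTop (𝓝 (potential h f⁺ ψ)) := by
    simp only [potential_rsmul]
    exact tendsto_integral_cutoff hχcont hχ2 hχlim ip
  have l3 : Tendsto (fun k => normSq h (rsmul (χ k) ψ)) atTop (𝓝 (normSq h ψ)) := by
    simp only [normSq_rsmul]
    exact tendsto_integral_cutoff hχcont hχ2 hχlim h2
  have l4 : Tendsto (fun k => holSchrodinger h (2 * D) f (rsmul (χ k) ψ)) atTop
      (𝓝 (2 * D * 0 + potential h f ψ)) := (hhol.const_mul (2 * D)).add l1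
  rw [mul_zero, zero_add] at l4
  refine le_of_tendsto_of_tendsto ((l2.const_mul (1 - κ)).sub (l3.const_mul b')) l4
    (Eventually.of_forall fun k => ?_)
  refine le_trans ?_ (le_holSchrodinger hK hf hneg hjoint (hcore k))
  have h5 : potential h f⁺ (rsmul (χ k) ψ) ≤ bochnerSchrodinger h D f⁺ (rsmul (χ k) ψ) :=
    le_add_of_nonneg_left (mul_nonneg hD.le (bochnerForm_nonneg _))
  have h6 := mul_le_mul_of_nonneg_left h5 (sub_nonneg.2 hκ.le)
  simp only
  linarith

end Toeplitz

/-! ### Closedness of the Berezin–Toeplitz form -/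

section Closed

variable {n : ℕ} {M : Type*} [MetricSpace M] [ChartedSpace (Cn n) M]
  [IsManifold 𝓘(ℂ, Cn n) ω M] [SecondCountableTopology M] [MeasurableSpace M] [BorelSpace M]
  [RiemannianBundle (fun x : M => TangentSpace 𝓘(ℝ, Cn n) x)]
  [IsContMDiffRiemannianBundle 𝓘(ℝ, Cn n) ∞ (Cn n)
      (fun x : M => TangentSpace 𝓘(ℝ, Cn n) x)]
  {L : M → Type*} [∀ x, AddCommGroup (L x)] [∀ x, Module ℂ (L x)] [∀ x, TopologicalSpace (L x)]
  [TopologicalSpace (TotalSpace ℂ L)] [FiberBundle ℂ L] [VectorBundle ℂ ℂ L]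
  [ContMDiffVectorBundle ω ℂ L 𝓘(ℂ, Cn n)]
  {h : HermitianMetric n L} {ψ : Π x, L x} {f : M → ℝ} {D : ℝ} {x₀ : M}

/-- Point evaluations are bounded on `L²_hol`, locally uniformly: this is the sub-mean-value
property of `|ψ|²` in a holomorphic frame. -/
theorem exists_norm_loc_sq_le (hK : IsKahler n M) {y : Cn n} (hy : y ∈ bdom n L x₀) :
    ∃ r > 0, ∃ K, 0 ≤ K ∧ Metric.ball y r ⊆ bdom n L x₀ ∧ ∀ v : Π x, L x,
      IsHolomorphicSection n v → Integrable (hSq h v) (volMeasure n M) →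
        ∀ z ∈ Metric.ball y r, ‖loc v x₀ z‖ ^ 2 ≤ K * normSq h v := by
  obtain ⟨R, hR, hRs⟩ := Metric.nhds_basis_closedBall.mem_iff.1 ((isOpen_bdom x₀).mem_nhds hy)
  have hc : ContinuousOn (fun z => volDensity x₀ z * hFrame h x₀ z) (Metric.closedBall y R) :=
    ((continuousOn_volDensity hK x₀).mono fun z hz => (hRs hz).1).mul
      ((contDiffOn_hFrame h x₀).continuousOn.mono hRs)
  obtain ⟨z₀, hz₀, hmin⟩ := (isCompact_closedBall y R).exists_isMinOn
    (Metric.nonempty_closedBall.2 hR.le) hc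
  -- `m` bounds the weight of the `L²` norm from below in the chart and frame at `x₀`
  set m := volDensity x₀ z₀ * hFrame h x₀ z₀ with hm
  have hm0 : 0 < m := mul_pos (volDensity_pos hK (hRs hz₀).1) (hFrame_pos h (hRs hz₀))
  have hr : 0 < R / 3 := by positivity
  set c := ∫ v : Cn n, radialBump (R / 3) v with hc'
  have hc0 : 0 < c := integral_radialBump_pos hr
  refine ⟨R / 3, hr, (c * m)⁻¹, by positivity, fun z hz => hRs ?_, fun v hv hi z hz => ?_⟩
  · rw [Metric.mem_ball] at hz
    rw [Metric.mem_closedBall]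
    linarith
  have hsub : ∀ w ∈ Metric.ball z (2 * (R / 3)), w ∈ Metric.closedBall y R := by
    intro w hw
    rw [Metric.mem_ball] at hz hw
    rw [Metric.mem_closedBall]
    have := dist_triangle w z y
    linarith
  have h1 := enorm_sq_mul_le_lintegral (y := z) (r := R / 3) (R := 2 * (R / 3))
    ((hv.differentiableOn_loc x₀).mono fun w hw => hRs (hsub w hw)) hr (by linarith)
  have h2 : ENNReal.ofReal m * ∫⁻ w in Metric.ball z (R / 3), ‖loc v x₀ w‖ₑ ^ 2
      ≤ ENNReal.ofReal (normSq h v) := by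
    have hcont := (hv.isSmoothSection.continuous_hSq h).measurable
    calc ENNReal.ofReal m * ∫⁻ w in Metric.ball z (R / 3), ‖loc v x₀ w‖ₑ ^ 2
        = ∫⁻ w in Metric.ball z (R / 3), ENNReal.ofReal m * ‖loc v x₀ w‖ₑ ^ 2 :=
          (lintegral_const_mul' _ _ ENNReal.ofReal_ne_top).symm
      _ ≤ ∫⁻ w in Metric.ball z (R / 3), ENNReal.ofReal (volDensity x₀ w)
            * ENNReal.ofReal (hSq h v ((chartAt (Cn n) x₀).symm w)) := by
          refine setLIntegral_mono' Metric.isOpen_ball.measurableSet fun w hw => ?_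
          have hw' := hsub w (Metric.ball_subset_ball (by linarith) hw)
          have hwd := hRs hw'
          rw [hSq_eq_loc h v (chart_symm_mem_bset hwd), (chartAt (Cn n) x₀).right_inv hwd.1,
            ← ENNReal.ofReal_mul (volDensity_nonneg _ _), ← ofReal_norm,
            ← ENNReal.ofReal_pow (norm_nonneg _), ← ENNReal.ofReal_mul hm0.le]
          refine ENNReal.ofReal_le_ofReal ?_
          have h3 : m ≤ volDensity x₀ w * hFrame h x₀ w := hmin hw'
          calc _ ≤ volDensity x₀ w * hFrame h x₀ w * ‖loc v x₀ w‖ ^ 2 :=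
                mul_le_mul_of_nonneg_right h3 (sq_nonneg _)
            _ = _ := by ring
      _ ≤ ∫⁻ w in (chartAt (Cn n) x₀).target, ENNReal.ofReal (volDensity x₀ w)
            * ENNReal.ofReal (hSq h v ((chartAt (Cn n) x₀).symm w)) :=
          lintegral_mono_set fun w hw =>
            (hRs (hsub w (Metric.ball_subset_ball (by linarith) hw))).1
      _ = ∫⁻ p in (chartAt (Cn n) x₀).source, ENNReal.ofReal (hSq h v p) ∂volMeasure n M :=
          (setLIntegral_chart hK x₀ hcont.ennreal_ofReal.aemeasurable).symm
      _ ≤ ∫⁻ p, ENNReal.ofReal (hSq h v p) ∂volMeasure n M := setLIntegral_le_lintegral _ _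
      _ = _ := (ofReal_integral_eq_lintegral_ofReal hi (ae_of_all _ (hSq_nonneg h v))).symm
  have h3 : ENNReal.ofReal (m * (c * ‖loc v x₀ z‖ ^ 2)) ≤ ENNReal.ofReal (normSq h v) := by
    refine le_trans ?_ h2
    rw [ENNReal.ofReal_mul hm0.le, ENNReal.ofReal_mul hc0.le, ENNReal.ofReal_pow (norm_nonneg _),
      ofReal_norm]
    exact mul_le_mul_right h1 _
  have h4 := (ENNReal.ofReal_le_ofReal_iff (normSq_nonneg h v)).1 h3
  rw [inv_mul_eq_div, le_div_iff₀ (by positivity)]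
  linarith

/-- An `L²`-Cauchy sequence of holomorphic sections converges pointwise to a holomorphic section. -/
theorem exists_holomorphic_limit (hK : IsKahler n M) {u : ℕ → Π x, L x}
    (hu : ∀ l, IsHolomorphicSection n (u l))
    (hi : ∀ k l, Integrable (hSq h (u k - u l)) (volMeasure n M))
    (hc : ∀ ε > 0, ∃ l₀, ∀ k ≥ l₀, ∀ l ≥ l₀, normSq h (u k - u l) < ε) :
    ∃ ψ : Π x, L x, IsHolomorphicSection n ψ ∧
      ∀ k x, Tendsto (fun l => hSq h (u k - u l) x) atTop (𝓝 (hSq h (u k - ψ) x)) := by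
  have hd : ∀ k l, IsHolomorphicSection n (u k - u l) := fun k l =>
    isLinSet_holomorphic.sub_mem (hu k) (hu l)
  have hloc : ∀ (x₀ : M), ∀ y ∈ bdom n L x₀, ∃ r > 0, Metric.ball y r ⊆ bdom n L x₀ ∧ ∀ ε > 0,
      ∃ l₀, ∀ k ≥ l₀, ∀ l ≥ l₀, ∀ z ∈ Metric.ball y r,
        dist (loc (u k) x₀ z) (loc (u l) x₀ z) < ε := by
    intro x₀ y hy
    obtain ⟨r, hr, K, hK0, hsub, hb⟩ := exists_norm_loc_sq_le (h := h) hK hy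
    refine ⟨r, hr, hsub, fun ε hε => ?_⟩
    obtain ⟨l₀, hl₀⟩ := hc (ε ^ 2 / (K + 1)) (by positivity)
    refine ⟨l₀, fun k hk l hl z hz => ?_⟩
    have h1 := hb _ (hd k l) (hi k l) z hz
    have h2 := hl₀ k hk l hl
    have h3 := normSq_nonneg h (u k - u l)
    rw [lt_div_iff₀ (by positivity)] at h2
    rw [loc_sub (hsub hz), ← dist_eq_norm] at h1
    refine lt_of_pow_lt_pow_left₀ 2 hε.le (h1.trans_lt ?_)
    linarith
  have hlim : ∀ x : M, ∃ a : ℂ, Tendsto (fun l => coord (u l) x x) atTop (𝓝 a) := by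
    intro x
    obtain ⟨r, hr, -, hb⟩ := hloc x _ (chart_mem_bdom (mem_bset_self (L := L) (n := n) x))
    refine cauchySeq_tendsto_of_complete (Metric.cauchySeq_iff.2 fun ε hε => ?_)
    obtain ⟨l₀, hl₀⟩ := hb ε hε
    refine ⟨l₀, fun k hk l hl => ?_⟩
    have h1 := hl₀ k hk l hl _ (Metric.mem_ball_self hr)
    rwa [loc_chart _ (mem_chart_source _ x), loc_chart _ (mem_chart_source _ x)] at h1
  -- the limit section, defined in the preferred frame at each point
  choose a ha using hlim
  set ψ : Π x, L x := fun x => a x • frame L x x with hψ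
  have hself : ∀ x : M, coord ψ x x = a x := by
    intro x
    have hx := mem_baseSet_trivializationAt ℂ L x
    have h1 := coord_smul a (fun p => frame L x p) hx
    rw [coord_frame_self hx, mul_one, coord_eq_linear _ hx] at h1
    rw [coord_eq_linear _ hx]
    exact h1
  have hcoord : ∀ x₀ p : M, p ∈ (trivializationAt ℂ L x₀).baseSet →
      Tendsto (fun l => coord (u l) x₀ p) atTop (𝓝 (coord ψ x₀ p)) := by
    intro x₀ p hp
    have hpp := mem_baseSet_trivializationAt ℂ L p
    rw [coord_eq ψ hpp hp, hself]
    exact ((ha p).const_mul _).congr fun l => (coord_eq (u l) hpp hp).symm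
  refine ⟨ψ, isHolomorphicSection_of_loc fun x => ?_, fun k x => ?_⟩
  · have hx := chart_mem_bdom (mem_bset_self (L := L) (n := n) x)
    have hT : TendstoLocallyUniformlyOn (fun l => loc (u l) x) (loc ψ x) atTop (bdom n L x) := by
      refine Metric.tendstoLocallyUniformlyOn_iff.2 fun ε hε y hy => ?_
      obtain ⟨r, hr, hsub, hb⟩ := hloc x y hy
      obtain ⟨l₀, hl₀⟩ := hb (ε / 2) (half_pos hε)
      refine ⟨Metric.ball y r, mem_nhdsWithin_of_mem_nhds (Metric.ball_mem_nhds y hr), ?_⟩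
      filter_upwards [eventually_ge_atTop l₀] with l hl z hz
      have h1 : Tendsto (fun k => loc (u k) x z) atTop (𝓝 (loc ψ x z)) :=
        hcoord x _ (chart_symm_mem_bset (hsub hz)).2
      have h2 : dist (loc ψ x z) (loc (u l) x z) ≤ ε / 2 :=
        le_of_tendsto (h1.dist tendsto_const_nhds) ((eventually_ge_atTop l₀).mono fun k hk =>
          (hl₀ k hk l hl z hz).le)
      linarith
    exact (hT.differentiableOn_Cn (isOpen_bdom x) fun k => (hu k).differentiableOn_loc x
      ).differentiableAt ((isOpen_bdom x).mem_nhds hx)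
  · have hx := mem_baseSet_trivializationAt ℂ L x
    have h1 : ∀ v : Π x, L x, hSq h (u k - v) x
        = ‖coord (u k) x x - coord v x x‖ ^ 2 * hSq h (frame L x) x := fun v => by
      rw [hSq_eq h _ hx, coord_sub _ _ hx]
    rw [h1]
    exact ((((tendsto_const_nhds.sub (hcoord x x hx)).norm).pow 2).mul_const _).congr fun l =>
      (h1 (u l)).symm

/-- Fatou's lemma for the limit of `exists_holomorphic_limit`. -/
theorem lintegral_hSq_sub_le {w : M → ℝ} (hw : Measurable w) {u : ℕ → Π x, L x} {v : Π x, L x}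
    (hd : ∀ l, IsHolomorphicSection n (v - u l)) {φ : Π x, L x}
    (hlim : ∀ x, Tendsto (fun l => hSq h (v - u l) x) atTop (𝓝 (hSq h φ x)))
    (hw0 : ∀ x, 0 ≤ w x)
    (hi : ∀ l, Integrable (fun x => w x * hSq h (v - u l) x) (volMeasure n M)) {ε : ℝ}
    (hε : ∀ᶠ l in atTop, potential h w (v - u l) ≤ ε) :
    potentialENN h w φ ≤ ENNReal.ofReal ε := by
  have h1 : ∀ x, Tendsto (fun l => ENNReal.ofReal (w x * hSq h (v - u l) x)) atTop
      (𝓝 (ENNReal.ofReal (w x * hSq h φ x))) := fun x =>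
    (ENNReal.continuous_ofReal.tendsto _).comp ((hlim x).const_mul (w x))
  calc potentialENN h w φ
      = ∫⁻ x, liminf (fun l => ENNReal.ofReal (w x * hSq h (v - u l) x)) atTop
          ∂volMeasure n M := lintegral_congr fun x => (h1 x).liminf_eq.symm
    _ ≤ liminf (fun l => ∫⁻ x, ENNReal.ofReal (w x * hSq h (v - u l) x) ∂volMeasure n M) atTop :=
        lintegral_liminf_le fun l =>
          (hw.mul ((hd l).isSmoothSection.continuous_hSq h).measurable).ennreal_ofReal
    _ ≤ ENNReal.ofReal ε := by
        refine liminf_le_of_le (by isBoundedDefault) fun b hb => ?_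
        obtain ⟨l, hl1, hl2⟩ := (hb.and hε).exists
        refine hl1.trans ?_
        rw [← ofReal_integral_eq_lintegral_ofReal (hi l)
          (ae_of_all _ fun x => mul_nonneg (hw0 x) (hSq_nonneg h _ x))]
        exact ENNReal.ofReal_le_ofReal hl2

/-- If `∫ |f| h(ψ,ψ) dm` is controlled by the form norm, then the Berezin–Toeplitz form is
closed. -/
theorem isClosedForm_toeplitz (hK : IsKahler n M) (hf : Measurable f) {c C : ℝ}
    (hlow : ∀ ψ ∈ toeplitzDomain h f, c * normSq h ψ ≤ potential h f ψ)
    (hbound : ∀ ψ ∈ toeplitzDomain h f, potential h (fun x => |f x|) ψ ≤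
      C * (potential h f ψ + (1 - c) * normSq h ψ))
    {u : ℕ → Π x, L x} (hu : ∀ l, u l ∈ toeplitzDomain h f)
    (hc : ∀ ε > 0, ∃ l₀, ∀ k ≥ l₀, ∀ l ≥ l₀,
      potential h f (u k - u l) + (1 - c) * normSq h (u k - u l) < ε) :
    ∃ ψ ∈ toeplitzDomain h f, Tendsto
      (fun l => potential h f (u l - ψ) + (1 - c) * normSq h (u l - ψ)) atTop (𝓝 0) := by
  have hlin := isLinSet_toeplitzDomain (h := h) hf
  have hd : ∀ k l, u k - u l ∈ toeplitzDomain h f := fun k l => hlin.sub_mem (hu k) (hu l)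
  have hd' := fun k l => (mem_toeplitzDomain_iff hf).1 (hd k l)
  have hE : ∀ v ∈ toeplitzDomain h f, normSq h v ≤ potential h f v + (1 - c) * normSq h v :=
    fun v hv => by linarith [hlow v hv]
  obtain ⟨ψ, hψ, hlim⟩ :=
    exists_holomorphic_limit hK (fun l => ((mem_toeplitzDomain_iff hf).1 (hu l)).1)
    (fun k l => (hd' k l).2.1) fun ε hε => by
      obtain ⟨l₀, hl₀⟩ := hc ε hε
      exact ⟨l₀, fun k hk l hl => (hE _ (hd k l)).trans_lt (hl₀ k hk l hl)⟩
  -- the form norm is equivalent to the norm of `L²` with the weight `w`,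
  -- to which Fatou's lemma applies
  set w : M → ℝ := fun x => 1 + |f x| with hw
  have hwm : Measurable w := (continuous_abs.measurable.comp hf).const_add 1
  have hw0 : ∀ x, 0 ≤ w x := fun x => by positivity
  have hwi : ∀ v ∈ toeplitzDomain h f, Integrable (fun x => w x * hSq h v x) (volMeasure n M) := by
    intro v hv
    obtain ⟨-, h2, h3⟩ := (mem_toeplitzDomain_iff hf).1 hv
    refine (h2.add h3).congr (ae_of_all _ fun x => ?_)
    simp only [hw, Pi.add_apply]
    ring
  have hwp : ∀ v ∈ toeplitzDomain h f,
      potential h w v = normSq h v + potential h (fun x => |f x|) v := by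
    intro v hv
    obtain ⟨-, h2, h3⟩ := (mem_toeplitzDomain_iff hf).1 hv
    rw [potential, normSq, potential, ← integral_add h2 h3]
    refine integral_congr_ae (ae_of_all _ fun x => ?_)
    simp only [hw]
    ring
  have hfatou : ∀ ε > 0, ∃ l₀, ∀ k ≥ l₀, potentialENN h w (u k - ψ) ≤ ENNReal.ofReal ε := by
    intro ε hε
    obtain ⟨l₀, hl₀⟩ := hc (ε / (1 + |C|)) (by positivity)
    refine ⟨l₀, fun k hk => lintegral_hSq_sub_le hwm (fun l => (hd' k l).1) (hlim k) hw0
      (fun l => hwi _ (hd k l)) ((eventually_ge_atTop l₀).mono fun l hl => ?_)⟩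
    have h1 := hl₀ k hk l hl
    have h2 := hE _ (hd k l)
    have h3 := (normSq_nonneg h _).trans h2
    have h4 := mul_le_mul_of_nonneg_right (le_abs_self C) h3
    rw [lt_div_iff₀ (by positivity)] at h1
    rw [hwp _ (hd k l)]
    linarith [hbound _ (hd k l)]
  have hmem : ∀ k, IsHolomorphicSection n (u k - ψ) := fun k =>
    isLinSet_holomorphic.sub_mem ((mem_toeplitzDomain_iff hf).1 (hu k)).1 hψ
  have hdom : ∀ k, potentialENN h w (u k - ψ) < ⊤ → u k - ψ ∈ toeplitzDomain h f := by
    intro k hk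
    have hm := (hmem k).isSmoothSection.continuous_hSq h
    have h1 := (potentialENN_lt_top_iff h hw0 (hwm.mul hm.measurable).aemeasurable).1 hk
    refine (mem_toeplitzDomain_iff hf).2 ⟨hmem k, h1.mono' hm.measurable.aestronglyMeasurable
      (ae_of_all _ fun x => ?_), h1.mono' ((continuous_abs.measurable.comp hf).mul
        hm.measurable).aestronglyMeasurable (ae_of_all _ fun x => ?_)⟩
    · rw [Real.norm_eq_abs, abs_of_nonneg (hSq_nonneg h _ x)]
      exact le_mul_of_one_le_left (hSq_nonneg h _ x) (le_add_of_nonneg_right (abs_nonneg _))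
    · rw [Real.norm_eq_abs, abs_of_nonneg (mul_nonneg (abs_nonneg _) (hSq_nonneg h _ x))]
      exact mul_le_mul_of_nonneg_right (le_add_of_nonneg_left zero_le_one) (hSq_nonneg h _ x)
  refine ⟨ψ, ?_, ?_⟩
  · obtain ⟨l₀, hl₀⟩ := hfatou 1 one_pos
    have h1 := hlin.sub_mem (hu l₀) (hdom l₀ ((hl₀ l₀ le_rfl).trans_lt ENNReal.ofReal_lt_top))
    rwa [sub_sub_cancel] at h1
  · refine Metric.tendsto_atTop.2 fun ε hε => ?_
    obtain ⟨l₀, hl₀⟩ := hfatou (ε / (2 * (1 + |1 - c|))) (by positivity)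
    refine ⟨l₀, fun k hk => ?_⟩
    have h1 := hl₀ k hk
    have h2 := hdom k (h1.trans_lt ENNReal.ofReal_lt_top)
    rw [← ofReal_potential h hw0 (hwi _ h2), ENNReal.ofReal_le_ofReal_iff (by positivity),
      hwp _ h2, le_div_iff₀ (by positivity)] at h1
    have h3 : potential h f (u k - ψ) ≤ potential h (fun x => |f x|) (u k - ψ) := by
      refine integral_mono (integrable_of_abs hf (fun _ => le_rfl) (hmem k).isSmoothSection
        ((mem_toeplitzDomain_iff hf).1 h2).2.2) ((mem_toeplitzDomain_iff hf).1 h2).2.2 fun x => ?_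
      exact mul_le_mul_of_nonneg_right (le_abs_self _) (hSq_nonneg h _ x)
    have h4 := normSq_nonneg h (u k - ψ)
    have h5 := h4.trans (hE _ h2)
    have h6 : 0 ≤ potential h (fun x => |f x|) (u k - ψ) :=
      potential_nonneg (fun x => abs_nonneg _) _
    have h7 := mul_le_mul_of_nonneg_right (le_abs_self (1 - c)) h4
    have h8 := mul_nonneg (abs_nonneg (1 - c)) h6
    rw [Real.dist_eq, sub_zero, abs_of_nonneg h5]
    linarith

theorem potential_abs_eq (hf : Measurable f) (hψ : ψ ∈ toeplitzDomain h f) :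
    potential h (fun x => |f x|) ψ = 2 * potential h f⁺ ψ - potential h f ψ := by
  obtain ⟨h1, -, h3⟩ := (mem_toeplitzDomain_iff hf).1 hψ
  have ip := integrable_of_abs (measurable_posPart hf) (abs_posPart_le f) h1.isSmoothSection h3
  have ifi := integrable_of_abs hf (fun _ => le_rfl) h1.isSmoothSection h3
  rw [potential, potential, potential, ← integral_const_mul, ← integral_sub (ip.const_mul 2) ifi]
  refine integral_congr_ae (ae_of_all _ fun x => ?_)
  simp only [← posPart_apply_add_negPart f x]
  linear_combination -hSq h ψ x * posPart_apply_sub_negPart f x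

/-- A lower bound by the positive part controls `∫ |f| h(ψ,ψ) dm` by the form norm. -/
theorem potential_abs_le (hf : Measurable f) {κ b' c : ℝ} (hκ : κ < 1)
    (hψ : ψ ∈ toeplitzDomain h f) (hlow : c * normSq h ψ ≤ potential h f ψ)
    (hpos : (1 - κ) * potential h f⁺ ψ - b' * normSq h ψ ≤ potential h f ψ) :
    potential h (fun x => |f x|) ψ ≤ (2 * (1 + |b' - 1 + c|) / (1 - κ) + |1 - c|) *
      (potential h f ψ + (1 - c) * normSq h ψ) := by
  have h0 := normSq_nonneg h ψ
  have h1 : normSq h ψ ≤ potential h f ψ + (1 - c) * normSq h ψ := by linarith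
  set E := potential h f ψ + (1 - c) * normSq h ψ with hE
  have hκ' : 0 < 1 - κ := sub_pos.2 hκ
  have h2 : ∀ s : ℝ, s * normSq h ψ ≤ |s| * E := fun s =>
    (mul_le_mul_of_nonneg_right (le_abs_self s) h0).trans
      (mul_le_mul_of_nonneg_left h1 (abs_nonneg s))
  have h3 : potential h f⁺ ψ ≤ (1 + |b' - 1 + c|) * E / (1 - κ) := by
    rw [le_div_iff₀ hκ']
    linarith [h2 (b' - 1 + c)]
  rw [potential_abs_eq hf hψ]
  calc 2 * potential h f⁺ ψ - potential h f ψ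
      ≤ 2 * ((1 + |b' - 1 + c|) * E / (1 - κ)) + |1 - c| * E := by linarith [h2 (1 - c)]
    _ = _ := by ring

end Closed

end BerezinToeplitz

end

open BerezinToeplitz in
theorem mainTheorem4 {n : ℕ} {M : Type*} [MetricSpace M] [ChartedSpace (Cn n) M]
    [IsManifold 𝓘(ℂ, Cn n) ω M] [SecondCountableTopology M] [ConnectedSpace M]
    [MeasurableSpace M] [BorelSpace M]
    [RiemannianBundle (fun x : M => TangentSpace 𝓘(ℝ, Cn n) x)]
    [IsContMDiffRiemannianBundle 𝓘(ℝ, Cn n) ∞ (Cn n)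
      (fun x : M => TangentSpace 𝓘(ℝ, Cn n) x)]
    [IsRiemannianManifold 𝓘(ℝ, Cn n) M]
    (hK : IsKahler n M) [CompleteSpace M]
    {L : M → Type*} [∀ x, AddCommGroup (L x)] [∀ x, Module ℂ (L x)]
    [∀ x, TopologicalSpace (L x)] [TopologicalSpace (TotalSpace ℂ L)]
    [FiberBundle ℂ L] [VectorBundle ℂ ℂ L] [ContMDiffVectorBundle ω ℂ L 𝓘(ℂ, Cn n)]
    (h : HermitianMetric n L)
    (D : ℝ) (hD : 0 < D) (f : M → ℝ) (hf : Measurable f)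
    (c₁ c₂ : ℝ) (hc₁ : c₁ < 1)
    (hneg : ∀ ψ ∈ formCore h f, potentialENN h f⁻ ψ ≤
      ENNReal.ofReal (c₁ * bochnerSchrodinger h D f⁺ ψ + c₂ * normSq h ψ))
    (a b : ℝ)
    (hrho : ∀ ψ ∈ formCore h f, |potential h (fun x => D * rho h x) ψ| ≤
      a * bochnerSchrodinger h D f⁺ ψ + b * normSq h ψ)
    (κ b' : ℝ) (hκ : κ < 1)
    (hjoint : ∀ ψ ∈ formCore h f,
      potential h f⁻ ψ - potential h (fun x => D * rho h x) ψ ≤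
      κ * bochnerSchrodinger h D f⁺ ψ + b' * normSq h ψ) :
    (∃ c : ℝ, ∀ ψ ∈ formDomain h D f, ∀ u, FormApprox h D f ψ u →
      ∃ s : ℝ, Tendsto (fun l => holSchrodinger h (2 * D) f (u l)) atTop (𝓝 s) ∧
        c * normSq h ψ ≤ s) ∧
    IsSemibounded h (toeplitzDomain h f) (fun ψ => (toeplitzForm h f ψ ψ).re) ∧
    IsClosedForm h (toeplitzDomain h f) (fun ψ => (toeplitzForm h f ψ ψ).re) := by
  have key := fun ψ hψ => le_potential_of_mem (ψ := ψ) hK hD hf hneg hκ hjoint hψ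
  simp only [IsSemibounded, IsClosedForm, IsLowerBound, toeplitzForm_re]
  refine ⟨semibounded_holSchrodinger hK hD hf hneg hrho hκ hjoint, ⟨-b', fun ψ hψ => ?_⟩,
    fun c hlow u hu hc => isClosedForm_toeplitz hK hf hlow (fun ψ hψ =>
      potential_abs_le hf hκ hψ (hlow ψ hψ) (key ψ hψ)) hu hc⟩
  have h1 := mul_nonneg (sub_pos.2 hκ).le (potential_nonneg (h := h) (posPart_apply_nonneg f) ψ)
  linarith [key ψ hψ]
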